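/- Let $n\ge 3$. **Conventions.** A point $i$ on a single line carries a variable $x_i$ of degree $2$; a point $j$ on a double line carries variables $y_j$ of degree $2$ and $z_j$ of degree $4$. All rings are $\mathbb Z$-graded polynomial rings over $\mathbb Q$ in such variables, and a free graded module is one with a homogeneous basis (possibly infinite). In $M\{k\}$ the degrees of $M$ are raised by $k$. For $\omega\in R$, an object of $\mathrm{MF}^{gr}_{R,\omega}$ is a diagram $M_0\xrightarrow{d_0}M_1\xrightarrow{d_1}M_0$ of free graded $R$-modules with $d_0,d_1$ $R$-linear of degree $n+1$, $d_1d_0=\omega$ and $d_0d_1=\omega$; morphisms are pairs of degree-preserving $R$-linear maps commuting with the differentials. $\mathrm{HMF}^{gr}_{R,\omega}$ has the same objects, and morphisms modulo the null-homotopic ones $(h_1d_0+d_1h_0,\;h_0d_1+d_0h_1)$. Shifts and direct sums are formed termwise. The tensor product $M\boxtimes N$ has terms $(M_0\otimes N_0)\oplus(M_1\otimes N_1)$ and $(M_1\otimes N_0)\oplus(M_0\otimes N_1)$ and differentials $\begin{pmatrix}d_{M_0}&-d_{N_1}\\ d_{N_0}&d_{M_1}\end{pmatrix}$ and $\begin{pmatrix}d_{M_1}&d_{N_1}\\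 -d_{N_0}&d_{M_0}\end{pmatrix}$, where $d_{M_i},d_{N_i}$ act on their own tensor factor; the potentials add. For homogeneous $a,b$ with $\deg a+\deg b=2n+2$, put $$K(a;b)_R=\bigl(R\xrightarrow{\,a\,}R\{\tfrac12(\deg b-\deg a)\}\xrightarrow{\,b\,}R\bigr),$$ and let $K\left(\binom{a_1}{a_2};\binom{b_1}{b_2}\right)_R=K(a_1;b_1)_R\boxtimes K(a_2;b_2)_R$. Let $f(s,t)\in\mathbb Q[s,t]$ be the polynomial with $f(x+y,xy)=x^{n+1}+y^{n+1}$. For $s,s'\in R$ of degree $2$ and $t,t'\in R$ of degree $4$ let $$K(s,t\,|\,s',t')_R=K\left(\begin{pmatrix}\frac{f(s,t)-f(s',t)}{s-s'}\\[2pt] \frac{f(s',t)-f(s',t')}{t-t'}\end{pmatrix};\begin{pmatrix}s-s'\\ t-t'\end{pmatrix}\right)_R,$$ the left-hand entries (quotients of polynomials in independent variables, then evaluated) having degrees $2n$ and $2n-2$; the potential is $f(s,t)-f(s',t')$. Define * the double line from $(y_2,z_2)$ to $(y_1,z_1)$: $\;L^{1}_{2}=K(y_1,z_1\,|\,y_2,z_2)_{\mathbb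 Q[y_1,y_2,z_1,z_2]}$; * the trivalent diagram merging $x_1,x_2$ into $(y_3,z_3)$: $\;\Lambda_{\mathrm{in}}=K(y_3,z_3\,|\,x_1+x_2,x_1x_2)_{\mathbb Q[x_1,x_2,y_3,z_3]}$, with potential $f(y_3,z_3)-x_1^{n+1}-x_2^{n+1}$; * the trivalent diagram splitting $(y_3,z_3)$ into $x_1,x_2$: $\;\Lambda_{\mathrm{out}}=K(x_1+x_2,x_1x_2\,|\,y_3,z_3)_{\mathbb Q[x_1,x_2,y_3,z_3]}\{-1\}$, with potential $x_1^{n+1}+x_2^{n+1}-f(y_3,z_3)$; * the Khovanov–Rozansky wide edge from $x_3,x_4$ to $x_1,x_2$: $\;W=K(x_1+x_2,x_1x_2\,|\,x_3+x_4,x_3x_4)_{\mathbb Q[x_1,x_2,x_3,x_4]}\{-1\}$. Two diagrams are glued by identifying the variables of the glued end points, taking $\boxtimes$ over the polynomial ring in all variables, and regarding the result as a matrix factorization over the polynomial ring in the remaining boundary variables (the potential does not involve the variables of the glued points). **Proposition.** 1. Let $R$ be the polynomial ring in the variables of any set of points, let $\omega\in R$, and let $M$ be any object of $\mathrm{MF}^{gr}_{\mathbb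 Q[y,z]\otimes R,\;f(y,z)-\omega}$ (for instance that of a planar diagram with an outgoing double line ending at $(y,z)$). Rename $(y,z)$ in $M$ as $(y',z')$ and glue the double line from $(y',z')$ to $(y,z)$ to it at the inner marking $(y',z')$. The resulting matrix factorization $M|_{(y,z)\to(y',z')}\boxtimes K(y,z\,|\,y',z')$ is isomorphic to $M$ in $\mathrm{HMF}^{gr}_{\mathbb Q[y,z]\otimes R,\;f(y,z)-\omega}$. 2. Likewise, for any object $M$ of $\mathrm{MF}^{gr}_{\mathbb Q[y,z]\otimes R,\;\omega-f(y,z)}$, gluing to $M$ (with $(y,z)$ renamed $(y',z')$) the double line from $(y,z)$ to $(y',z')$ at the inner marking $(y',z')$ gives a matrix factorization isomorphic to $M$ in $\mathrm{HMF}^{gr}_{\mathbb Q[y,z]\otimes R,\;\omega-f(y,z)}$. 3. The double loop, i.e. $L^1_2$ with $(y_1,z_1)$ and $(y_2,z_2)$ identified, seen over $\mathbb Q$, satisfies in $\mathrm{HMF}^{gr}_{\mathbb Q,0}$ $$L^1_2\big|_{(y_1,z_1)=(y_2,z_2)}\;\simeq\;\bigl(J_{f(y,z)}\{4-2n\}\to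 0\to J_{f(y,z)}\{4-2n\}\bigr),\qquad J_{f(y,z)}=\mathbb Q[y,z]\big/\bigl\langle\tfrac{\partial f}{\partial y},\tfrac{\partial f}{\partial z}\bigr\rangle .$$ 4. Gluing $\Lambda_{\mathrm{in}}$ (from $x_3,x_4$ to $(y_1,z_1)$) and $\Lambda_{\mathrm{out}}$ (from $(y_2,z_2)$ to $x_3,x_4$) at the two points $x_3,x_4$ gives a matrix factorization isomorphic in $\mathrm{HMF}^{gr}_{\mathbb Q[y_1,y_2,z_1,z_2],\;f(y_1,z_1)-f(y_2,z_2)}$ to $$L^1_2\{-1\}\oplus L^1_2\{1\}.$$ 5. Gluing $\Lambda_{\mathrm{in}}$ (from $x_3,x_4$ to $(y_5,z_5)$) and $\Lambda_{\mathrm{out}}$ (from $(y_5,z_5)$ to $x_1,x_2$) at the point $(y_5,z_5)$ gives a matrix factorization isomorphic to $W$ in $\mathrm{HMF}^{gr}_{\mathbb Q[x_1,x_2,x_3,x_4],\;x_1^{n+1}+x_2^{n+1}-x_3^{n+1}-x_4^{n+1}}$. -/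

import Mathlib

open CategoryTheory TensorProduct

namespace MOY

noncomputable section

/-! ## Free graded modules over a graded ring -/

section Generic

set_option linter.unusedSectionVars false

variable {R : Type} [CommRing R] [Algebra ℚ R]

/-- `IsFreeGraded 𝒜 gr`: the module `M` over the graded ring `R = ⨁ 𝒜 j` is free, and `gr` is the
`ℤ`-grading of `M` for which some basis of `M` consists of homogeneous elements
(`b i` having degree `δ i`). -/
def IsFreeGraded (𝒜 : ℤ → Submodule ℚ R) {M : Type} [AddCommGroup M] [Module R M]
    (gr : ℤ → AddSubgroup M) : Prop :=
  ∃ (ι : Type) (b : Module.Basis ι R M) (δ : ι → ℤ),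
    ∀ (j : ℤ) (x : M), x ∈ gr j ↔ ∀ i, b.repr x i ∈ 𝒜 (j - δ i)

/-- A free `ℤ`-graded module, possibly of infinite rank. -/
structure GrMod (𝒜 : ℤ → Submodule ℚ R) where
  carrier : Type
  [acg : AddCommGroup carrier]
  [mod : Module R carrier]
  /-- `gr j` is the group of homogeneous elements of degree `j`. -/
  gr : ℤ → AddSubgroup carrier
  free : IsFreeGraded 𝒜 gr

attribute [instance] GrMod.acg GrMod.mod

instance (𝒜 : ℤ → Submodule ℚ R) : CoeSort (GrMod 𝒜) Type := ⟨GrMod.carrier⟩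

namespace GrMod

variable {𝒜 : ℤ → Submodule ℚ R}

/-- The grading shift `M{k}`: an element of degree `j` in `M` has degree `j + k` in `M{k}`. -/
def shift (M : GrMod 𝒜) (k : ℤ) : GrMod 𝒜 where
  carrier := M
  gr j := M.gr (j - k)
  free := by
    obtain ⟨ι, b, δ, h⟩ := M.free
    refine ⟨ι, b, fun i => δ i + k, fun j x => ?_⟩
    rw [h]
    simp only [sub_sub, add_comm]

/-- The zero module. -/
def zero (𝒜 : ℤ → Submodule ℚ R) : GrMod 𝒜 where
  carrier := PUnit
  gr _ := ⊤
  free := ⟨Empty, Module.Basis.empty _, fun _ => 0, fun j x => by simp⟩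

/-- The ring as a graded module over itself. -/
def self (𝒜 : ℤ → Submodule ℚ R) : GrMod 𝒜 where
  carrier := R
  gr j := (𝒜 j).toAddSubgroup
  free := ⟨Unit, Module.Basis.singleton Unit R, fun _ => 0, fun j x => by simp⟩

/-- The direct sum of two graded modules. -/
def prod (M N : GrMod 𝒜) : GrMod 𝒜 where
  carrier := M × N
  gr j := (M.gr j).prod (N.gr j)
  free := by
    obtain ⟨ι, b, δ, h⟩ := M.free
    obtain ⟨κ, c, ε, h'⟩ := N.free
    refine ⟨ι ⊕ κ, b.prod c, Sum.elim δ ε, fun j x => ?_⟩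
    rw [AddSubgroup.mem_prod, h, h', Sum.forall]
    simp

theorem closure_criterion {M : Type} [AddCommGroup M] [Module R M] {ι : Type}
    (b : Module.Basis ι R M) (δ : ι → ℤ) (T : Set M) (j : ℤ)
    (h1 : ∀ t ∈ T, ∀ i, b.repr t i ∈ 𝒜 (j - δ i))
    (h2 : ∀ i, ∀ r ∈ 𝒜 (j - δ i), r • b i ∈ T) (x : M) :
    x ∈ AddSubgroup.closure T ↔ ∀ i, b.repr x i ∈ 𝒜 (j - δ i) := by
  constructor
  · intro hx i
    induction hx using AddSubgroup.closure_induction with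
    | mem t ht => exact h1 t ht i
    | zero => simp
    | add x y _ _ hx hy => simpa using add_mem hx hy
    | neg x _ hx => simpa using neg_mem hx
  · intro hx
    rw [← b.linearCombination_repr x, Finsupp.linearCombination_apply]
    exact AddSubgroup.sum_mem _ fun i _ => AddSubgroup.subset_closure (h2 i _ (hx i))

theorem smul_basis_mem {M : GrMod 𝒜} {ι : Type} {b : Module.Basis ι R M} {δ : ι → ℤ}
    (h : ∀ (j : ℤ) (x : M), x ∈ M.gr j ↔ ∀ i, b.repr x i ∈ 𝒜 (j - δ i)) (i : ι) (k j : ℤ) (r : R)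
    (hr : r ∈ 𝒜 k) (hk : k + δ i = j) : r • b i ∈ M.gr j := by
  classical
  rw [h]
  intro i'
  rw [map_smul, b.repr_self, Finsupp.smul_apply, Finsupp.single_apply]
  split_ifs with hi
  · subst hi hk; simpa using hr
  · simp

variable [SetLike.GradedMonoid 𝒜]

/-- The tensor product of two graded modules over the graded ring: `m ⊗ n` has degree
`deg m + deg n`. -/
def tensor (M N : GrMod 𝒜) : GrMod 𝒜 where
  carrier := M ⊗[R] N
  gr j := AddSubgroup.closure
    {t | ∃ (k l : ℤ) (m : M) (n : N), k + l = j ∧ m ∈ M.gr k ∧ n ∈ N.gr l ∧ t = m ⊗ₜ[R] n}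
  free := by
    obtain ⟨ι, b, δ, h⟩ := M.free
    obtain ⟨κ, c, ε, h'⟩ := N.free
    refine ⟨ι × κ, b.tensorProduct c, fun p => δ p.1 + ε p.2, fun j x => ?_⟩
    refine closure_criterion _ _ _ _ ?_ ?_ x
    · rintro t ⟨k, l, m, n, rfl, hm, hn, rfl⟩ ⟨i, i'⟩
      rw [Module.Basis.tensorProduct_repr_tmul_apply, smul_eq_mul]
      have := SetLike.mul_mem_graded ((h' l n).1 hn i') ((h k m).1 hm i)
      convert this using 2
      ring
    · rintro ⟨i, i'⟩ r hr
      refine ⟨j - ε i', ε i', r • b i, c i', by ring, ?_, ?_, ?_⟩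
      · exact smul_basis_mem h i _ _ r hr (by simp only; ring)
      · simpa using smul_basis_mem h' i' 0 (ε i') 1 (SetLike.one_mem_graded 𝒜) (by ring)
      · rw [Module.Basis.tensorProduct_apply, smul_tmul']

variable {S : Type} [CommRing S] [Algebra ℚ S] {ℬ : ℤ → Submodule ℚ S} [SetLike.GradedMonoid ℬ]

/-- Base change `S ⊗_R M` along a homomorphism of graded rings `φ : R → S`. -/
def extend (φ : R →+* S) (hφ : ∀ j, ∀ r ∈ 𝒜 j, φ r ∈ ℬ j) (M : GrMod 𝒜) : GrMod ℬ :=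
  letI := φ.toAlgebra
  { carrier := S ⊗[R] M
    gr := fun j => AddSubgroup.closure
      {t | ∃ (k l : ℤ) (s : S) (m : M), k + l = j ∧ s ∈ ℬ k ∧ m ∈ M.gr l ∧ t = s ⊗ₜ[R] m}
    free := by
      obtain ⟨ι, b, δ, h⟩ := M.free
      refine ⟨ι, Algebra.TensorProduct.basis S b, δ, fun j x => ?_⟩
      refine closure_criterion _ _ _ _ ?_ ?_ x
      · rintro t ⟨k, l, s, m, rfl, hs, hm, rfl⟩ i
        rw [Algebra.TensorProduct.basis_repr_tmul, Finsupp.smul_apply, Finsupp.mapRange_apply,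
          smul_eq_mul, RingHom.algebraMap_toAlgebra]
        have := SetLike.mul_mem_graded hs (hφ _ _ ((h l m).1 hm i))
        convert this using 2
        ring
      · intro i r hr
        refine ⟨j - δ i, δ i, r, b i, by ring, hr, ?_, ?_⟩
        · simpa using smul_basis_mem h i 0 (δ i) 1 (SetLike.one_mem_graded 𝒜) (by ring)
        · rw [Algebra.TensorProduct.basis_apply, smul_tmul', smul_eq_mul, mul_one] }


/-- Restriction of scalars along a homomorphism of graded rings `φ : R → S`, for `S` free and graded
over `R`. -/
def restrict (φ : R →+* S)
    (hφ : letI := Module.compHom S φ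
      IsFreeGraded (R := R) (M := S) 𝒜 (fun j => (ℬ j).toAddSubgroup))
    (M : GrMod ℬ) : GrMod 𝒜 :=
  letI := φ.toAlgebra
  { carrier := M
    mod := Module.compHom M φ
    gr := M.gr
    free := by
      let _ := Module.compHom M φ
      have : IsScalarTower R S M := ⟨fun r s m => by
        rw [Algebra.smul_def, mul_smul]; rfl⟩
      obtain ⟨κ, c, ε, h'⟩ := hφ
      obtain ⟨ι, b, δ, h⟩ := M.free
      refine ⟨κ × ι, Module.Basis.smulTower (R := R) c b, fun p => δ p.2 + ε p.1, fun j x => ?_⟩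
      rw [h, Prod.forall, forall_comm]
      refine forall_congr' fun i => ?_
      have := h' (j - δ i) (b.repr x i)
      rw [Submodule.mem_toAddSubgroup] at this
      rw [this]
      refine forall_congr' fun k => ?_
      rw [Module.Basis.smulTower_repr_mk, sub_sub] }

end GrMod

/-! ## Graded matrix factorizations -/

/-- A graded matrix factorization with potential `ω` over the graded ring `R = ⨁ 𝒜 j`: free graded
modules `X0`, `X1` with `R`-linear maps `d0 : X0 → X1`, `d1 : X1 → X0`, homogeneous of degree `c`,
whose composites in both orders are multiplication by `ω`.  (If `ω` is nonzero and the
factorization is nonzero, then `ω` has degree `2 * c`.) -/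
structure MF (𝒜 : ℤ → Submodule ℚ R) (c : ℤ) (ω : R) where
  X0 : GrMod 𝒜
  X1 : GrMod 𝒜
  d0 : X0 →ₗ[R] X1
  d1 : X1 →ₗ[R] X0
  d0_mem : ∀ (j : ℤ), ∀ x ∈ X0.gr j, d0 x ∈ X1.gr (j + c)
  d1_mem : ∀ (j : ℤ), ∀ x ∈ X1.gr j, d1 x ∈ X0.gr (j + c)
  d1_d0 : ∀ x, d1 (d0 x) = ω • x
  d0_d1 : ∀ x, d0 (d1 x) = ω • x

namespace MF

variable {𝒜 : ℤ → Submodule ℚ R} {c : ℤ} {ω : R}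

/-- A morphism of graded matrix factorizations: a pair of `R`-linear maps that preserve the
`ℤ`-grading and commute with the differentials. -/
@[ext] structure Hom (M N : MF 𝒜 c ω) where
  f0 : M.X0 →ₗ[R] N.X0
  f1 : M.X1 →ₗ[R] N.X1
  f0_mem : ∀ (j : ℤ), ∀ x ∈ M.X0.gr j, f0 x ∈ N.X0.gr j
  f1_mem : ∀ (j : ℤ), ∀ x ∈ M.X1.gr j, f1 x ∈ N.X1.gr j
  comm0 : ∀ x, N.d0 (f0 x) = f1 (M.d0 x)
  comm1 : ∀ x, N.d1 (f1 x) = f0 (M.d1 x)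

/-- The category of graded matrix factorizations with potential `ω`. -/
instance : Category (MF 𝒜 c ω) where
  Hom := Hom
  id M :=
    { f0 := LinearMap.id, f1 := LinearMap.id
      f0_mem := fun _ _ h => h, f1_mem := fun _ _ h => h
      comm0 := fun _ => rfl, comm1 := fun _ => rfl }
  comp f g :=
    { f0 := g.f0 ∘ₗ f.f0, f1 := g.f1 ∘ₗ f.f1
      f0_mem := fun j x h => g.f0_mem j _ (f.f0_mem j x h)
      f1_mem := fun j x h => g.f1_mem j _ (f.f1_mem j x h)
      comm0 := fun x => by simp [g.comm0, f.comm0]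
      comm1 := fun x => by simp [g.comm1, f.comm1] }

/-- Two morphisms are homotopic if their difference is null-homotopic, i.e. of the form
`(h1 d0 + d1 h0, h0 d1 + d0 h1)`.  As the difference preserves the `ℤ`-grading, the maps `h0`, `h1`
may be taken homogeneous of degree `-c`. -/
def homotopic : HomRel (MF 𝒜 c ω) := fun M N f g =>
  ∃ (h0 : M.X0 →ₗ[R] N.X1) (h1 : M.X1 →ₗ[R] N.X0),
    (∀ (j : ℤ), ∀ x ∈ M.X0.gr j, h0 x ∈ N.X1.gr (j - c)) ∧
    (∀ (j : ℤ), ∀ x ∈ M.X1.gr j, h1 x ∈ N.X0.gr (j - c)) ∧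
    (∀ x, f.f0 x - g.f0 x = h1 (M.d0 x) + N.d1 (h0 x)) ∧
    (∀ x, f.f1 x - g.f1 x = h0 (M.d1 x) + N.d0 (h1 x))

/-- Homotopy is an equivalence relation compatible with composition. -/
instance : Congruence (homotopic (𝒜 := 𝒜) (c := c) (ω := ω)) where
  equivalence :=
    { refl := fun f => ⟨0, 0, fun _ _ _ => by simp, fun _ _ _ => by simp, fun _ => by simp,
        fun _ => by simp⟩
      symm := by
        rintro f g ⟨h0, h1, a, b, e0, e1⟩
        refine ⟨-h0, -h1, fun j x hx => ?_, fun j x hx => ?_, fun x => ?_, fun x => ?_⟩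
        · exact neg_mem (a j x hx)
        · exact neg_mem (b j x hx)
        · rw [← neg_sub, e0]; simp [add_comm]
        · rw [← neg_sub, e1]; simp [add_comm]
      trans := by
        rintro f g k ⟨h0, h1, a, b, e0, e1⟩ ⟨h0', h1', a', b', e0', e1'⟩
        refine ⟨h0 + h0', h1 + h1', fun j x hx => ?_, fun j x hx => ?_, fun x => ?_, fun x => ?_⟩
        · exact add_mem (a j x hx) (a' j x hx)
        · exact add_mem (b j x hx) (b' j x hx)
        · rw [← sub_add_sub_cancel _ (g.f0 x), e0, e0']
          simp only [LinearMap.add_apply, map_add]; abel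
        · rw [← sub_add_sub_cancel _ (g.f1 x), e1, e1']
          simp only [LinearMap.add_apply, map_add]; abel }
  comp_left := by
    rintro L M N f g g' ⟨h0, h1, a, b, e0, e1⟩
    refine ⟨h0 ∘ₗ f.f0, h1 ∘ₗ f.f1, fun j x hx => a j _ (f.f0_mem j x hx),
      fun j x hx => b j _ (f.f1_mem j x hx), fun x => ?_, fun x => ?_⟩
    · exact (e0 (f.f0 x)).trans (by rw [f.comm0]; rfl)
    · exact (e1 (f.f1 x)).trans (by rw [f.comm1]; rfl)
  comp_right := by
    rintro L M N f f' g ⟨h0, h1, a, b, e0, e1⟩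
    refine ⟨g.f1 ∘ₗ h0, g.f0 ∘ₗ h1, fun j x hx => g.f1_mem _ _ (a j x hx),
      fun j x hx => g.f0_mem _ _ (b j x hx), fun x => ?_, fun x => ?_⟩
    · refine (map_sub g.f0 _ _).symm.trans ?_
      rw [e0, map_add, ← g.comm1]; rfl
    · refine (map_sub g.f1 _ _).symm.trans ?_
      rw [e1, map_add, ← g.comm0]; rfl

end MF

/-- The homotopy category of graded matrix factorizations with potential `ω`: morphisms are
morphisms of graded matrix factorizations modulo homotopy. -/
abbrev HMF (𝒜 : ℤ → Submodule ℚ R) (c : ℤ) (ω : R) : Type 1 :=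
  Quotient (MF.homotopic (𝒜 := 𝒜) (c := c) (ω := ω))

namespace MF

variable {𝒜 : ℤ → Submodule ℚ R} {c : ℤ} {ω ω' : R}

/-- A graded matrix factorization as an object of the homotopy category. -/
abbrev toHMF (M : MF 𝒜 c ω) : HMF 𝒜 c ω := (Quotient.functor _).obj M

/-- The same matrix factorization, its potential being written differently. -/
def ofEq (h : ω = ω') (M : MF 𝒜 c ω) : MF 𝒜 c ω' :=
  { M with
    d1_d0 := h ▸ M.d1_d0
    d0_d1 := h ▸ M.d0_d1 }

/-- The grading shift `M{k}`. -/
def shift (M : MF 𝒜 c ω) (k : ℤ) : MF 𝒜 c ω where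
  X0 := M.X0.shift k
  X1 := M.X1.shift k
  d0 := M.d0
  d1 := M.d1
  d0_mem j x hx := by
    have := M.d0_mem (j - k) x hx
    rwa [sub_add_eq_add_sub] at this
  d1_mem j x hx := by
    have := M.d1_mem (j - k) x hx
    rwa [sub_add_eq_add_sub] at this
  d1_d0 := M.d1_d0
  d0_d1 := M.d0_d1

/-- The direct sum of two graded matrix factorizations. -/
def prod (M N : MF 𝒜 c ω) : MF 𝒜 c ω where
  X0 := M.X0.prod N.X0
  X1 := M.X1.prod N.X1
  d0 := LinearMap.prodMap M.d0 N.d0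
  d1 := LinearMap.prodMap M.d1 N.d1
  d0_mem j _ hx := ⟨M.d0_mem j _ hx.1, N.d0_mem j _ hx.2⟩
  d1_mem j _ hx := ⟨M.d1_mem j _ hx.1, N.d1_mem j _ hx.2⟩
  d1_d0 x := Prod.ext (M.d1_d0 x.1) (N.d1_d0 x.2)
  d0_d1 x := Prod.ext (M.d0_d1 x.1) (N.d0_d1 x.2)

variable [SetLike.GradedMonoid 𝒜]

theorem rTensor_mem {M M' N : GrMod 𝒜} (d : M →ₗ[R] M')
    (hd : ∀ (j : ℤ), ∀ x ∈ M.gr j, d x ∈ M'.gr (j + c)) (j : ℤ) (x : M ⊗[R] N)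
    (hx : x ∈ (M.tensor N).gr j) : d.rTensor N x ∈ (M'.tensor N).gr (j + c) := by
  induction hx using AddSubgroup.closure_induction with
  | mem t ht =>
    obtain ⟨k, l, m, n, rfl, hm, hn, rfl⟩ := ht
    exact AddSubgroup.subset_closure ⟨k + c, l, d m, n, by ring, hd _ _ hm, hn, by simp⟩
  | zero => rw [map_zero]; exact zero_mem _
  | add x y _ _ hx hy => rw [map_add]; exact add_mem hx hy
  | neg x _ hx => rw [map_neg]; exact neg_mem hx

theorem lTensor_mem {M N N' : GrMod 𝒜} (d : N →ₗ[R] N')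
    (hd : ∀ (j : ℤ), ∀ x ∈ N.gr j, d x ∈ N'.gr (j + c)) (j : ℤ) (x : M ⊗[R] N)
    (hx : x ∈ (M.tensor N).gr j) : d.lTensor M x ∈ (M.tensor N').gr (j + c) := by
  induction hx using AddSubgroup.closure_induction with
  | mem t ht =>
    obtain ⟨k, l, m, n, rfl, hm, hn, rfl⟩ := ht
    exact AddSubgroup.subset_closure ⟨k, l + c, m, d n, by ring, hm, hd _ _ hn, by simp⟩
  | zero => rw [map_zero]; exact zero_mem _
  | add x y _ _ hx hy => rw [map_add]; exact add_mem hx hy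
  | neg x _ hx => rw [map_neg]; exact neg_mem hx

theorem rTensor_rTensor {M M' N : Type} [AddCommGroup M] [AddCommGroup M'] [AddCommGroup N]
    [Module R M] [Module R M'] [Module R N] (d : M →ₗ[R] M') (d' : M' →ₗ[R] M)
    (h : ∀ x, d' (d x) = ω • x) (x : M ⊗[R] N) :
    d'.rTensor N (d.rTensor N x) = ω • x := by
  have : d' ∘ₗ d = ω • LinearMap.id := LinearMap.ext h
  rw [← LinearMap.comp_apply, ← LinearMap.rTensor_comp, this, LinearMap.rTensor_smul]
  simp

theorem lTensor_lTensor {M N N' : Type} [AddCommGroup M] [AddCommGroup N'] [AddCommGroup N]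
    [Module R M] [Module R N'] [Module R N] (d : N →ₗ[R] N') (d' : N' →ₗ[R] N)
    (h : ∀ x, d' (d x) = ω • x) (x : M ⊗[R] N) :
    d'.lTensor M (d.lTensor M x) = ω • x := by
  have : d' ∘ₗ d = ω • LinearMap.id := LinearMap.ext h
  rw [← LinearMap.comp_apply, ← LinearMap.lTensor_comp, this, LinearMap.lTensor_smul]
  simp

theorem lTensor_rTensor {M M' N N' : Type} [AddCommGroup M] [AddCommGroup M'] [AddCommGroup N]
    [AddCommGroup N'] [Module R M] [Module R M'] [Module R N] [Module R N']
    (d : M →ₗ[R] M') (e : N →ₗ[R] N') (x : M ⊗[R] N) :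
    e.lTensor M' (d.rTensor N x) = d.rTensor N' (e.lTensor M x) := by
  rw [← LinearMap.comp_apply, ← LinearMap.comp_apply, LinearMap.lTensor_comp_rTensor,
    LinearMap.rTensor_comp_lTensor]

theorem tensor_d1_d0 {M M' N N' : Type} [AddCommGroup M] [AddCommGroup M'] [AddCommGroup N]
    [AddCommGroup N'] [Module R M] [Module R M'] [Module R N] [Module R N']
    (d : M →ₗ[R] M') (d' : M' →ₗ[R] M) (e : N →ₗ[R] N') (e' : N' →ₗ[R] N)
    (h1 : ∀ x, d' (d x) = ω • x) (h2 : ∀ x, d (d' x) = ω • x)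
    (h3 : ∀ x, e' (e x) = ω' • x) (h4 : ∀ x, e (e' x) = ω' • x)
    (x : (M ⊗[R] N) × (M' ⊗[R] N')) :
    (((d'.rTensor N ∘ₗ LinearMap.fst R (M' ⊗[R] N) (M ⊗[R] N'))
      + (e'.lTensor M ∘ₗ LinearMap.snd R (M' ⊗[R] N) (M ⊗[R] N'))).prod
    (-(e.lTensor M' ∘ₗ LinearMap.fst R (M' ⊗[R] N) (M ⊗[R] N'))
      + (d.rTensor N' ∘ₗ LinearMap.snd R (M' ⊗[R] N) (M ⊗[R] N'))))
    ((((d.rTensor N ∘ₗ LinearMap.fst R (M ⊗[R] N) (M' ⊗[R] N'))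
      - (e'.lTensor M' ∘ₗ LinearMap.snd R (M ⊗[R] N) (M' ⊗[R] N'))).prod
    ((e.lTensor M ∘ₗ LinearMap.fst R (M ⊗[R] N) (M' ⊗[R] N'))
      + (d'.rTensor N' ∘ₗ LinearMap.snd R (M ⊗[R] N) (M' ⊗[R] N')))) x) = (ω + ω') • x := by
  obtain ⟨a, b⟩ := x
  refine Prod.ext ?_ ?_
  · simp only [LinearMap.prod_apply, Function.prod, LinearMap.sub_apply, LinearMap.add_apply,
      LinearMap.neg_apply, LinearMap.comp_apply, LinearMap.fst_apply, LinearMap.snd_apply,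
      map_sub, map_add, rTensor_rTensor d d' h1, lTensor_lTensor e e' h3, lTensor_rTensor,
      Prod.smul_fst, Prod.fst_add, add_smul]
    abel
  · simp only [LinearMap.prod_apply, Function.prod, LinearMap.sub_apply, LinearMap.add_apply,
      LinearMap.neg_apply, LinearMap.comp_apply, LinearMap.fst_apply, LinearMap.snd_apply,
      map_sub, map_add, rTensor_rTensor d' d h2, lTensor_lTensor e' e h4, lTensor_rTensor,
      Prod.smul_snd, Prod.snd_add, add_smul]
    abel

theorem tensor_d0_d1 {M M' N N' : Type} [AddCommGroup M] [AddCommGroup M'] [AddCommGroup N]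
    [AddCommGroup N'] [Module R M] [Module R M'] [Module R N] [Module R N']
    (d : M →ₗ[R] M') (d' : M' →ₗ[R] M) (e : N →ₗ[R] N') (e' : N' →ₗ[R] N)
    (h1 : ∀ x, d' (d x) = ω • x) (h2 : ∀ x, d (d' x) = ω • x)
    (h3 : ∀ x, e' (e x) = ω' • x) (h4 : ∀ x, e (e' x) = ω' • x)
    (x : (M' ⊗[R] N) × (M ⊗[R] N')) :
    (((d.rTensor N ∘ₗ LinearMap.fst R (M ⊗[R] N) (M' ⊗[R] N'))
      - (e'.lTensor M' ∘ₗ LinearMap.snd R (M ⊗[R] N) (M' ⊗[R] N'))).prod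
    ((e.lTensor M ∘ₗ LinearMap.fst R (M ⊗[R] N) (M' ⊗[R] N'))
      + (d'.rTensor N' ∘ₗ LinearMap.snd R (M ⊗[R] N) (M' ⊗[R] N'))))
    ((((d'.rTensor N ∘ₗ LinearMap.fst R (M' ⊗[R] N) (M ⊗[R] N'))
      + (e'.lTensor M ∘ₗ LinearMap.snd R (M' ⊗[R] N) (M ⊗[R] N'))).prod
    (-(e.lTensor M' ∘ₗ LinearMap.fst R (M' ⊗[R] N) (M ⊗[R] N'))
      + (d.rTensor N' ∘ₗ LinearMap.snd R (M' ⊗[R] N) (M ⊗[R] N')))) x) = (ω + ω') • x := by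
  obtain ⟨a, b⟩ := x
  refine Prod.ext ?_ ?_
  · simp only [LinearMap.prod_apply, Function.prod, LinearMap.sub_apply, LinearMap.add_apply,
      LinearMap.neg_apply, LinearMap.comp_apply, LinearMap.fst_apply, LinearMap.snd_apply,
      map_neg, map_add, rTensor_rTensor d' d h2, lTensor_lTensor e e' h3, lTensor_rTensor,
      Prod.smul_fst, Prod.fst_add, add_smul]
    abel
  · simp only [LinearMap.prod_apply, Function.prod, LinearMap.sub_apply, LinearMap.add_apply,
      LinearMap.neg_apply, LinearMap.comp_apply, LinearMap.fst_apply, LinearMap.snd_apply,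
      map_neg, map_add, rTensor_rTensor d d' h1, lTensor_lTensor e' e h4, lTensor_rTensor,
      Prod.smul_snd, Prod.snd_add, add_smul]
    abel

/-- The tensor product of graded matrix factorizations over a common ring. -/
def tensor (M : MF 𝒜 c ω) (N : MF 𝒜 c ω') : MF 𝒜 c (ω + ω') where
  X0 := (M.X0.tensor N.X0).prod (M.X1.tensor N.X1)
  X1 := (M.X1.tensor N.X0).prod (M.X0.tensor N.X1)
  d0 :=
    ((M.d0.rTensor N.X0 ∘ₗ LinearMap.fst R (M.X0 ⊗[R] N.X0) (M.X1 ⊗[R] N.X1))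
      - (N.d1.lTensor M.X1 ∘ₗ LinearMap.snd R (M.X0 ⊗[R] N.X0) (M.X1 ⊗[R] N.X1))).prod
    ((N.d0.lTensor M.X0 ∘ₗ LinearMap.fst R (M.X0 ⊗[R] N.X0) (M.X1 ⊗[R] N.X1))
      + (M.d1.rTensor N.X1 ∘ₗ LinearMap.snd R (M.X0 ⊗[R] N.X0) (M.X1 ⊗[R] N.X1)))
  d1 :=
    ((M.d1.rTensor N.X0 ∘ₗ LinearMap.fst R (M.X1 ⊗[R] N.X0) (M.X0 ⊗[R] N.X1))
      + (N.d1.lTensor M.X0 ∘ₗ LinearMap.snd R (M.X1 ⊗[R] N.X0) (M.X0 ⊗[R] N.X1))).prod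
    (-(N.d0.lTensor M.X1 ∘ₗ LinearMap.fst R (M.X1 ⊗[R] N.X0) (M.X0 ⊗[R] N.X1))
      + (M.d0.rTensor N.X1 ∘ₗ LinearMap.snd R (M.X1 ⊗[R] N.X0) (M.X0 ⊗[R] N.X1)))
  d0_mem j x hx :=
    ⟨AddSubgroup.sub_mem _ (rTensor_mem M.d0 M.d0_mem j x.1 hx.1)
        (lTensor_mem N.d1 N.d1_mem j x.2 hx.2),
      AddSubgroup.add_mem _ (lTensor_mem N.d0 N.d0_mem j x.1 hx.1)
        (rTensor_mem M.d1 M.d1_mem j x.2 hx.2)⟩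
  d1_mem j x hx :=
    ⟨AddSubgroup.add_mem _ (rTensor_mem M.d1 M.d1_mem j x.1 hx.1)
        (lTensor_mem N.d1 N.d1_mem j x.2 hx.2),
      AddSubgroup.add_mem _ (AddSubgroup.neg_mem _ (lTensor_mem N.d0 N.d0_mem j x.1 hx.1))
        (rTensor_mem M.d0 M.d0_mem j x.2 hx.2)⟩
  d1_d0 := tensor_d1_d0 M.d0 M.d1 N.d0 N.d1 M.d1_d0 M.d0_d1 N.d1_d0 N.d0_d1
  d0_d1 := tensor_d0_d1 M.d0 M.d1 N.d0 N.d1 M.d1_d0 M.d0_d1 N.d1_d0 N.d0_d1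

/-- The matrix factorization `K(a; b)_R = (R → R{(deg b - deg a) / 2} → R)` with potential `a * b`,
the maps being multiplication by `a` and by `b`.  Here `a` and `b` are homogeneous of degrees `α`
and `β`, and `α + β = 2 * c`. -/
def koszul (a b : R) (α β : ℤ) (ha : a ∈ 𝒜 α) (hb : b ∈ 𝒜 β) (h : α + β = 2 * c) :
    MF 𝒜 c (a * b) where
  X0 := GrMod.self 𝒜
  X1 := (GrMod.self 𝒜).shift ((β - α) / 2)
  d0 := LinearMap.mulLeft R a
  d1 := LinearMap.mulLeft R b
  d0_mem j (x : R) hx := by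
    change a * x ∈ 𝒜 (j + c - (β - α) / 2)
    have := SetLike.mul_mem_graded ha (show x ∈ 𝒜 j from hx)
    convert this using 2
    omega
  d1_mem j (x : R) hx := by
    change b * x ∈ 𝒜 (j + c)
    have := SetLike.mul_mem_graded hb (show x ∈ 𝒜 (j - (β - α) / 2) from hx)
    convert this using 2
    omega
  d1_d0 := fun (x : R) => show b * (a * x) = a * b * x by ring
  d0_d1 := fun (x : R) => show a * (b * x) = a * b * x by ring

variable {S : Type} [CommRing S] [Algebra ℚ S] {ℬ : ℤ → Submodule ℚ S} [SetLike.GradedMonoid ℬ]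

theorem baseChange_mem (φ : R →+* S) (hφ : ∀ j, ∀ r ∈ 𝒜 j, φ r ∈ ℬ j) {M N : GrMod 𝒜}
    (d : M →ₗ[R] N) (hd : ∀ (j : ℤ), ∀ x ∈ M.gr j, d x ∈ N.gr (j + c)) (j : ℤ) :
    letI := φ.toAlgebra
    ∀ x : S ⊗[R] M, x ∈ (M.extend φ hφ).gr j → d.baseChange S x ∈ (N.extend φ hφ).gr (j + c) := by
  let _ := φ.toAlgebra
  intro x hx
  induction hx using AddSubgroup.closure_induction with
  | mem t ht =>
    obtain ⟨k, l, s, m, rfl, hs, hm, rfl⟩ := ht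
    exact AddSubgroup.subset_closure ⟨k, l + c, s, d m, by ring, hs, hd _ _ hm, rfl⟩
  | zero => rw [map_zero]; exact zero_mem _
  | add x y _ _ hx hy => rw [map_add]; exact add_mem hx hy
  | neg x _ hx => rw [map_neg]; exact neg_mem hx

theorem baseChange_baseChange [Algebra R S] {M N : Type} [AddCommGroup M] [AddCommGroup N]
    [Module R M] [Module R N] (d : M →ₗ[R] N) (d' : N →ₗ[R] M) (h : ∀ x, d' (d x) = ω • x)
    (x : S ⊗[R] M) : d'.baseChange S (d.baseChange S x) = algebraMap R S ω • x := by
  have : d' ∘ₗ d = ω • LinearMap.id := LinearMap.ext h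
  rw [← LinearMap.comp_apply, ← LinearMap.baseChange_comp, this, LinearMap.baseChange_smul]
  simp

/-- Base change of a graded matrix factorization along a homomorphism of graded rings. -/
def extend (φ : R →+* S) (hφ : ∀ j, ∀ r ∈ 𝒜 j, φ r ∈ ℬ j) (M : MF 𝒜 c ω) : MF ℬ c (φ ω) :=
  letI := φ.toAlgebra
  { X0 := M.X0.extend φ hφ
    X1 := M.X1.extend φ hφ
    d0 := M.d0.baseChange S
    d1 := M.d1.baseChange S
    d0_mem := baseChange_mem φ hφ M.d0 M.d0_mem
    d1_mem := baseChange_mem φ hφ M.d1 M.d1_mem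
    d1_d0 := baseChange_baseChange M.d0 M.d1 M.d1_d0
    d0_d1 := baseChange_baseChange M.d1 M.d0 M.d0_d1 }

/-- Restriction of scalars of a graded matrix factorization along a homomorphism of graded rings
`φ : R → S`, when the potential comes from `R`. -/
def restrict (φ : R →+* S)
    (hφ : letI := Module.compHom S φ
      IsFreeGraded (R := R) (M := S) 𝒜 (fun j => (ℬ j).toAddSubgroup))
    (M : MF ℬ c (φ ω)) : MF 𝒜 c ω where
  X0 := M.X0.restrict φ hφ
  X1 := M.X1.restrict φ hφ
  d0 :=
    { toFun := M.d0
      map_add' := M.d0.map_add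
      map_smul' := fun r x => M.d0.map_smul (φ r) x }
  d1 :=
    { toFun := M.d1
      map_add' := M.d1.map_add
      map_smul' := fun r x => M.d1.map_smul (φ r) x }
  d0_mem := M.d0_mem
  d1_mem := M.d1_mem
  d1_d0 := M.d1_d0
  d0_d1 := M.d0_d1

end MF
end Generic

/-! ## The graded polynomial rings attached to boundary points -/

/-- The variables attached to a set `S` of points on single lines and a set `D` of points on double
lines: `x s` for `s` in `S`, and the pair `y d`, `z d` for `d` in `D`. -/
inductive BVar (S D : Type) : Type
  | x (s : S)
  | y (d : D)
  | z (d : D)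

/-- The degrees of the variables: `2` for `x` and `y`, and `4` for `z`. -/
def BVar.wt {S D : Type} : BVar S D → ℤ
  | x _ => 2
  | y _ => 2
  | z _ => 4

/-- Relabelling of the points. -/
def BVar.map {S D S' D' : Type} (s : S → S') (d : D → D') : BVar S D → BVar S' D'
  | x i => x (s i)
  | y i => y (d i)
  | z i => z (d i)

theorem BVar.wt_map {S D S' D' : Type} (s : S → S') (d : D → D') (v : BVar S D) :
    (v.map s d).wt = v.wt := by cases v <;> rfl

/-- The polynomial ring over `ℚ` in the variables attached to the points `S` and `D`. -/
abbrev BRing (S D : Type) : Type := MvPolynomial (BVar S D) ℚ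

/-- The `ℤ`-grading of the polynomial ring. -/
def grade (S D : Type) : ℤ → Submodule ℚ (BRing S D) :=
  MvPolynomial.weightedHomogeneousSubmodule ℚ BVar.wt

instance (S D : Type) : SetLike.GradedMonoid (grade S D) :=
  MvPolynomial.WeightedHomogeneousSubmodule.gradedMonoid

/-- The ring homomorphism that relabels (and possibly identifies) the points. -/
def relabel {S D S' D' : Type} (s : S → S') (d : D → D') : BRing S D →+* BRing S' D' :=
  (MvPolynomial.rename (BVar.map s d)).toRingHom

theorem map_mem_of_weights {σ B : Type} [CommRing B] [Algebra ℚ B] (ℬ : ℤ → Submodule ℚ B)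
    [SetLike.GradedMonoid ℬ] (w : σ → ℤ) (φ : MvPolynomial σ ℚ →ₐ[ℚ] B)
    (hφ : ∀ i, φ (MvPolynomial.X i) ∈ ℬ (w i)) (j : ℤ) (p : MvPolynomial σ ℚ)
    (hp : MvPolynomial.IsWeightedHomogeneous w p j) : φ p ∈ ℬ j := by
  induction hp using MvPolynomial.IsWeightedHomogeneous.induction_on with
  | zero => simp
  | add p q _ _ hp hq => rw [map_add]; exact add_mem hp hq
  | monomial d r hr =>
    rw [MvPolynomial.monomial_eq, ← MvPolynomial.algebraMap_eq, ← Algebra.smul_def, map_smul,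
      Finsupp.prod, map_prod]
    refine Submodule.smul_mem _ _ ?_
    rw [← hr, Finsupp.weight_apply, Finsupp.sum]
    refine SetLike.prod_mem_graded _ _ _ fun i _ => ?_
    rw [map_pow]
    exact SetLike.pow_mem_graded _ (hφ i)

theorem relabel_mem {S D S' D' : Type} (s : S → S') (d : D → D') (j : ℤ) (p : BRing S D)
    (hp : p ∈ grade S D j) : relabel s d p ∈ grade S' D' j := by
  refine map_mem_of_weights (grade S' D') BVar.wt (MvPolynomial.rename (BVar.map s d)) ?_ j p hp
  intro i
  rw [MvPolynomial.rename_X, ← BVar.wt_map s d]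
  exact MvPolynomial.isWeightedHomogeneous_X ℚ BVar.wt (i.map s d)

/-! ### Polynomial rings are free and graded over the ring of some of the variables -/

/-- Splitting the variables. -/
def BVar.split (S D S' D' : Type) : BVar (S ⊕ S') (D ⊕ D') ≃ BVar S' D' ⊕ BVar S D where
  toFun
    | x (.inl i) => .inr (x i)
    | x (.inr i) => .inl (x i)
    | y (.inl i) => .inr (y i)
    | y (.inr i) => .inl (y i)
    | z (.inl i) => .inr (z i)
    | z (.inr i) => .inl (z i)
  invFun := Sum.elim (BVar.map Sum.inr Sum.inr) (BVar.map Sum.inl Sum.inl)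
  left_inv v := by rcases v with (i | i) | (i | i) | (i | i) <;> rfl
  right_inv v := by rcases v with (i | i | i) | (i | i | i) <;> rfl

def splitRing (S D S' D' : Type) :
    BRing (S ⊕ S') (D ⊕ D') ≃ₐ[ℚ] MvPolynomial (BVar S' D') (BRing S D) :=
  (MvPolynomial.renameEquiv ℚ (BVar.split S D S' D')).trans
    (MvPolynomial.sumAlgEquiv ℚ (BVar S' D') (BVar S D))

/-- The total degree on the iterated polynomial ring. -/
def iterGrade (S D S' D' : Type) (j : ℤ) : Submodule ℚ (MvPolynomial (BVar S' D') (BRing S D)) where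
  carrier := {q | ∀ m, q.coeff m ∈ grade S D (j - Finsupp.weight BVar.wt m)}
  zero_mem' m := by simp
  add_mem' hp hq m := by rw [MvPolynomial.coeff_add]; exact add_mem (hp m) (hq m)
  smul_mem' r q hq m := by rw [MvPolynomial.coeff_smul]; exact Submodule.smul_mem _ _ (hq m)

instance (S D S' D' : Type) : SetLike.GradedMonoid (iterGrade S D S' D') where
  one_mem m := by
    classical
    rw [MvPolynomial.coeff_one]
    split_ifs with h
    · subst h; simpa using SetLike.one_mem_graded (grade S D)
    · exact zero_mem _
  mul_mem i j p q hp hq m := by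
    classical
    rw [MvPolynomial.coeff_mul]
    refine Submodule.sum_mem _ fun a ha => ?_
    rw [Finset.HasAntidiagonal.mem_antidiagonal] at ha
    have := SetLike.mul_mem_graded (hp a.1) (hq a.2)
    convert this using 2
    rw [← ha, map_add]
    ring

theorem splitRing_relabel (S D S' D' : Type) (r : BRing S D) :
    splitRing S D S' D' (relabel Sum.inl Sum.inl r) = MvPolynomial.C r := by
  have : ((splitRing S D S' D').toAlgHom.comp (MvPolynomial.rename (BVar.map Sum.inl Sum.inl))) =
      (IsScalarTower.toAlgHom ℚ (BRing S D) (MvPolynomial (BVar S' D') (BRing S D))) := by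
    refine MvPolynomial.algHom_ext fun v => ?_
    cases v <;> simp [splitRing, BVar.split, BVar.map, MvPolynomial.algebraMap_eq]
  exact DFunLike.congr_fun this r

theorem splitRing_monomial (S D S' D' : Type) (m : BVar S' D' →₀ ℕ) :
    splitRing S D S' D' (relabel Sum.inr Sum.inr (MvPolynomial.monomial m 1)) =
      MvPolynomial.monomial m 1 := by
  have : ((splitRing S D S' D').toAlgHom.comp (MvPolynomial.rename (BVar.map Sum.inr Sum.inr))) =
      MvPolynomial.mapAlgHom (Algebra.ofId ℚ (BRing S D)) := by
    refine MvPolynomial.algHom_ext fun v => ?_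
    cases v <;> simp [splitRing, BVar.split, BVar.map]
  refine (DFunLike.congr_fun this _).trans ?_
  simp

theorem splitRing_mem (S D S' D' : Type) (j : ℤ) (p : BRing (S ⊕ S') (D ⊕ D')) :
    p ∈ grade (S ⊕ S') (D ⊕ D') j ↔
      ∀ m, (splitRing S D S' D' p).coeff m ∈ grade S D (j - Finsupp.weight BVar.wt m) := by
  classical
  constructor
  · intro hp
    refine map_mem_of_weights (iterGrade S D S' D') BVar.wt (splitRing S D S' D').toAlgHom ?_ j p hp
    have hX : ∀ v : BVar S' D', (MvPolynomial.X v : MvPolynomial (BVar S' D') (BRing S D)) ∈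
        iterGrade S D S' D' v.wt := by
      intro v m
      rw [MvPolynomial.coeff_X]
      split_ifs with h
      · subst h
        simpa [Finsupp.weight_single] using SetLike.one_mem_graded (grade S D)
      · exact zero_mem _
    have hC : ∀ v : BVar S D, (MvPolynomial.C (MvPolynomial.X v) :
        MvPolynomial (BVar S' D') (BRing S D)) ∈ iterGrade S D S' D' v.wt := by
      intro v m
      rw [MvPolynomial.coeff_C]
      split_ifs with h
      · subst h
        rw [map_zero, sub_zero]
        exact MvPolynomial.isWeightedHomogeneous_X ℚ BVar.wt v
      · exact zero_mem _
    rintro ((i | i) | (i | i) | (i | i))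
    · simpa [splitRing, BVar.split, BVar.wt] using hC (.x i)
    · simpa [splitRing, BVar.split, BVar.wt] using hX (.x i)
    · simpa [splitRing, BVar.split, BVar.wt] using hC (.y i)
    · simpa [splitRing, BVar.split, BVar.wt] using hX (.y i)
    · simpa [splitRing, BVar.split, BVar.wt] using hC (.z i)
    · simpa [splitRing, BVar.split, BVar.wt] using hX (.z i)
  · intro h
    rw [← (splitRing S D S' D').symm_apply_apply p]
    generalize splitRing S D S' D' p = q at h
    rw [q.as_sum, map_sum]
    refine Submodule.sum_mem _ fun m _ => ?_
    have e : MvPolynomial.monomial m (q.coeff m) = splitRing S D S' D'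
        (relabel Sum.inl Sum.inl (q.coeff m) *
          relabel Sum.inr Sum.inr (MvPolynomial.monomial m 1)) := by
      rw [map_mul, splitRing_relabel, splitRing_monomial, MvPolynomial.C_mul_monomial, mul_one]
    rw [e, AlgEquiv.symm_apply_apply]
    have := SetLike.mul_mem_graded (relabel_mem (Sum.inl (β := S')) (Sum.inl (β := D')) _ _ (h m))
      (relabel_mem (Sum.inr (α := S)) (Sum.inr (α := D)) _ _
        (MvPolynomial.isWeightedHomogeneous_monomial (R := ℚ) BVar.wt m 1 rfl))
    rwa [sub_add_cancel] at this

theorem relabel_free (S D S' D' : Type) :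
    letI := Module.compHom (BRing (S ⊕ S') (D ⊕ D'))
      (relabel (Sum.inl : S → S ⊕ S') (Sum.inl : D → D ⊕ D'))
    IsFreeGraded (M := BRing (S ⊕ S') (D ⊕ D')) (grade S D)
      (fun j => (grade (S ⊕ S') (D ⊕ D') j).toAddSubgroup) := by
  let _ := Module.compHom (BRing (S ⊕ S') (D ⊕ D'))
    (relabel (Sum.inl : S → S ⊕ S') (Sum.inl : D → D ⊕ D'))
  let e : BRing (S ⊕ S') (D ⊕ D') ≃ₗ[BRing S D] MvPolynomial (BVar S' D') (BRing S D) :=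
    { (splitRing S D S' D').toAddEquiv with
      map_smul' := fun r p => by
        change splitRing S D S' D' (relabel Sum.inl Sum.inl r * p) = r • splitRing S D S' D' p
        rw [map_mul, splitRing_relabel, MvPolynomial.smul_eq_C_mul] }
  exact ⟨_, (MvPolynomial.basisMonomials _ _).map e.symm, fun m => Finsupp.weight BVar.wt m,
    fun j p => splitRing_mem S D S' D' j p⟩

/-- Graded matrix factorizations over the polynomial ring of the points `S`, `D`. -/
abbrev MFgr (S D : Type) (c : ℤ) (ω : BRing S D) : Type 1 := MF (grade S D) c ω

/-- The homotopy category of graded matrix factorizations over the polynomial ring of the points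
`S`, `D`. -/
abbrev HMFgr (S D : Type) (c : ℤ) (ω : BRing S D) : Type 1 := HMF (grade S D) c ω

/-! ## Gluing -/

/-- Relabelling of the points of a matrix factorization (base change along `relabel s d`).  Points
with the same image are identified. -/
def MFgr.relabel {S D S' D' : Type} {c : ℤ} {ω : BRing S D} (M : MFgr S D c ω) (s : S → S')
    (d : D → D') : MFgr S' D' c (MOY.relabel s d ω) :=
  MF.extend (MOY.relabel s d) (relabel_mem s d) M

/-- A matrix factorization over the polynomial ring of the points `S ⊕ S'`, `D ⊕ D'`, seen as a
matrix factorization over the polynomial ring of the points `S`, `D` only, provided that the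
potential does not involve the variables of the inner points `S'`, `D'`. -/
def MFgr.toBoundary {S D S' D' : Type} {c : ℤ} {ω' : BRing (S ⊕ S') (D ⊕ D')}
    (M : MFgr (S ⊕ S') (D ⊕ D') c ω') (ω : BRing S D)
    (h : ω' = MOY.relabel Sum.inl Sum.inl ω) : MFgr S D c ω :=
  MF.restrict (MOY.relabel Sum.inl Sum.inl) (relabel_free S D S' D') (MF.ofEq h M)

/-- The matrix factorization of the diagram that is obtained from two diagrams by gluing: the points
of the two diagrams are mapped to boundary points `S`, `D` or inner points `S'`, `D'` of the new
diagram, and we take the tensor product over the polynomial ring of all these points, seen over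
the polynomial ring of the boundary points. -/
def glue {S₁ D₁ S₂ D₂ S D S' D' : Type} {c : ℤ} {ω₁ : BRing S₁ D₁} {ω₂ : BRing S₂ D₂}
    (M : MFgr S₁ D₁ c ω₁) (s₁ : S₁ → S ⊕ S') (d₁ : D₁ → D ⊕ D')
    (N : MFgr S₂ D₂ c ω₂) (s₂ : S₂ → S ⊕ S') (d₂ : D₂ → D ⊕ D')
    (ω : BRing S D) (h : relabel s₁ d₁ ω₁ + relabel s₂ d₂ ω₂ = relabel Sum.inl Sum.inl ω) :
    MFgr S D c ω :=
  MFgr.toBoundary ((M.relabel s₁ d₁).tensor (N.relabel s₂ d₂)) ω h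

/-! ## The potential and its difference quotients -/

section Potential

variable {A B : Type} [CommRing A] [CommRing B]

/-- The power sum `a ^ k + b ^ k` as a polynomial in `s = a + b` and `t = a * b`. -/
def powerSum (s t : A) : ℕ → A
  | 0 => 2
  | 1 => s
  | k + 2 => s * powerSum s t (k + 1) - t * powerSum s t k

theorem powerSum_add_mul (a b : A) : ∀ k, powerSum (a + b) (a * b) k = a ^ k + b ^ k
  | 0 => by rw [powerSum]; norm_num
  | 1 => by rw [powerSum]; ring
  | k + 2 => by
    rw [powerSum, powerSum_add_mul a b (k + 1), powerSum_add_mul a b k]; ring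

theorem map_powerSum (φ : A →+* B) (s t : A) : ∀ k, φ (powerSum s t k) = powerSum (φ s) (φ t) k
  | 0 => by rw [powerSum, powerSum]; exact map_ofNat φ 2
  | 1 => by rw [powerSum, powerSum]
  | k + 2 => by
    rw [powerSum, powerSum, map_sub, map_mul, map_mul, map_powerSum φ s t (k + 1),
      map_powerSum φ s t k]

/-- The polynomial `f`, with `f (a + b, a * b) = a ^ (n + 1) + b ^ (n + 1)`. -/
def f (n : ℕ) (s t : A) : A := powerSum s t (n + 1)

theorem f_add_mul (n : ℕ) (a b : A) : f n (a + b) (a * b) = a ^ (n + 1) + b ^ (n + 1) :=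
  powerSum_add_mul a b (n + 1)

theorem map_f (φ : A →+* B) (n : ℕ) (s t : A) : φ (f n s t) = f n (φ s) (φ t) :=
  map_powerSum φ s t (n + 1)

/-- The polynomial `(p (s, t) - p (s', t)) / (s - s')`, where `p` is the `k`-th power sum. -/
def quotFst (s s' t : A) : ℕ → A
  | 0 => 0
  | 1 => 1
  | k + 2 => powerSum s t (k + 1) + s' * quotFst s s' t (k + 1) - t * quotFst s s' t k

/-- The polynomial `(p (s, t) - p (s, t')) / (t - t')`, where `p` is the `k`-th power sum. -/
def quotSnd (s t t' : A) : ℕ → A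
  | 0 => 0
  | 1 => 0
  | k + 2 => s * quotSnd s t t' (k + 1) - (powerSum s t k + t' * quotSnd s t t' k)

theorem quotFst_mul (s s' t : A) :
    ∀ k, quotFst s s' t k * (s - s') = powerSum s t k - powerSum s' t k
  | 0 => by simp [quotFst, powerSum]
  | 1 => by simp [quotFst, powerSum]
  | k + 2 => by
    rw [quotFst, powerSum, powerSum]
    linear_combination s' * quotFst_mul s s' t (k + 1) - t * quotFst_mul s s' t k

theorem quotSnd_mul (s t t' : A) :
    ∀ k, quotSnd s t t' k * (t - t') = powerSum s t k - powerSum s t' k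
  | 0 => by simp [quotSnd, powerSum]
  | 1 => by simp [quotSnd, powerSum]
  | k + 2 => by
    rw [quotSnd, powerSum, powerSum]
    linear_combination s * quotSnd_mul s t t' (k + 1) - t' * quotSnd_mul s t t' k

/-- The polynomial `(f (s, t) - f (s', t)) / (s - s')`. -/
def fQuotFst (n : ℕ) (s s' t : A) : A := quotFst s s' t (n + 1)

/-- The polynomial `(f (s, t) - f (s, t')) / (t - t')`. -/
def fQuotSnd (n : ℕ) (s t t' : A) : A := quotSnd s t t' (n + 1)

theorem fQuotFst_mul (n : ℕ) (s s' t : A) : fQuotFst n s s' t * (s - s') = f n s t - f n s' t :=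
  quotFst_mul s s' t (n + 1)

theorem fQuotSnd_mul (n : ℕ) (s t t' : A) : fQuotSnd n s t t' * (t - t') = f n s t - f n s t' :=
  quotSnd_mul s t t' (n + 1)

variable [Algebra ℚ A] {𝒜 : ℤ → Submodule ℚ A} [SetLike.GradedMonoid 𝒜]

theorem mul_mem_of_eq {a b : A} {i j k : ℤ} (ha : a ∈ 𝒜 i) (hb : b ∈ 𝒜 j) (h : i + j = k) :
    a * b ∈ 𝒜 k := h ▸ SetLike.mul_mem_graded ha hb

theorem powerSum_mem {s t : A} (hs : s ∈ 𝒜 2) (ht : t ∈ 𝒜 4) : ∀ k : ℕ, powerSum s t k ∈ 𝒜 (2 * k)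
  | 0 => by
    have := Submodule.smul_mem (𝒜 0) (2 : ℚ) (SetLike.one_mem_graded 𝒜)
    rw [Algebra.smul_def, mul_one, map_ofNat] at this
    simpa [powerSum] using this
  | 1 => by simpa [powerSum] using hs
  | k + 2 => by
    rw [powerSum]
    refine sub_mem (mul_mem_of_eq hs (powerSum_mem hs ht (k + 1)) ?_)
      (mul_mem_of_eq ht (powerSum_mem hs ht k) ?_) <;> push_cast <;> ring

theorem quotFst_mem {s s' t : A} (hs : s ∈ 𝒜 2) (hs' : s' ∈ 𝒜 2) (ht : t ∈ 𝒜 4) :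
    ∀ k : ℕ, quotFst s s' t k ∈ 𝒜 (2 * k - 2)
  | 0 => by rw [quotFst]; exact zero_mem _
  | 1 => by simpa [quotFst] using SetLike.one_mem_graded 𝒜
  | k + 2 => by
    rw [quotFst]
    refine sub_mem (add_mem ?_ (mul_mem_of_eq hs' (quotFst_mem hs hs' ht (k + 1)) ?_))
      (mul_mem_of_eq ht (quotFst_mem hs hs' ht k) ?_)
    · convert powerSum_mem hs ht (k + 1) using 2
      push_cast; ring
    · push_cast; ring
    · push_cast; ring

theorem quotSnd_mem {s t t' : A} (hs : s ∈ 𝒜 2) (ht : t ∈ 𝒜 4) (ht' : t' ∈ 𝒜 4) :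
    ∀ k : ℕ, quotSnd s t t' k ∈ 𝒜 (2 * k - 4)
  | 0 => by rw [quotSnd]; exact zero_mem _
  | 1 => by rw [quotSnd]; exact zero_mem _
  | k + 2 => by
    rw [quotSnd]
    refine sub_mem (mul_mem_of_eq hs (quotSnd_mem hs ht ht' (k + 1)) ?_)
      (add_mem ?_ (mul_mem_of_eq ht' (quotSnd_mem hs ht ht' k) ?_))
    · push_cast; ring
    · convert powerSum_mem hs ht k using 2
      push_cast; ring
    · push_cast; ring

end Potential

/-! ## The matrix factorizations of the elementary diagrams -/

section Elementary

variable {S D : Type}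

/-- The variable `x` of a point on a single line. -/
def X (i : S) : BRing S D := MvPolynomial.X (BVar.x i)

/-- The variable `y` of a point on a double line. -/
def Y (i : D) : BRing S D := MvPolynomial.X (BVar.y i)

/-- The variable `z` of a point on a double line. -/
def Z (i : D) : BRing S D := MvPolynomial.X (BVar.z i)

theorem X_mem (i : S) : (X i : BRing S D) ∈ grade S D 2 :=
  MvPolynomial.isWeightedHomogeneous_X ℚ BVar.wt (BVar.x i)

theorem Y_mem (i : D) : (Y i : BRing S D) ∈ grade S D 2 :=
  MvPolynomial.isWeightedHomogeneous_X ℚ BVar.wt (BVar.y i)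

theorem Z_mem (i : D) : (Z i : BRing S D) ∈ grade S D 4 :=
  MvPolynomial.isWeightedHomogeneous_X ℚ BVar.wt (BVar.z i)

theorem X_add_X_mem (i j : S) : (X i + X j : BRing S D) ∈ grade S D 2 := add_mem (X_mem i) (X_mem j)

theorem X_mul_X_mem (i j : S) : (X i * X j : BRing S D) ∈ grade S D 4 :=
  SetLike.mul_mem_graded (X_mem i) (X_mem j)

section
variable {S' D' : Type} (s : S → S') (d : D → D')

theorem relabel_X (i : S) : relabel s d (X i) = X (s i) := MvPolynomial.rename_X _ _

theorem relabel_Y (i : D) : relabel s d (Y i) = Y (d i) := MvPolynomial.rename_X _ _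

theorem relabel_Z (i : D) : relabel s d (Z i) = Z (d i) := MvPolynomial.rename_X _ _

theorem relabel_relabel {S'' D'' : Type} (s' : S' → S'') (d' : D' → D'') (p : BRing S D) :
    relabel s' d' (relabel s d p) = relabel (s' ∘ s) (d' ∘ d) p := by
  refine (MvPolynomial.rename_rename _ _ p).trans ?_
  have : BVar.map s' d' ∘ BVar.map s d = BVar.map (s' ∘ s) (d' ∘ d) := by
    funext v; cases v <;> rfl
  rw [this]; rfl

end

/-- The Koszul matrix factorization with the two rows
`((f(s,t) - f(s',t)) / (s - s') ; s - s')` and `((f(s',t) - f(s',t')) / (t - t') ; t - t')`, where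
`s`, `s'` have degree `2` and `t`, `t'` have degree `4`.  The left entries have degrees `2 * n` and
`2 * n - 2`, and the potential is `f(s,t) - f(s',t')`. -/
def twoRow (n : ℕ) (s t s' t' : BRing S D) (hs : s ∈ grade S D 2) (ht : t ∈ grade S D 4)
    (hs' : s' ∈ grade S D 2) (ht' : t' ∈ grade S D 4) :
    MFgr S D (n + 1) (f n s t - f n s' t') :=
  MF.ofEq (by rw [fQuotFst_mul, fQuotSnd_mul]; ring)
    (MF.tensor
      (MF.koszul (fQuotFst n s s' t) (s - s') (2 * n) 2
        (by rw [fQuotFst]; convert quotFst_mem hs hs' ht (n + 1) using 2; push_cast; ring)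
        (sub_mem hs hs') (by ring))
      (MF.koszul (fQuotSnd n s' t t') (t - t') (2 * n - 2) 4
        (by rw [fQuotSnd]; convert quotSnd_mem hs' ht ht' (n + 1) using 2; push_cast; ring)
        (sub_mem ht ht') (by ring)))

/-- The double line directed from the point `1` to the point `0`. -/
def doubleLine (n : ℕ) :
    MFgr Empty (Fin 2) (n + 1) (f n (Y 0) (Z 0) - f n (Y 1) (Z 1)) :=
  twoRow n (Y 0) (Z 0) (Y 1) (Z 1) (Y_mem 0) (Z_mem 0) (Y_mem 1) (Z_mem 1)

/-- The trivalent diagram with two single lines, starting at the points `0` and `1`, which merge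
into a double line. -/
def trivalentIn (n : ℕ) :
    MFgr (Fin 2) Unit (n + 1) (f n (Y ()) (Z ()) - X 0 ^ (n + 1) - X 1 ^ (n + 1)) :=
  MF.ofEq (by rw [f_add_mul]; ring)
    (twoRow n (Y ()) (Z ()) (X 0 + X 1) (X 0 * X 1)
      (Y_mem ()) (Z_mem ()) (X_add_X_mem 0 1) (X_mul_X_mem 0 1))

/-- The trivalent diagram with a double line which splits into two single lines, ending at the
points `0` and `1`. -/
def trivalentOut (n : ℕ) :
    MFgr (Fin 2) Unit (n + 1) (X 0 ^ (n + 1) + X 1 ^ (n + 1) - f n (Y ()) (Z ())) :=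
  MF.ofEq (by rw [f_add_mul])
    ((twoRow n (X 0 + X 1) (X 0 * X 1) (Y ()) (Z ())
      (X_add_X_mem 0 1) (X_mul_X_mem 0 1) (Y_mem ()) (Z_mem ())).shift (-1))

/-- The wide edge of Khovanov and Rozansky, with the single lines starting at the points `2` and `3`
and the single lines ending at the points `0` and `1`. -/
def wideEdge (n : ℕ) :
    MFgr (Fin 4) Empty (n + 1)
      (X 0 ^ (n + 1) + X 1 ^ (n + 1) - X 2 ^ (n + 1) - X 3 ^ (n + 1)) :=
  MF.ofEq (by rw [f_add_mul, f_add_mul]; ring)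
    ((twoRow n (X 0 + X 1) (X 0 * X 1) (X 2 + X 3) (X 2 * X 3)
      (X_add_X_mem 0 1) (X_mul_X_mem 0 1) (X_add_X_mem 2 3) (X_mul_X_mem 2 3)).shift (-1))

end Elementary

/-! ## The glued diagrams -/

/-- A diagram `M` with a double line leaving it at the point `Sum.inr ()`, prolonged by a double line
which is glued to it at that point: the gluing point becomes an inner point, and the head of the
double line is the new boundary point `Sum.inr ()`. -/
def prolongOut {S D : Type} (n : ℕ) (ω : BRing S D)
    (M : MFgr S (D ⊕ Unit) (n + 1)
      (f n (Y (Sum.inr ())) (Z (Sum.inr ())) - relabel id Sum.inl ω)) :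
    MFgr S (D ⊕ Unit) (n + 1) (f n (Y (Sum.inr ())) (Z (Sum.inr ())) - relabel id Sum.inl ω) :=
  glue (S := S) (S' := Empty) (D := D ⊕ Unit) (D' := Unit)
    M Sum.inl (Sum.elim (fun i => Sum.inl (Sum.inl i)) Sum.inr)
    (doubleLine n) Empty.elim ![Sum.inl (Sum.inr ()), Sum.inr ()] _
    (by
      simp only [map_sub, map_f, relabel_Y, relabel_Z, relabel_relabel, Sum.elim_inr]
      simp [Function.comp_def])

/-- A diagram `M` with a double line entering it at the point `Sum.inr ()`, prolonged by a double
line which is glued to it at that point: the gluing point becomes an inner point, and the tail of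
the double line is the new boundary point `Sum.inr ()`. -/
def prolongIn {S D : Type} (n : ℕ) (ω : BRing S D)
    (M : MFgr S (D ⊕ Unit) (n + 1)
      (relabel id Sum.inl ω - f n (Y (Sum.inr ())) (Z (Sum.inr ())))) :
    MFgr S (D ⊕ Unit) (n + 1) (relabel id Sum.inl ω - f n (Y (Sum.inr ())) (Z (Sum.inr ()))) :=
  glue (S := S) (S' := Empty) (D := D ⊕ Unit) (D' := Unit)
    (doubleLine n) Empty.elim ![Sum.inr (), Sum.inl (Sum.inr ())]
    M Sum.inl (Sum.elim (fun i => Sum.inl (Sum.inl i)) Sum.inr) _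
    (by
      simp only [map_sub, map_f, relabel_Y, relabel_Z, relabel_relabel, Sum.elim_inr]
      simp [Function.comp_def])

/-- The double loop: the two ends of a double line are identified to one inner point. -/
def doubleLoop (n : ℕ) : MFgr Empty Empty (n + 1) 0 :=
  MFgr.toBoundary (S' := Empty) (D' := Unit)
    ((doubleLine n).relabel Empty.elim (fun _ => Sum.inr ())) 0
    (by simp [map_f, relabel_Y, relabel_Z])

/-- The bubble: a double line which comes from the point `1`, splits into two single lines with
inner points `0` and `1`, which merge again into a double line ending at the point `0`. -/
def bubble (n : ℕ) : MFgr Empty (Fin 2) (n + 1) (f n (Y 0) (Z 0) - f n (Y 1) (Z 1)) :=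
  glue (S := Empty) (S' := Fin 2) (D := Fin 2) (D' := Empty)
    (trivalentIn n) Sum.inr (fun _ => Sum.inl 0)
    (trivalentOut n) Sum.inr (fun _ => Sum.inl 1) _
    (by
      simp only [map_sub, map_add, map_pow, map_f, relabel_X, relabel_Y, relabel_Z]
      ring)

/-- Two single lines, starting at the points `2` and `3`, which merge into a double line with one
inner point, which splits into two single lines ending at the points `0` and `1`. -/
def mergeSplit (n : ℕ) :
    MFgr (Fin 4) Empty (n + 1)
      (X 0 ^ (n + 1) + X 1 ^ (n + 1) - X 2 ^ (n + 1) - X 3 ^ (n + 1)) :=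
  glue (S := Fin 4) (S' := Empty) (D := Empty) (D' := Unit)
    (trivalentIn n) ![Sum.inl 2, Sum.inl 3] Sum.inr
    (trivalentOut n) ![Sum.inl 0, Sum.inl 1] Sum.inr _
    (by
      simp only [map_sub, map_add, map_pow, map_f, relabel_X, relabel_Y, relabel_Z]
      simp
      ring)

/-! ## The Jacobi algebra -/

theorem exists_homogeneous_basis {σ : Type} (w : σ → ℤ) (I : Ideal (MvPolynomial σ ℚ))
    (hI : ∀ p ∈ I, ∀ j, MvPolynomial.weightedHomogeneousComponent w j p ∈ I) :
    ∃ (ι : Type) (b : Module.Basis ι ℚ (MvPolynomial σ ℚ ⧸ I)) (δ : ι → ℤ),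
      ∀ (j : ℤ) (x : MvPolynomial σ ℚ ⧸ I),
        (∃ p, MvPolynomial.IsWeightedHomogeneous w p j ∧ Ideal.Quotient.mk I p = x) ↔
          ∀ i, b.repr x i ≠ 0 → δ i = j := by
  classical
  let π : MvPolynomial σ ℚ →ₗ[ℚ] MvPolynomial σ ℚ ⧸ I := (Ideal.Quotient.mkₐ ℚ I).toLinearMap
  have hπ : ∀ p, π p = Ideal.Quotient.mk I p := fun p => rfl
  let s : Set (MvPolynomial σ ℚ ⧸ I) :=
    Set.range fun d : σ →₀ ℕ => π (MvPolynomial.monomial d 1)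
  have hs : Submodule.span ℚ s = ⊤ := by
    have h1 := (MvPolynomial.basisMonomials σ ℚ).span_eq
    have h2 : s = π '' Set.range (MvPolynomial.basisMonomials σ ℚ) := by
      rw [← Set.range_comp]; simp [s, Function.comp_def]
    rw [h2, Submodule.span_image, h1, Submodule.map_top, LinearMap.range_eq_top]
    exact Ideal.Quotient.mk_surjective
  obtain ⟨t, hts, htspan, hti⟩ := exists_linearIndependent ℚ s
  let b : Module.Basis t ℚ (MvPolynomial σ ℚ ⧸ I) :=
    Module.Basis.mk hti (by rw [Subtype.range_coe, htspan, hs])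
  have hb : ∀ i, b i = i := fun i => by simp [b]
  choose e he using fun i : t => hts i.2
  have he' : ∀ i, π (MvPolynomial.monomial (e i) 1) = b i := fun i => (he i).trans (hb i).symm
  refine ⟨t, b, fun i => Finsupp.weight w (e i), fun j x => ⟨?_, ?_⟩⟩
  · rintro ⟨p, hp, rfl⟩ i
    let c := b.repr (Ideal.Quotient.mk I p)
    let m : t → MvPolynomial σ ℚ := fun i => MvPolynomial.monomial (e i) (c i)
    have hm : ∀ i, π (m i) = c i • b i := fun i => by
      rw [← he', ← map_smul, MvPolynomial.smul_monomial]; simp [m]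
    have hsum : ∑ i ∈ c.support, c i • b i = π p := by
      have := b.linearCombination_repr (π p)
      rwa [Finsupp.linearCombination_apply] at this
    have hmem : p - ∑ i ∈ c.support, m i ∈ I := by
      rw [← Ideal.Quotient.eq_zero_iff_mem, ← hπ, map_sub, map_sum]
      simp only [hm, hsum, sub_self]
    have hcomp := hI _ hmem j
    rw [map_sub, map_sum, MvPolynomial.weightedHomogeneousComponent_eq_self hp] at hcomp
    have hcm : ∀ i, MvPolynomial.weightedHomogeneousComponent w j (m i) =
        if Finsupp.weight w (e i) = j then m i else 0 := fun i =>
      MvPolynomial.weightedHomogeneousComponent_of_mem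
        (MvPolynomial.isWeightedHomogeneous_monomial w (e i) (c i) rfl) |>.trans (by
          simp only [eq_comm, m])
    simp only [hcm] at hcomp
    rw [← Ideal.Quotient.eq_zero_iff_mem, ← hπ, map_sub, map_sum, sub_eq_zero] at hcomp
    have hrepr := congrArg (fun x => b.repr x i) hcomp
    intro hi
    by_contra hne
    apply hi
    refine hrepr.trans ?_
    simp only [map_sum, Finsupp.finsetSum_apply]
    refine Finset.sum_eq_zero fun k _ => ?_
    split_ifs with hk
    · rw [hm, map_smul, b.repr_self, Finsupp.smul_apply, Finsupp.single_apply, if_neg, smul_zero]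
      rintro rfl
      exact hne hk
    · simp
  · intro h
    refine ⟨∑ i ∈ (b.repr x).support, MvPolynomial.monomial (e i) (b.repr x i), ?_, ?_⟩
    · refine MvPolynomial.IsWeightedHomogeneous.sum _ _ _ fun i hi => ?_
      exact MvPolynomial.isWeightedHomogeneous_monomial _ _ _ (h i (Finsupp.mem_support_iff.1 hi))
    · rw [← hπ, map_sum]
      conv_rhs => rw [← b.linearCombination_repr x, Finsupp.linearCombination_apply]
      refine Finset.sum_congr rfl fun i _ => ?_
      change _ = b.repr x i • b i
      rw [← he', ← map_smul, MvPolynomial.smul_monomial]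
      simp

/-- The Jacobian ideal of a polynomial, generated by its partial derivatives. -/
def jacobianIdeal {σ : Type} (p : MvPolynomial σ ℚ) : Ideal (MvPolynomial σ ℚ) :=
  Ideal.span (Set.range fun i => MvPolynomial.pderiv i p)

/-- The Jacobi algebra of a polynomial. -/
abbrev Jacobi {σ : Type} (p : MvPolynomial σ ℚ) : Type := MvPolynomial σ ℚ ⧸ jacobianIdeal p

theorem jacobianIdeal_component_mem {σ : Type} (w : σ → ℤ) (p : MvPolynomial σ ℚ) (k : ℤ)
    (hp : MvPolynomial.IsWeightedHomogeneous w p k) (q : MvPolynomial σ ℚ)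
    (hq : q ∈ jacobianIdeal p) (j : ℤ) :
    MvPolynomial.weightedHomogeneousComponent w j q ∈ jacobianIdeal p := by
  let _ := MvPolynomial.weightedGradedAlgebra ℚ w
  refine MvPolynomial.weightedHomogeneousComponent_mem_of_mem ℚ w ?_ hq j
  refine Ideal.homogeneous_span _ _ ?_
  rintro _ ⟨i, rfl⟩
  exact ⟨k - w i, hp.pderiv (sub_add_cancel _ _)⟩

/-- The Jacobi algebra of a homogeneous polynomial `p` in the variables of `S`, `D`, as a graded
module over `ℚ`, the polynomial ring of the empty set of points. -/
def jacobiMod {S D : Type} (p : BRing S D) (k : ℤ) (hp : p ∈ grade S D k) :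
    GrMod (grade Empty Empty) where
  carrier := Jacobi p
  mod := Module.compHom (Jacobi p)
    ((Ideal.Quotient.mk (jacobianIdeal p)).comp (relabel Empty.elim Empty.elim))
  gr j := ((grade S D j).map (Ideal.Quotient.mkₐ ℚ (jacobianIdeal p)).toLinearMap).toAddSubgroup
  free := by
    have : IsEmpty (BVar Empty Empty) := ⟨fun v => by cases v <;> exact Empty.elim ‹_›⟩
    obtain ⟨ι, b, δ, h⟩ := exists_homogeneous_basis BVar.wt (jacobianIdeal p)
      (jacobianIdeal_component_mem BVar.wt p k hp)
    let _ := Module.compHom (Jacobi p)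
      ((Ideal.Quotient.mk (jacobianIdeal p)).comp (relabel Empty.elim Empty.elim))
    refine ⟨ι, b.mapCoeffs (MvPolynomial.isEmptyRingEquiv ℚ (BVar Empty Empty)).symm ?_, δ, ?_⟩
    · intro c x
      change Ideal.Quotient.mk (jacobianIdeal p) (relabel Empty.elim Empty.elim
        (MvPolynomial.C c)) * x = c • x
      rw [show relabel Empty.elim Empty.elim (MvPolynomial.C c) = (MvPolynomial.C c : BRing S D) from
        MvPolynomial.rename_C _ _]
      obtain ⟨q, rfl⟩ := Ideal.Quotient.mk_surjective x
      rw [← map_mul, MvPolynomial.C_mul']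
      rfl
    · intro j x
      refine (h j x).trans (forall_congr' fun i => ?_)
      change _ ↔ (MvPolynomial.C (b.repr x i) : BRing Empty Empty) ∈ grade Empty Empty (j - δ i)
      constructor
      · intro h'
        by_cases h0 : b.repr x i = 0
        · rw [h0, map_zero]; exact zero_mem _
        · rw [h' h0, sub_self]; exact MvPolynomial.isWeightedHomogeneous_C _ _
      · intro h' h0
        by_contra hne
        apply h0
        have := MvPolynomial.IsWeightedHomogeneous.inj_right (R := ℚ) (w := BVar.wt)
          (φ := (MvPolynomial.C (b.repr x i) : BRing Empty Empty))
          (by rwa [Ne, MvPolynomial.C_eq_zero]) h' (MvPolynomial.isWeightedHomogeneous_C _ _)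
        omega

theorem f_mem (n : ℕ) :
    f n (Y ()) (Z ()) ∈ grade Empty Unit (2 * n + 2) := by
  rw [f]
  convert powerSum_mem (Y_mem (S := Empty) ()) (Z_mem ()) (n + 1) using 2
  push_cast; ring

/-- The graded matrix factorization `J{4 - 2 n} → 0 → J{4 - 2 n}` over `ℚ` with potential `0`, where
`J` is the Jacobi algebra of the polynomial `f(y,z)` in two variables `y` and `z`. -/
def jacobiFactorization (n : ℕ) : MFgr Empty Empty (n + 1) 0 where
  X0 := (jacobiMod (f n (Y ()) (Z ())) (2 * n + 2) (f_mem n)).shift (4 - 2 * n)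
  X1 := GrMod.zero _
  d0 := 0
  d1 := 0
  d0_mem j x _ := zero_mem _
  d1_mem j x _ := zero_mem _
  d1_d0 x := by simp
  d0_d1 x := by simp

end
end MOY

open MOY CategoryTheory

/-! Everything rests on the elimination of Koszul rows. Let `R` be the ring of all variables of a
glued diagram and `T` the ring of its boundary variables. Let `N` be a factorization over `R`,
tensored with a Koszul factorization with rows `(a₁, a₂; b₁, b₂)`, and suppose that `b₁`, `b₂` is a
regular sequence with quotient `S`. Then the projection to Koszul degree zero, followed by reduction
to `S`, is a homotopy equivalence over `T` from the tensor product to the base change of `N` to `S`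
(`nonempty_iso_elimination`).

The reason is a perturbation argument. If the differential of `N` and the `aᵢ` are discarded, what
remains is the Koszul complex of `b₁`, `b₂` on `N`, a resolution of the reduced module. It does not
split over `R`, but all its terms and the reduced module are free over `T`. Graded projectivity
therefore yields a homogeneous `T`-linear contraction (`exists_koszul_homotopy`). Once the discarded
terms are restored, the contraction is wrong by an error that strictly raises the Koszul degree.
There are only three Koszul degrees, so on the kernel of the projection the error has cube zero and
a geometric series corrects the contraction (`nonempty_iso_of_nilpotent`). A termwise split
surjection with contractible kernel is a homotopy equivalence, even if the splitting does not
commute with the differentials (`nonempty_iso_of_contraction`).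

For a prolongation, the rows of the double line are `±(y' - y)` and `±(z' - z)`; eliminating the
inner variables returns `M`. For merge and split, the rows of the splitting vertex eliminate the
inner double point, and the merging vertex becomes the wide edge. For the bubble, the same rows
eliminate the boundary variables `y₂`, `z₂` in favour of the elementary symmetric functions of the
two inner points. What remains is the merging vertex, which is the base change of the double line
along the inclusion of symmetric functions. That extension is free with basis `1`, `x₃` in degrees
`0` and `2`, so restriction of scalars doubles the double line; the shift by `-1` of the splitting
vertex makes the result symmetric.

For the double loop both `bᵢ` vanish, and the factorization folds the Koszul complex of the partial
derivatives of `f`. Up to nonzero rational factors these are consecutive complete symmetric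
polynomials, which are coprime by Euclid's algorithm applied to their recursion. Hence the complex
resolves the Jacobi algebra (`nonempty_iso_ofEven`), placed in the copy of the ring that is shifted
by `(1 - n) + (3 - n) = 4 - 2n`.

Base changes are recognised by what they do to homogeneous bases (`SemiHom.IsExt`), which avoids
explicit isomorphisms of iterated tensor products. -/

namespace MOY
noncomputable section

/-! ### Graded lifting, strict isomorphisms and homotopy equivalences of factorizations. -/

section Generic

variable {R : Type} [CommRing R] [Algebra ℚ R] {𝒜 : ℤ → Submodule ℚ R} {c : ℤ}

/-! ## Homogeneous bases -/

/-- The basis `b`, with `b i` in degree `δ i`, determines the grading `gr`. -/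
def IsHomogeneousBasis (𝒜 : ℤ → Submodule ℚ R) {M : Type} [AddCommGroup M] [Module R M]
    (gr : ℤ → AddSubgroup M) {ι : Type} (b : Module.Basis ι R M) (δ : ι → ℤ) : Prop :=
  ∀ (j : ℤ) (x : M), x ∈ gr j ↔ ∀ i, b.repr x i ∈ 𝒜 (j - δ i)

theorem GrMod.basis_mem [SetLike.GradedMonoid 𝒜] {M : GrMod 𝒜} {ι : Type}
    {b : Module.Basis ι R M} {δ : ι → ℤ} (h : IsHomogeneousBasis 𝒜 M.gr b δ) (i : ι) :
    b i ∈ M.gr (δ i) := by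
  simpa using smul_basis_mem h i 0 (δ i) 1 (SetLike.one_mem_graded 𝒜) (by ring)

theorem GrMod.smul_mem [SetLike.GradedMonoid 𝒜] {M : GrMod 𝒜} {i j : ℤ} {r : R} {x : M}
    (hr : r ∈ 𝒜 i) (hx : x ∈ M.gr j) : r • x ∈ M.gr (i + j) := by
  obtain ⟨ι, b, δ, h⟩ := M.free
  rw [h] at hx ⊢
  intro k
  rw [map_smul, Finsupp.smul_apply, smul_eq_mul]
  convert SetLike.mul_mem_graded hr (hx k) using 2
  ring

theorem GrMod.smul_mem_of_eq [SetLike.GradedMonoid 𝒜] {M : GrMod 𝒜} {i j k : ℤ} {r : R} {x : M}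
    (hr : r ∈ 𝒜 i) (hx : x ∈ M.gr j) (h : i + j = k) : r • x ∈ M.gr k :=
  h ▸ GrMod.smul_mem hr hx

/-- Free graded modules are graded projective. -/
theorem GrMod.exists_lift [SetLike.GradedMonoid 𝒜] {P X Y : GrMod 𝒜} (k : ℤ) (f : P →ₗ[R] X)
    (g : Y →ₗ[R] X) (h : ∀ (j : ℤ), ∀ x ∈ P.gr j, ∃ y ∈ Y.gr (j + k), g y = f x) :
    ∃ s : P →ₗ[R] Y, (∀ (j : ℤ), ∀ x ∈ P.gr j, s x ∈ Y.gr (j + k)) ∧ ∀ x, g (s x) = f x := by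
  obtain ⟨ι, b, δ, hb⟩ := P.free
  choose y hy hgy using fun i => h (δ i) (b i) (basis_mem hb i)
  refine ⟨b.constr R y, fun j x hx => ?_, fun x => ?_⟩
  · rw [Module.Basis.constr_apply]
    refine AddSubgroup.sum_mem _ fun i _ => ?_
    exact GrMod.smul_mem_of_eq ((hb j x).1 hx i) (hy i) (by ring)
  · have : g ∘ₗ b.constr R y = f := b.ext fun i => by simp [hgy]
    exact DFunLike.congr_fun this x

/-- Coordinatewise solutions of a linear problem assemble to a homogeneous element. As the basis may
be infinite, `0` has to be a solution outside a finite set of coordinates. -/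
theorem GrMod.exists_of_coords [SetLike.GradedMonoid 𝒜] {M : GrMod 𝒜} {ι : Type}
    {b : Module.Basis ι R M} {δ : ι → ℤ} (hb : IsHomogeneousBasis 𝒜 M.gr b δ) (j : ℤ)
    (s : Finset ι) (p : ι → R → Prop) (h : ∀ i, ∃ r ∈ 𝒜 (j - δ i), p i r)
    (h0 : ∀ i ∉ s, p i 0) : ∃ x ∈ M.gr j, ∀ i, p i (b.repr x i) := by
  classical
  choose r hr hp using h
  have key : ∀ i, b.repr (∑ k ∈ s, r k • b k) i = if i ∈ s then r i else 0 := by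
    intro i
    simp [Finsupp.finsetSum_apply, Finsupp.single_apply]
  refine ⟨∑ k ∈ s, r k • b k, (hb _ _).2 fun i => ?_, fun i => ?_⟩
  · rw [key]; split_ifs
    · exact hr i
    · exact zero_mem _
  · rw [key]; split_ifs with hi
    · exact hp i
    · exact h0 i hi

namespace MF

variable {ω ω' ω'' : R}

/-! ## Strict isomorphisms -/

/-- An isomorphism of graded matrix factorizations whose potentials may be written differently. -/
structure GEquiv (M : MF 𝒜 c ω) (N : MF 𝒜 c ω') where
  e0 : M.X0 ≃ₗ[R] N.X0
  e1 : M.X1 ≃ₗ[R] N.X1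
  mem0 : ∀ (j : ℤ) (x : M.X0), e0 x ∈ N.X0.gr j ↔ x ∈ M.X0.gr j
  mem1 : ∀ (j : ℤ) (x : M.X1), e1 x ∈ N.X1.gr j ↔ x ∈ M.X1.gr j
  comm0 : ∀ x, N.d0 (e0 x) = e1 (M.d0 x)
  comm1 : ∀ x, N.d1 (e1 x) = e0 (M.d1 x)

namespace GEquiv

/-- The identity isomorphism. -/
def refl (M : MF 𝒜 c ω) : GEquiv M M :=
  ⟨.refl _ _, .refl _ _, fun _ _ => Iff.rfl, fun _ _ => Iff.rfl, fun _ => rfl, fun _ => rfl⟩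

/-- The inverse of an isomorphism. -/
def symm {M : MF 𝒜 c ω} {N : MF 𝒜 c ω'} (e : GEquiv M N) : GEquiv N M where
  e0 := e.e0.symm
  e1 := e.e1.symm
  mem0 j x := by rw [← e.mem0, e.e0.apply_symm_apply]
  mem1 j x := by rw [← e.mem1, e.e1.apply_symm_apply]
  comm0 x := by rw [LinearEquiv.eq_symm_apply, ← e.comm0, e.e0.apply_symm_apply]
  comm1 x := by rw [LinearEquiv.eq_symm_apply, ← e.comm1, e.e1.apply_symm_apply]

/-- The composition of two isomorphisms. -/
def trans {M : MF 𝒜 c ω} {N : MF 𝒜 c ω'} {L : MF 𝒜 c ω''} (e : GEquiv M N) (e' : GEquiv N L) :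
    GEquiv M L where
  e0 := e.e0.trans e'.e0
  e1 := e.e1.trans e'.e1
  mem0 j x := (e'.mem0 j _).trans (e.mem0 j x)
  mem1 j x := (e'.mem1 j _).trans (e.mem1 j x)
  comm0 x := (e'.comm0 _).trans (congrArg e'.e1 (e.comm0 x))
  comm1 x := (e'.comm1 _).trans (congrArg e'.e0 (e.comm1 x))

/-- Transport along an equality of potentials does not change a factorization. -/
def ofEq (h : ω = ω') (M : MF 𝒜 c ω) : GEquiv (MF.ofEq h M) M :=
  ⟨.refl _ _, .refl _ _, fun _ _ => Iff.rfl, fun _ _ => Iff.rfl, fun _ => rfl, fun _ => rfl⟩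

/-- The shift of an isomorphism. -/
def shift {M : MF 𝒜 c ω} {N : MF 𝒜 c ω'} (e : GEquiv M N) (k : ℤ) :
    GEquiv (M.shift k) (N.shift k) where
  e0 := e.e0
  e1 := e.e1
  mem0 j x := e.mem0 (j - k) x
  mem1 j x := e.mem1 (j - k) x
  comm0 := e.comm0
  comm1 := e.comm1

/-- The direct sum of two isomorphisms. -/
def prod {M M' : MF 𝒜 c ω} {N N' : MF 𝒜 c ω'} (e : GEquiv M N) (e' : GEquiv M' N') :
    GEquiv (M.prod M') (N.prod N') where
  e0 := e.e0.prodCongr e'.e0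
  e1 := e.e1.prodCongr e'.e1
  mem0 j x := and_congr (e.mem0 j x.1) (e'.mem0 j x.2)
  mem1 j x := and_congr (e.mem1 j x.1) (e'.mem1 j x.2)
  comm0 x := Prod.ext (e.comm0 x.1) (e'.comm0 x.2)
  comm1 x := Prod.ext (e.comm1 x.1) (e'.comm1 x.2)

/-- A strict isomorphism as a morphism. -/
def hom {M N : MF 𝒜 c ω} (e : GEquiv M N) : M ⟶ N :=
  ({ f0 := e.e0, f1 := e.e1
     f0_mem := fun j x h => (e.mem0 j x).2 h
     f1_mem := fun j x h => (e.mem1 j x).2 h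
     comm0 := e.comm0, comm1 := e.comm1 } : Hom M N)

theorem nonempty_iso {M N : MF 𝒜 c ω} (e : GEquiv M N) : Nonempty (M.toHMF ≅ N.toHMF) := by
  refine ⟨(Quotient.functor _).mapIso ⟨e.hom, e.symm.hom, ?_, ?_⟩⟩
  · refine Hom.ext ?_ ?_
    · exact LinearMap.ext fun x => e.e0.symm_apply_apply x
    · exact LinearMap.ext fun x => e.e1.symm_apply_apply x
  · refine Hom.ext ?_ ?_
    · exact LinearMap.ext fun x => e.e0.apply_symm_apply x
    · exact LinearMap.ext fun x => e.e1.apply_symm_apply x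

end GEquiv

/-! ## Homotopy equivalences -/

/-- A termwise split surjection with contractible kernel is a homotopy equivalence. -/
theorem nonempty_iso_of_contraction {P Q : MF 𝒜 c ω} (F : Hom P Q)
    (σ0 : Q.X0 →ₗ[R] P.X0) (σ1 : Q.X1 →ₗ[R] P.X1)
    (hσ0 : ∀ (j : ℤ), ∀ x ∈ Q.X0.gr j, σ0 x ∈ P.X0.gr j)
    (hσ1 : ∀ (j : ℤ), ∀ x ∈ Q.X1.gr j, σ1 x ∈ P.X1.gr j)
    (s0 : ∀ x, F.f0 (σ0 x) = x) (s1 : ∀ x, F.f1 (σ1 x) = x)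
    (h0 : P.X0 →ₗ[R] P.X1) (h1 : P.X1 →ₗ[R] P.X0)
    (hh0 : ∀ (j : ℤ), ∀ x ∈ P.X0.gr j, h0 x ∈ P.X1.gr (j - c))
    (hh1 : ∀ (j : ℤ), ∀ x ∈ P.X1.gr j, h1 x ∈ P.X0.gr (j - c))
    (k0 : ∀ x, F.f0 x = 0 → F.f1 (h0 x) = 0) (k1 : ∀ x, F.f1 x = 0 → F.f0 (h1 x) = 0)
    (e0 : ∀ x, F.f0 x = 0 → h1 (P.d0 x) + P.d1 (h0 x) = x)
    (e1 : ∀ x, F.f1 x = 0 → h0 (P.d1 x) + P.d0 (h1 x) = x) :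
    Nonempty (P.toHMF ≅ Q.toHMF) := by
  -- The failure of the section to commute with the differentials. It takes values in the kernel of
  -- `F`, where `h` is a contraction, and it anticommutes with the differentials.
  let t0 : Q.X0 →ₗ[R] P.X1 := P.d0 ∘ₗ σ0 - σ1 ∘ₗ Q.d0
  let t1 : Q.X1 →ₗ[R] P.X0 := P.d1 ∘ₗ σ1 - σ0 ∘ₗ Q.d1
  have ht0 : ∀ x, t0 x = P.d0 (σ0 x) - σ1 (Q.d0 x) := fun x => rfl
  have ht1 : ∀ x, t1 x = P.d1 (σ1 x) - σ0 (Q.d1 x) := fun x => rfl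
  have kt0 : ∀ x, F.f1 (t0 x) = 0 := fun x => by
    rw [ht0, map_sub, ← F.comm0, s0, s1, sub_self]
  have kt1 : ∀ x, F.f0 (t1 x) = 0 := fun x => by
    rw [ht1, map_sub, ← F.comm1, s1, s0, sub_self]
  have g0 : ∀ (j : ℤ), ∀ x ∈ Q.X0.gr j, t0 x ∈ P.X1.gr (j + c) := fun j x hx =>
    sub_mem (P.d0_mem _ _ (hσ0 _ _ hx)) (hσ1 _ _ (Q.d0_mem _ _ hx))
  have g1 : ∀ (j : ℤ), ∀ x ∈ Q.X1.gr j, t1 x ∈ P.X0.gr (j + c) := fun j x hx =>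
    sub_mem (P.d1_mem _ _ (hσ1 _ _ hx)) (hσ0 _ _ (Q.d1_mem _ _ hx))
  -- The corrected section `σ - h t`. On the kernel `d h = 1 - h d`, so the correction removes `t`
  -- from the commutator and the rest cancels by `d t = -t d`.
  let G : Hom Q P :=
    { f0 := σ0 - h1 ∘ₗ t0
      f1 := σ1 - h0 ∘ₗ t1
      f0_mem := fun j x hx => sub_mem (hσ0 _ _ hx) (by simpa using hh1 _ _ (g0 _ _ hx))
      f1_mem := fun j x hx => sub_mem (hσ1 _ _ hx) (by simpa using hh0 _ _ (g1 _ _ hx))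
      comm0 := fun x => by
        have a := e1 _ (kt0 x)
        have b : P.d1 (t0 x) = - t1 (Q.d0 x) := by
          rw [ht0, ht1, map_sub, P.d1_d0, Q.d1_d0, map_smul]; abel
        rw [b, map_neg] at a
        change P.d0 (σ0 x - h1 (t0 x)) = σ1 (Q.d0 x) - h0 (t1 (Q.d0 x))
        rw [map_sub]
        rw [← sub_eq_iff_eq_add'.2 a.symm]
        rw [ht0]; abel
      comm1 := fun x => by
        have a := e0 _ (kt1 x)
        have b : P.d0 (t1 x) = - t0 (Q.d1 x) := by
          rw [ht0, ht1, map_sub, P.d0_d1, Q.d0_d1, map_smul]; abel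
        rw [b, map_neg] at a
        change P.d1 (σ1 x - h0 (t1 x)) = σ0 (Q.d1 x) - h1 (t0 (Q.d1 x))
        rw [map_sub]
        rw [← sub_eq_iff_eq_add'.2 a.symm]
        rw [ht1]; abel }
  have FG0 : ∀ x, F.f0 (G.f0 x) = x := fun x => by
    change F.f0 (σ0 x - h1 (t0 x)) = x
    rw [map_sub, s0, k1 _ (kt0 x), sub_zero]
  have FG1 : ∀ x, F.f1 (G.f1 x) = x := fun x => by
    change F.f1 (σ1 x - h0 (t1 x)) = x
    rw [map_sub, s1, k0 _ (kt1 x), sub_zero]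
  let F' : P ⟶ Q := F
  let G' : Q ⟶ P := G
  have hGF : homotopic (F' ≫ G') (𝟙 P) := by
    -- Since `F G = 1`, the map `G F - 1` lands in the kernel of `F`. Hence `h (G F - 1)` is a
    -- homotopy from `G F` to the identity.
    have c0 : ∀ x, G.f0 (F.f0 x) - x = h1 (P.d0 (G.f0 (F.f0 x) - x)) +
        P.d1 (h0 (G.f0 (F.f0 x) - x)) := fun x =>
      (e0 _ (by rw [map_sub, FG0, sub_self])).symm
    have c1 : ∀ x, G.f1 (F.f1 x) - x = h0 (P.d1 (G.f1 (F.f1 x) - x)) +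
        P.d0 (h1 (G.f1 (F.f1 x) - x)) := fun x =>
      (e1 _ (by rw [map_sub, FG1, sub_self])).symm
    refine ⟨h0 ∘ₗ (G.f0 ∘ₗ F.f0 - LinearMap.id), h1 ∘ₗ (G.f1 ∘ₗ F.f1 - LinearMap.id),
      fun j x hx => ?_, fun j x hx => ?_, fun x => ?_, fun x => ?_⟩
    · exact hh0 _ _ (sub_mem (G.f0_mem _ _ (F.f0_mem _ _ hx)) hx)
    · exact hh1 _ _ (sub_mem (G.f1_mem _ _ (F.f1_mem _ _ hx)) hx)
    · refine (c0 x).trans ?_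
      rw [map_sub P.d0, G.comm0, F.comm0]; rfl
    · refine (c1 x).trans ?_
      rw [map_sub P.d1, G.comm1, F.comm1]; rfl
  have hFG : G' ≫ F' = 𝟙 Q := Hom.ext (LinearMap.ext FG0) (LinearMap.ext FG1)
  refine ⟨⟨(Quotient.functor _).map F', (Quotient.functor _).map G', ?_, ?_⟩⟩
  · rw [← Functor.map_comp, CategoryTheory.Quotient.sound _ hGF, CategoryTheory.Functor.map_id]
  · rw [← Functor.map_comp, hFG, CategoryTheory.Functor.map_id]

/-- In `nonempty_iso_of_contraction`, it is enough that `h` is a contraction of the kernel up to a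
nilpotent error. -/
theorem nonempty_iso_of_nilpotent [SetLike.GradedMonoid 𝒜] {P Q : MF 𝒜 c ω} (F : Hom P Q)
    (hF0 : ∀ (j : ℤ), ∀ x ∈ Q.X0.gr j, ∃ y ∈ P.X0.gr j, F.f0 y = x)
    (hF1 : ∀ (j : ℤ), ∀ x ∈ Q.X1.gr j, ∃ y ∈ P.X1.gr j, F.f1 y = x)
    (h0 : P.X0 →ₗ[R] P.X1) (h1 : P.X1 →ₗ[R] P.X0)
    (hh0 : ∀ (j : ℤ), ∀ x ∈ P.X0.gr j, h0 x ∈ P.X1.gr (j - c))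
    (hh1 : ∀ (j : ℤ), ∀ x ∈ P.X1.gr j, h1 x ∈ P.X0.gr (j - c))
    (k0 : ∀ x, F.f0 x = 0 → F.f1 (h0 x) = 0) (k1 : ∀ x, F.f1 x = 0 → F.f0 (h1 x) = 0)
    (ν0 : P.X0 →ₗ[R] P.X0) (ν1 : P.X1 →ₗ[R] P.X1)
    (e0 : ∀ x, ν0 x = x - h1 (P.d0 x) - P.d1 (h0 x))
    (e1 : ∀ x, ν1 x = x - h0 (P.d1 x) - P.d0 (h1 x))
    (n0 : ∀ x, F.f0 x = 0 → ν0 (ν0 (ν0 x)) = 0) (n1 : ∀ x, F.f1 x = 0 → ν1 (ν1 (ν1 x)) = 0) :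
    Nonempty (P.toHMF ≅ Q.toHMF) := by
  -- The terms of `Q` are graded projective, so surjectivity in each degree already gives linear
  -- sections of degree zero.
  obtain ⟨σ0, hσ0, s0⟩ := GrMod.exists_lift 0 LinearMap.id F.f0
    (fun j x hx => by simpa using hF0 j x hx)
  obtain ⟨σ1, hσ1, s1⟩ := GrMod.exists_lift 0 LinearMap.id F.f1
    (fun j x hx => by simpa using hF1 j x hx)
  have z0 : ∀ x, F.f0 x = 0 → F.f1 (P.d0 x) = 0 := fun x hx => by
    rw [← F.comm0, hx, map_zero]
  have z1 : ∀ x, F.f1 x = 0 → F.f0 (P.d1 x) = 0 := fun x hx => by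
    rw [← F.comm1, hx, map_zero]
  have kν0 : ∀ x, F.f0 x = 0 → F.f0 (ν0 x) = 0 := fun x hx => by
    rw [e0, map_sub, map_sub, hx, k1 _ (z0 _ hx), z1 _ (k0 _ hx)]; simp
  have kν1 : ∀ x, F.f1 x = 0 → F.f1 (ν1 x) = 0 := fun x hx => by
    rw [e1, map_sub, map_sub, hx, k0 _ (z1 _ hx), z0 _ (k1 _ hx)]; simp
  have cν0 : ∀ x, P.d0 (ν0 x) = ν1 (P.d0 x) := fun x => by
    rw [e0, e1, map_sub, map_sub, P.d1_d0, P.d0_d1, map_smul]; abel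
  have cν1 : ∀ x, P.d1 (ν1 x) = ν0 (P.d1 x) := fun x => by
    rw [e0, e1, map_sub, map_sub, P.d1_d0, P.d0_d1, map_smul]; abel
  have gν0 : ∀ (j : ℤ), ∀ x ∈ P.X0.gr j, ν0 x ∈ P.X0.gr j := fun j x hx => by
    rw [e0]
    exact sub_mem (sub_mem hx (by simpa using hh1 _ _ (P.d0_mem _ _ hx)))
      (by simpa using P.d1_mem _ _ (hh0 _ _ hx))
  have gν1 : ∀ (j : ℤ), ∀ x ∈ P.X1.gr j, ν1 x ∈ P.X1.gr j := fun j x hx => by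
    rw [e1]
    exact sub_mem (sub_mem hx (by simpa using hh0 _ _ (P.d1_mem _ _ hx)))
      (by simpa using P.d0_mem _ _ (hh1 _ _ hx))
  -- On the kernel `h d + d h = 1 - ν`, with inverse `g = 1 + ν + ν²` because `ν³ = 0` there. Since
  -- `ν` commutes with the differentials, so does `g`, and `g h` is an exact contraction.
  let g0 : P.X0 →ₗ[R] P.X0 := LinearMap.id + ν0 + ν0 ∘ₗ ν0
  let g1 : P.X1 →ₗ[R] P.X1 := LinearMap.id + ν1 + ν1 ∘ₗ ν1
  have hg0 : ∀ x, g0 x = x + ν0 x + ν0 (ν0 x) := fun x => rfl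
  have hg1 : ∀ x, g1 x = x + ν1 x + ν1 (ν1 x) := fun x => rfl
  have f0 : ∀ x, F.f0 x = 0 → F.f0 (g0 x) = 0 := fun x hx => by
    rw [hg0, map_add, map_add, kν0 _ (kν0 _ hx), kν0 _ hx, hx]; simp
  have f1 : ∀ x, F.f1 x = 0 → F.f1 (g1 x) = 0 := fun x hx => by
    rw [hg1, map_add, map_add, kν1 _ (kν1 _ hx), kν1 _ hx, hx]; simp
  have c0 : ∀ x, P.d0 (g0 x) = g1 (P.d0 x) := fun x => by
    simp only [hg0, hg1, map_add, cν0]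
  have c1 : ∀ x, P.d1 (g1 x) = g0 (P.d1 x) := fun x => by
    simp only [hg0, hg1, map_add, cν1]
  refine nonempty_iso_of_contraction F σ0 σ1 (fun j x hx => by simpa using hσ0 j x hx)
    (fun j x hx => by simpa using hσ1 j x hx) s0 s1 (g1 ∘ₗ h0) (g0 ∘ₗ h1) ?_ ?_ ?_ ?_ ?_ ?_
  · exact fun j x hx => add_mem (add_mem (hh0 _ _ hx) (gν1 _ _ (hh0 _ _ hx)))
      (gν1 _ _ (gν1 _ _ (hh0 _ _ hx)))
  · exact fun j x hx => add_mem (add_mem (hh1 _ _ hx) (gν0 _ _ (hh1 _ _ hx)))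
      (gν0 _ _ (gν0 _ _ (hh1 _ _ hx)))
  · exact fun x hx => f1 _ (k0 _ hx)
  · exact fun x hx => f0 _ (k1 _ hx)
  · intro x hx
    change g0 (h1 (P.d0 x)) + P.d1 (g1 (h0 x)) = x
    rw [c1, ← map_add, show h1 (P.d0 x) + P.d1 (h0 x) = x - ν0 x by rw [e0]; abel]
    rw [hg0, map_sub, map_sub, n0 x hx]; abel
  · intro x hx
    change g1 (h0 (P.d1 x)) + P.d0 (g0 (h1 x)) = x
    rw [c0, ← map_add, show h0 (P.d1 x) + P.d0 (h1 x) = x - ν1 x by rw [e1]; abel]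
    rw [hg1, map_sub, map_sub, n1 x hx]; abel

end MF
end Generic

section Semilinear

set_option linter.unusedSectionVars false

variable {R S T : Type} [CommRing R] [CommRing S] [CommRing T] [Algebra ℚ R] [Algebra ℚ S]
  [Algebra ℚ T] {𝒜 : ℤ → Submodule ℚ R} {ℬ : ℤ → Submodule ℚ S} {𝒞 : ℤ → Submodule ℚ T} {c : ℤ}

/-! ## Base change by means of bases -/

/-- The `φ`-semilinear map `η` sends some homogeneous basis to a homogeneous basis with the same
degrees. -/
def PreservesBasis {φ : R →+* S} {M : GrMod 𝒜} {N : GrMod ℬ} (η : M →ₛₗ[φ] N) : Prop :=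
  ∃ (ι : Type) (b : Module.Basis ι R M) (b' : Module.Basis ι S N) (δ : ι → ℤ),
    IsHomogeneousBasis 𝒜 M.gr b δ ∧ IsHomogeneousBasis ℬ N.gr b' δ ∧ ∀ i, b' i = η (b i)

/-- The `φ`-semilinear map `η` sends every homogeneous basis to a homogeneous basis with the same
degrees. -/
def PreservesBases {φ : R →+* S} {M : GrMod 𝒜} {N : GrMod ℬ} (η : M →ₛₗ[φ] N) : Prop :=
  ∀ (ι : Type) (b : Module.Basis ι R M) (δ : ι → ℤ), IsHomogeneousBasis 𝒜 M.gr b δ →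
    ∃ b' : Module.Basis ι S N, IsHomogeneousBasis ℬ N.gr b' δ ∧ ∀ i, b' i = η (b i)

/-- This reduces every question about a base change `η` to a question about `φ` in each coordinate.
-/
theorem repr_semilinear {φ : R →+* S} {M N : Type} [AddCommGroup M] [Module R M] [AddCommGroup N]
    [Module S N] {ι : Type} (b : Module.Basis ι R M) (b' : Module.Basis ι S N) (η : M →ₛₗ[φ] N)
    (h : ∀ i, b' i = η (b i)) (x : M) (i : ι) : b'.repr (η x) i = φ (b.repr x i) := by
  classical
  conv_lhs => rw [← b.linearCombination_repr x, Finsupp.linearCombination_apply, Finsupp.sum]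
  simp only [map_sum, map_smulₛₗ, ← h, Finsupp.finsetSum_apply, Finsupp.smul_apply,
    Module.Basis.repr_self, Finsupp.single_apply, smul_eq_mul, mul_ite, mul_one, mul_zero]
  rw [Finset.sum_ite_eq']
  split_ifs with hi
  · rfl
  · rw [Finsupp.notMem_support_iff.1 hi, map_zero]

/-- The semilinear map that sends one basis to another. -/
def basisMap (ρ : R →+* S) {M N : Type} [AddCommGroup M] [Module R M] [AddCommGroup N] [Module S N]
    {ι : Type} (b : Module.Basis ι R M) (b' : Module.Basis ι S N) : M →ₛₗ[ρ] N where
  toFun x := b'.repr.symm (Finsupp.mapRange ρ (map_zero ρ) (b.repr x))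
  map_add' x y := by
    rw [map_add, Finsupp.mapRange_add (map_add ρ), map_add]
  map_smul' r x := by
    rw [← map_smul]
    congr 1
    ext i
    simp

theorem basisMap_apply (ρ : R →+* S) {M N : Type} [AddCommGroup M] [Module R M] [AddCommGroup N]
    [Module S N] {ι : Type} (b : Module.Basis ι R M) (b' : Module.Basis ι S N) (i : ι) :
    basisMap ρ b b' (b i) = b' i := by
  simp [basisMap]

theorem semilinear_ext {ρ : R →+* S} {M N : Type} [AddCommGroup M] [Module R M] [AddCommGroup N]
    [Module S N] {ι : Type} (b : Module.Basis ι R M) {f g : M →ₛₗ[ρ] N}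
    (h : ∀ i, f (b i) = g (b i)) (x : M) : f x = g x := by
  rw [← b.linearCombination_repr x, Finsupp.linearCombination_apply, Finsupp.sum]
  simp only [map_sum, map_smulₛₗ, h]

namespace MF

variable {ω : R} {ω' : S} {ω'' : T}

/-- A pair of `φ`-semilinear maps that commute with the differentials. -/
structure SemiHom (φ : R →+* S) (M : MF 𝒜 c ω) (N : MF ℬ c ω') where
  f0 : M.X0 →ₛₗ[φ] N.X0
  f1 : M.X1 →ₛₗ[φ] N.X1
  comm0 : ∀ x, N.d0 (f0 x) = f1 (M.d0 x)
  comm1 : ∀ x, N.d1 (f1 x) = f0 (M.d1 x)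

/-- `N` is the base change of `M` along `η`, as witnessed by one basis. -/
def SemiHom.IsExt {φ : R →+* S} {M : MF 𝒜 c ω} {N : MF ℬ c ω'} (η : SemiHom φ M N) : Prop :=
  PreservesBasis η.f0 ∧ PreservesBasis η.f1

/-- `N` is the base change of `M` along `η`, as witnessed by all bases. -/
def SemiHom.IsStrongExt {φ : R →+* S} {M : MF 𝒜 c ω} {N : MF ℬ c ω'} (η : SemiHom φ M N) : Prop :=
  PreservesBases η.f0 ∧ PreservesBases η.f1

/-- A base change along a composite ring homomorphism factors through a base change along the first
factor. -/
theorem SemiHom.exists_factor {θ : R →+* S} {ρ : S →+* T} {φ : R →+* T} (hφ : ∀ r, ρ (θ r) = φ r)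
    {M : MF 𝒜 c ω} {N : MF ℬ c ω'} {Q : MF 𝒞 c ω''} (η : SemiHom θ M N) (hη : η.IsStrongExt)
    (ζ : SemiHom φ M Q) (hζ : ζ.IsExt) : ∃ π : SemiHom ρ N Q, π.IsExt := by
  have : RingHomCompTriple θ ρ φ := ⟨RingHom.ext hφ⟩
  obtain ⟨⟨ι, b, q, δ, hb, hq, eq⟩, ⟨κ, b', q', δ', hb', hq', eq'⟩⟩ := hζ
  -- The basis `b` is imposed by `ζ`, so `η` must carry this particular basis to a basis of `N`.
  -- This is why `η` is required to preserve all bases and `ζ` only one.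
  obtain ⟨n, hn, en⟩ := hη.1 ι b δ hb
  obtain ⟨n', hn', en'⟩ := hη.2 κ b' δ' hb'
  have h0 : ∀ x, basisMap ρ n q (η.f0 x) = ζ.f0 x := fun x =>
    semilinear_ext b (f := (basisMap ρ n q).comp η.f0) (g := ζ.f0)
      (fun i => by rw [LinearMap.comp_apply, ← en, basisMap_apply, eq]) x
  have h1 : ∀ x, basisMap ρ n' q' (η.f1 x) = ζ.f1 x := fun x =>
    semilinear_ext b' (f := (basisMap ρ n' q').comp η.f1) (g := ζ.f1)
      (fun i => by rw [LinearMap.comp_apply, ← en', basisMap_apply, eq']) x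
  refine ⟨⟨basisMap ρ n q, basisMap ρ n' q', ?_, ?_⟩,
    ⟨ι, n, q, δ, hn, hq, fun i => (basisMap_apply _ _ _ i).symm⟩,
    ⟨κ, n', q', δ', hn', hq', fun i => (basisMap_apply _ _ _ i).symm⟩⟩
  -- It suffices to compare on the basis `n = η b`, where both sides are determined by the
  -- compatibilities of `η` and `ζ`.
  · refine semilinear_ext n (f := Q.d0.comp (basisMap ρ n q)) (g := (basisMap ρ n' q').comp N.d0) ?_
    intro i
    rw [LinearMap.comp_apply, LinearMap.comp_apply, en, h0, η.comm0, h1, ζ.comm0]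
  · refine semilinear_ext n' (f := Q.d1.comp (basisMap ρ n' q')) (g := (basisMap ρ n q).comp N.d1) ?_
    intro i
    rw [LinearMap.comp_apply, LinearMap.comp_apply, en', h1, η.comm1, h0, ζ.comm1]

/-- Over the identity, `η` is the linear equivalence that matches the two bases. Coordinates are
unchanged, so membership in a graded piece is both preserved and reflected. -/
theorem PreservesBasis.bijective {M N : GrMod 𝒜} {φ : R →+* R} (hφ : φ = RingHom.id R)
    {η : M →ₛₗ[φ] N} (h : PreservesBasis η) :
    ∃ e : M ≃ₗ[R] N, (∀ x, e x = η x) ∧ ∀ (j : ℤ) (x : M), e x ∈ N.gr j ↔ x ∈ M.gr j := by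
  subst hφ
  obtain ⟨ι, b, b', δ, hb, hb', e⟩ := h
  have he : ∀ x, b.equiv b' (Equiv.refl ι) x = η x := fun x => by
    refine semilinear_ext b (f := (b.equiv b' (Equiv.refl ι)).toLinearMap) (g := η) (fun i => ?_) x
    rw [LinearEquiv.coe_coe, Module.Basis.equiv_apply, Equiv.refl_apply, e]
  refine ⟨b.equiv b' (Equiv.refl ι), he, fun j x => ?_⟩
  rw [hb, hb', he]
  simp only [repr_semilinear b b' η e, RingHom.id_apply]

theorem SemiHom.IsExt.nonempty_gequiv {ω' : R} {M : MF 𝒜 c ω} {N : MF 𝒜 c ω'}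
    {φ : R →+* R} (hφ : φ = RingHom.id R) {η : SemiHom φ M N} (h : η.IsExt) :
    Nonempty (GEquiv M N) := by
  obtain ⟨e0, h0, m0⟩ := PreservesBasis.bijective hφ h.1
  obtain ⟨e1, h1, m1⟩ := PreservesBasis.bijective hφ h.2
  exact ⟨⟨e0, e1, m0, m1, fun x => by rw [h0, h1, η.comm0], fun x => by rw [h0, h1, η.comm1]⟩⟩

/-- Base changes are unique. -/
theorem nonempty_gequiv_of_isExt {θ : R →+* S} {ω₂ : S}
    {M : MF 𝒜 c ω} {N : MF ℬ c ω'} {Q : MF ℬ c ω₂} (η : SemiHom θ M N) (hη : η.IsStrongExt)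
    (ζ : SemiHom θ M Q) (hζ : ζ.IsExt) : Nonempty (GEquiv N Q) := by
  obtain ⟨π, hπ⟩ := SemiHom.exists_factor (θ := θ) (ρ := RingHom.id S) (fun _ => rfl) η hη ζ hζ
  exact hπ.nonempty_gequiv rfl

/-- Composition with a strict isomorphism. -/
theorem SemiHom.IsExt.of_gequiv {φ : R →+* S} {ω₁ : R} {M : MF 𝒜 c ω} {M' : MF 𝒜 c ω₁}
    {N : MF ℬ c ω'} (e : GEquiv M M') {η : SemiHom φ M' N} (h : η.IsExt) :
    ∃ ζ : SemiHom φ M N, ζ.IsExt := by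
  obtain ⟨⟨ι, b, q, δ, hb, hq, eq⟩, ⟨κ, b', q', δ', hb', hq', eq'⟩⟩ := h
  refine ⟨⟨η.f0.comp e.e0.toLinearMap, η.f1.comp e.e1.toLinearMap, fun x => ?_, fun x => ?_⟩,
    ⟨ι, b.map e.e0.symm, q, δ, ?_, hq, ?_⟩, ⟨κ, b'.map e.e1.symm, q', δ', ?_, hq', ?_⟩⟩
  · simp [η.comm0, e.comm0]
  · simp [η.comm1, e.comm1]
  · intro j x
    rw [← e.mem0, hb]; rfl
  · intro i; simp [eq]
  · intro j x
    rw [← e.mem1, hb']; rfl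
  · intro i; simp [eq']

/-- A factorization is its own base change along the identity. -/
theorem exists_isExt_id (M : MF 𝒜 c ω) {φ : R →+* R} (hφ : φ = RingHom.id R) :
    ∃ η : SemiHom φ M M, η.IsExt := by
  subst hφ
  obtain ⟨ι, b, δ, hb⟩ := M.X0.free
  obtain ⟨κ, b', δ', hb'⟩ := M.X1.free
  exact ⟨⟨LinearMap.id, LinearMap.id, fun _ => rfl, fun _ => rfl⟩,
    ⟨ι, b, b, δ, hb, hb, fun _ => rfl⟩, ⟨κ, b', b', δ', hb', hb', fun _ => rfl⟩⟩

variable [SetLike.GradedMonoid 𝒜] [SetLike.GradedMonoid ℬ]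

/-- The formula `x ↦ 1 ⊗ x` is recorded along with the basis property, because it is what makes
these maps commute with the base-changed differentials. -/
theorem exists_extend_basis (φ : R →+* S) (hφ : ∀ j, ∀ r ∈ 𝒜 j, φ r ∈ ℬ j) (M : GrMod 𝒜) :
    ∃ η : M →ₛₗ[φ] M.extend φ hφ, PreservesBases η ∧
      ∀ x, letI := φ.toAlgebra; η x = (1 : S) ⊗ₜ[R] x := by
  let _ := φ.toAlgebra
  refine ⟨{ toFun := fun x => (1 : S) ⊗ₜ[R] x, map_add' := fun x y => tmul_add _ _ _,
            map_smul' := fun r x => ?_ }, ?_, fun x => rfl⟩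
  · change (1 : S) ⊗ₜ[R] (r • x) = φ r • ((1 : S) ⊗ₜ[R] x)
    rw [← smul_tmul, smul_tmul', Algebra.smul_def, RingHom.algebraMap_toAlgebra]
    rfl
  · intro ι b δ hb
    have repr_tmul : ∀ (s : S) (m : M) (i : ι),
        (Algebra.TensorProduct.basis S b).repr (s ⊗ₜ[R] m) i = s * φ (b.repr m i) :=
      fun s m i => by
        rw [Algebra.TensorProduct.basis_repr_tmul, Finsupp.smul_apply, Finsupp.mapRange_apply,
          smul_eq_mul, RingHom.algebraMap_toAlgebra]
    have smul_basis : ∀ (s : S) (i : ι),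
        s • Algebra.TensorProduct.basis S b i = s ⊗ₜ[R] b i := fun s i => by
      rw [Algebra.TensorProduct.basis_apply, smul_tmul', smul_eq_mul, mul_one]
    refine ⟨Algebra.TensorProduct.basis S b, ?_, fun i => Algebra.TensorProduct.basis_apply b i⟩
    intro j x
    refine GrMod.closure_criterion (M := S ⊗[R] M) _ _ _ _ ?_ ?_ x
    · rintro t ⟨k, l, s, m, rfl, hs, hm, rfl⟩ i
      refine (congrArg (· ∈ ℬ (k + l - δ i)) (repr_tmul s m i)).mpr ?_
      have := SetLike.mul_mem_graded hs (hφ _ _ ((hb l m).1 hm i))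
      convert this using 2
      ring
    · intro i r hr
      exact ⟨j - δ i, δ i, r, b i, by ring, hr, GrMod.basis_mem hb i, smul_basis r i⟩

theorem exists_extend_isStrongExt (φ : R →+* S) (hφ : ∀ j, ∀ r ∈ 𝒜 j, φ r ∈ ℬ j) (M : MF 𝒜 c ω) :
    ∃ η : SemiHom φ M (M.extend φ hφ), η.IsStrongExt := by
  obtain ⟨η0, p0, h0⟩ := exists_extend_basis φ hφ M.X0
  obtain ⟨η1, p1, h1⟩ := exists_extend_basis φ hφ M.X1
  let _ := φ.toAlgebra
  refine ⟨⟨η0, η1, fun x => ?_, fun x => ?_⟩, p0, p1⟩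
  · exact (congrArg (M.d0.baseChange S) (h0 x)).trans (h1 (M.d0 x)).symm
  · exact (congrArg (M.d1.baseChange S) (h1 x)).trans (h0 (M.d1 x)).symm

end MF
end Semilinear

section TwoRows

set_option linter.unusedSectionVars false

variable {R : Type} [CommRing R] [Algebra ℚ R] {𝒜 : ℤ → Submodule ℚ R} [SetLike.GradedMonoid 𝒜]
  {c : ℤ} {ω ω' : R}

/-! ## Koszul factorizations with two rows -/

/-- Two rows `(a₁, a₂; b₁, b₂)` of homogeneous elements with `deg aᵢ = c - κᵢ`,
`deg bᵢ = c + κᵢ`. -/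
structure KoszulRows (𝒜 : ℤ → Submodule ℚ R) (c : ℤ) where
  a₁ : R
  b₁ : R
  a₂ : R
  b₂ : R
  κ₁ : ℤ
  κ₂ : ℤ
  ha₁ : a₁ ∈ 𝒜 (c - κ₁)
  hb₁ : b₁ ∈ 𝒜 (c + κ₁)
  ha₂ : a₂ ∈ 𝒜 (c - κ₂)
  hb₂ : b₂ ∈ 𝒜 (c + κ₂)

namespace KoszulRows

variable (D : KoszulRows 𝒜 c)

/-- The potential. -/
def potential : R := D.a₁ * D.b₁ + D.a₂ * D.b₂

section Matrix

variable {M : Type} [AddCommGroup M] [Module R M]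

/-- The matrix of the first differential. -/
def mat0 (M : Type) [AddCommGroup M] [Module R M] : M × M →ₗ[R] M × M :=
  (D.a₁ • LinearMap.fst R M M - D.b₂ • LinearMap.snd R M M).prod
    (D.a₂ • LinearMap.fst R M M + D.b₁ • LinearMap.snd R M M)

/-- The matrix of the second differential. -/
def mat1 (M : Type) [AddCommGroup M] [Module R M] : M × M →ₗ[R] M × M :=
  (D.b₁ • LinearMap.fst R M M + D.b₂ • LinearMap.snd R M M).prod
    (D.a₁ • LinearMap.snd R M M - D.a₂ • LinearMap.fst R M M)

theorem mat0_apply (x y : M) :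
    D.mat0 M (x, y) = (D.a₁ • x - D.b₂ • y, D.a₂ • x + D.b₁ • y) := rfl

theorem mat1_apply (x y : M) :
    D.mat1 M (x, y) = (D.b₁ • x + D.b₂ • y, D.a₁ • y - D.a₂ • x) := rfl

theorem mat1_mat0 (x : M × M) : D.mat1 M (D.mat0 M x) = D.potential • x := by
  obtain ⟨x, y⟩ := x
  rw [mat0_apply, mat1_apply, potential, Prod.smul_mk]
  refine Prod.ext ?_ ?_ <;> simp only <;> module

theorem mat0_mat1 (x : M × M) : D.mat0 M (D.mat1 M x) = D.potential • x := by
  obtain ⟨x, y⟩ := x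
  rw [mat1_apply, mat0_apply, potential, Prod.smul_mk]
  refine Prod.ext ?_ ?_ <;> simp only <;> module

theorem map_mat0 {N : Type} [AddCommGroup N] [Module R N] (g : M →ₗ[R] N) (x : M × M) :
    D.mat0 N (g.prodMap g x) = g.prodMap g (D.mat0 M x) := by
  obtain ⟨x, y⟩ := x
  simp [mat0_apply]

theorem map_mat1 {N : Type} [AddCommGroup N] [Module R N] (g : M →ₗ[R] N) (x : M × M) :
    D.mat1 N (g.prodMap g x) = g.prodMap g (D.mat1 M x) := by
  obtain ⟨x, y⟩ := x
  simp [mat1_apply]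

end Matrix

/-- Two copies of a graded module, as in the even part of a Koszul factorization. -/
def even (k : ℤ) (N : GrMod 𝒜) : GrMod 𝒜 := (N.shift k).prod (N.shift (k + D.κ₁ + D.κ₂))

/-- Two copies of a graded module, as in the odd part of a Koszul factorization. -/
def odd (k : ℤ) (N : GrMod 𝒜) : GrMod 𝒜 := (N.shift (k + D.κ₁)).prod (N.shift (k + D.κ₂))

theorem mem_even {k j : ℤ} {N : GrMod 𝒜} {x : N × N} :
    x ∈ (D.even k N).gr j ↔ x.1 ∈ N.gr (j - k) ∧ x.2 ∈ N.gr (j - (k + D.κ₁ + D.κ₂)) := Iff.rfl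

theorem mem_odd {k j : ℤ} {N : GrMod 𝒜} {x : N × N} :
    x ∈ (D.odd k N).gr j ↔ x.1 ∈ N.gr (j - (k + D.κ₁)) ∧ x.2 ∈ N.gr (j - (k + D.κ₂)) := Iff.rfl

theorem mat0_mem (k : ℤ) (N : GrMod 𝒜) (j : ℤ) (x : N × N) (hx : x ∈ (D.even k N).gr j) :
    D.mat0 N x ∈ (D.odd k N).gr (j + c) := by
  obtain ⟨h1, h2⟩ := D.mem_even.1 hx
  have e1 : D.a₁ • x.1 - D.b₂ • x.2 ∈ N.gr (j + c - (k + D.κ₁)) :=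
    sub_mem (GrMod.smul_mem_of_eq D.ha₁ h1 (by ring)) (GrMod.smul_mem_of_eq D.hb₂ h2 (by ring))
  have e2 : D.a₂ • x.1 + D.b₁ • x.2 ∈ N.gr (j + c - (k + D.κ₂)) :=
    add_mem (GrMod.smul_mem_of_eq D.ha₂ h1 (by ring)) (GrMod.smul_mem_of_eq D.hb₁ h2 (by ring))
  exact ⟨e1, e2⟩

theorem mat1_mem (k : ℤ) (N : GrMod 𝒜) (j : ℤ) (x : N × N) (hx : x ∈ (D.odd k N).gr j) :
    D.mat1 N x ∈ (D.even k N).gr (j + c) := by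
  obtain ⟨h1, h2⟩ := D.mem_odd.1 hx
  have e1 : D.b₁ • x.1 + D.b₂ • x.2 ∈ N.gr (j + c - k) :=
    add_mem (GrMod.smul_mem_of_eq D.hb₁ h1 (by ring)) (GrMod.smul_mem_of_eq D.hb₂ h2 (by ring))
  have e2 : D.a₁ • x.2 - D.a₂ • x.1 ∈ N.gr (j + c - (k + D.κ₁ + D.κ₂)) :=
    sub_mem (GrMod.smul_mem_of_eq D.ha₁ h2 (by ring)) (GrMod.smul_mem_of_eq D.ha₂ h1 (by ring))
  exact ⟨e1, e2⟩

theorem prodMap_even_mem {N N' : GrMod 𝒜} (d : N →ₗ[R] N')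
    (hd : ∀ (j : ℤ), ∀ x ∈ N.gr j, d x ∈ N'.gr (j + c)) (k j : ℤ) (x : N × N)
    (hx : x ∈ (D.even k N).gr j) : d.prodMap d x ∈ (D.even k N').gr (j + c) := by
  obtain ⟨h1, h2⟩ := D.mem_even.1 hx
  refine D.mem_even.2 ⟨?_, ?_⟩
  · rw [← sub_add_eq_add_sub]; exact hd _ _ h1
  · rw [← sub_add_eq_add_sub]; exact hd _ _ h2

theorem prodMap_odd_mem {N N' : GrMod 𝒜} (d : N →ₗ[R] N')
    (hd : ∀ (j : ℤ), ∀ x ∈ N.gr j, d x ∈ N'.gr (j + c)) (k j : ℤ) (x : N × N)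
    (hx : x ∈ (D.odd k N).gr j) : d.prodMap d x ∈ (D.odd k N').gr (j + c) := by
  obtain ⟨h1, h2⟩ := D.mem_odd.1 hx
  refine D.mem_odd.2 ⟨?_, ?_⟩
  · rw [← sub_add_eq_add_sub]; exact hd _ _ h1
  · rw [← sub_add_eq_add_sub]; exact hd _ _ h2

/-! ### The total differential of a tensor product with two Koszul rows. -/

section Total

variable {M M' : Type} [AddCommGroup M] [AddCommGroup M'] [Module R M] [Module R M']

/-- The even differential of the tensor product with a Koszul factorization. -/
def tot0 (d : M →ₗ[R] M') (d' : M' →ₗ[R] M) :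
    (M × M) × (M' × M') →ₗ[R] (M' × M') × (M × M) :=
  ((d.prodMap d ∘ₗ LinearMap.fst R (M × M) (M' × M'))
      - (D.mat1 M' ∘ₗ LinearMap.snd R (M × M) (M' × M'))).prod
    ((D.mat0 M ∘ₗ LinearMap.fst R (M × M) (M' × M'))
      + (d'.prodMap d' ∘ₗ LinearMap.snd R (M × M) (M' × M')))

/-- The odd differential of the tensor product with a Koszul factorization. -/
def tot1 (d : M →ₗ[R] M') (d' : M' →ₗ[R] M) :
    (M' × M') × (M × M) →ₗ[R] (M × M) × (M' × M') :=
  ((d'.prodMap d' ∘ₗ LinearMap.fst R (M' × M') (M × M))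
      + (D.mat1 M ∘ₗ LinearMap.snd R (M' × M') (M × M))).prod
    (-(D.mat0 M' ∘ₗ LinearMap.fst R (M' × M') (M × M))
      + (d.prodMap d ∘ₗ LinearMap.snd R (M' × M') (M × M)))

theorem tot0_apply (d : M →ₗ[R] M') (d' : M' →ₗ[R] M) (u : M × M) (v : M' × M') :
    D.tot0 d d' (u, v) = (d.prodMap d u - D.mat1 M' v, D.mat0 M u + d'.prodMap d' v) := rfl

theorem tot1_apply (d : M →ₗ[R] M') (d' : M' →ₗ[R] M) (u : M' × M') (v : M × M) :
    D.tot1 d d' (u, v) = (d'.prodMap d' u + D.mat1 M v, -D.mat0 M' u + d.prodMap d v) := rfl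

theorem tot1_tot0 (d : M →ₗ[R] M') (d' : M' →ₗ[R] M) (h : ∀ x, d' (d x) = ω • x)
    (h' : ∀ x, d (d' x) = ω • x) (x : (M × M) × (M' × M')) :
    D.tot1 d d' (D.tot0 d d' x) = (ω + D.potential) • x := by
  have k : ∀ x : M × M, d'.prodMap d' (d.prodMap d x) = ω • x := fun x =>
    Prod.ext (h x.1) (h x.2)
  have k' : ∀ x : M' × M', d.prodMap d (d'.prodMap d' x) = ω • x := fun x =>
    Prod.ext (h' x.1) (h' x.2)
  obtain ⟨u, v⟩ := x
  simp only [tot0_apply, tot1_apply, map_sub, map_add, k, k', mat1_mat0, mat0_mat1, map_mat0,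
    map_mat1, add_smul, Prod.smul_mk, Prod.mk_add_mk]
  refine Prod.ext ?_ ?_ <;> simp only <;> abel

theorem tot0_tot1 (d : M →ₗ[R] M') (d' : M' →ₗ[R] M) (h : ∀ x, d' (d x) = ω • x)
    (h' : ∀ x, d (d' x) = ω • x) (x : (M' × M') × (M × M)) :
    D.tot0 d d' (D.tot1 d d' x) = (ω + D.potential) • x := by
  have k : ∀ x : M × M, d'.prodMap d' (d.prodMap d x) = ω • x := fun x =>
    Prod.ext (h x.1) (h x.2)
  have k' : ∀ x : M' × M', d.prodMap d (d'.prodMap d' x) = ω • x := fun x =>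
    Prod.ext (h' x.1) (h' x.2)
  obtain ⟨u, v⟩ := x
  simp only [tot0_apply, tot1_apply, map_neg, map_add, k, k', mat1_mat0, mat0_mat1, map_mat0,
    map_mat1, add_smul, Prod.smul_mk, Prod.mk_add_mk]
  refine Prod.ext ?_ ?_ <;> simp only <;> abel

end Total

/-- The Koszul factorization with two rows, shifted by `k`. -/
def mf (k : ℤ) : MF 𝒜 c D.potential where
  X0 := D.even k (GrMod.self 𝒜)
  X1 := D.odd k (GrMod.self 𝒜)
  d0 := D.mat0 R
  d1 := D.mat1 R
  d0_mem := D.mat0_mem k (GrMod.self 𝒜)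
  d1_mem := D.mat1_mem k (GrMod.self 𝒜)
  d1_d0 := D.mat1_mat0 (M := R)
  d0_d1 := D.mat0_mat1 (M := R)

/-- The tensor product of `N` with a Koszul factorization with two rows, written in terms of
four copies of `N`. -/
def tensorMf (N : MF 𝒜 c ω) (k : ℤ) : MF 𝒜 c (ω + D.potential) where
  X0 := (D.even k N.X0).prod (D.odd k N.X1)
  X1 := (D.even k N.X1).prod (D.odd k N.X0)
  d0 := D.tot0 N.d0 N.d1
  d1 := D.tot1 N.d0 N.d1
  d0_mem j x hx :=
    ⟨AddSubgroup.sub_mem _ (D.prodMap_even_mem N.d0 N.d0_mem k j x.1 hx.1)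
        (D.mat1_mem k N.X1 j x.2 hx.2),
      AddSubgroup.add_mem _ (D.mat0_mem k N.X0 j x.1 hx.1)
        (D.prodMap_odd_mem N.d1 N.d1_mem k j x.2 hx.2)⟩
  d1_mem j x hx :=
    ⟨AddSubgroup.add_mem _ (D.prodMap_even_mem N.d1 N.d1_mem k j x.1 hx.1)
        (D.mat1_mem k N.X0 j x.2 hx.2),
      AddSubgroup.add_mem _ (AddSubgroup.neg_mem _ (D.mat0_mem k N.X1 j x.1 hx.1))
        (D.prodMap_odd_mem N.d0 N.d0_mem k j x.2 hx.2)⟩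
  d1_d0 := D.tot1_tot0 N.d0 N.d1 N.d1_d0 N.d0_d1
  d0_d1 := D.tot0_tot1 N.d0 N.d1 N.d1_d0 N.d0_d1

end KoszulRows

/-! ## Tensor products of graded modules -/

namespace GrMod

/-- The graded piece is generated as a group by homogeneous pure tensors, so additivity of `e` is
all that is needed. -/
theorem tensor_induction {M N : GrMod 𝒜} {P : Type} [AddCommGroup P] (e : M ⊗[R] N →+ P)
    (G : AddSubgroup P) (j : ℤ)
    (h : ∀ (k l : ℤ) (m : M) (n : N), k + l = j → m ∈ M.gr k → n ∈ N.gr l → e (m ⊗ₜ[R] n) ∈ G)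
    (x : M ⊗[R] N) (hx : x ∈ (M.tensor N).gr j) : e x ∈ G := by
  refine (AddSubgroup.closure_le (G.comap e)).2 ?_ hx
  rintro t ⟨k, l, m, n, hkl, hm, hn, rfl⟩
  exact h k l m n hkl hm hn

theorem tmul_mem {M N : GrMod 𝒜} {j k l : ℤ} {m : M} {n : N} (h : k + l = j) (hm : m ∈ M.gr k)
    (hn : n ∈ N.gr l) : m ⊗ₜ[R] n ∈ (M.tensor N).gr j :=
  AddSubgroup.subset_closure ⟨k, l, m, n, h, hm, hn, rfl⟩

theorem tensor_map_mem {M N M' N' : GrMod 𝒜} (e : M →ₗ[R] M') (e' : N →ₗ[R] N')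
    (he : ∀ (j : ℤ), ∀ x ∈ M.gr j, e x ∈ M'.gr j) (he' : ∀ (j : ℤ), ∀ x ∈ N.gr j, e' x ∈ N'.gr j)
    (j : ℤ) (x : M ⊗[R] N) (hx : x ∈ (M.tensor N).gr j) :
    TensorProduct.map e e' x ∈ (M'.tensor N').gr j :=
  tensor_induction (TensorProduct.map e e').toAddMonoidHom ((M'.tensor N').gr j) j
    (fun _ _ _ _ h hm hn => tmul_mem h (he _ _ hm) (he' _ _ hn)) x hx

theorem tensor_congr_mem {M N M' N' : GrMod 𝒜} (e : M ≃ₗ[R] M') (e' : N ≃ₗ[R] N')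
    (he : ∀ (j : ℤ) (x : M), e x ∈ M'.gr j ↔ x ∈ M.gr j)
    (he' : ∀ (j : ℤ) (x : N), e' x ∈ N'.gr j ↔ x ∈ N.gr j) (j : ℤ) (x : M ⊗[R] N) :
    TensorProduct.congr e e' x ∈ (M'.tensor N').gr j ↔ x ∈ (M.tensor N).gr j := by
  refine ⟨fun h => ?_, tensor_map_mem e.toLinearMap e'.toLinearMap (fun j x => (he j x).2)
    (fun j x => (he' j x).2) j x⟩
  have := tensor_map_mem e.symm.toLinearMap e'.symm.toLinearMap
    (fun j x hx => by rw [← he]; simpa using hx) (fun j x hx => by rw [← he']; simpa using hx)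
    j _ h
  have e1 : TensorProduct.map e.symm.toLinearMap e'.symm.toLinearMap (TensorProduct.congr e e' x) =
    x := (TensorProduct.congr e e').symm_apply_apply x
  rwa [e1] at this

theorem tensor_comm_mem {M N : GrMod 𝒜} (j : ℤ) (x : M ⊗[R] N) :
    TensorProduct.comm R M N x ∈ (N.tensor M).gr j ↔ x ∈ (M.tensor N).gr j := by
  have key : ∀ (M N : GrMod 𝒜) (x : M ⊗[R] N), x ∈ (M.tensor N).gr j →
      TensorProduct.comm R M N x ∈ (N.tensor M).gr j := fun M N x hx =>
    tensor_induction (TensorProduct.comm R M N).toLinearMap.toAddMonoidHom ((N.tensor M).gr j) j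
      (fun _ _ _ _ h hm hn => tmul_mem ((add_comm _ _).trans h) hn hm) x hx
  refine ⟨fun h => ?_, key M N x⟩
  have := key N M _ h
  rwa [TensorProduct.comm_comm] at this

theorem one_mem_sub (𝒜 : ℤ → Submodule ℚ R) [SetLike.GradedMonoid 𝒜] (k : ℤ) :
    (1 : R) ∈ 𝒜 (k - k) := by
  rw [sub_self]; exact SetLike.one_mem_graded 𝒜

theorem tensor_self_mem {N : GrMod 𝒜} (l j : ℤ) (x : N ⊗[R] R) :
    TensorProduct.rid R N x ∈ N.gr (j - l) ↔ x ∈ (N.tensor ((GrMod.self 𝒜).shift l)).gr j := by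
  constructor
  · intro h
    have e : x = TensorProduct.rid R N x ⊗ₜ[R] (1 : R) :=
      ((TensorProduct.rid R N).symm_apply_apply x).symm
    rw [e]
    exact tmul_mem (N := (GrMod.self 𝒜).shift l) (sub_add_cancel j l) h (one_mem_sub 𝒜 l)
  · refine tensor_induction (N := (GrMod.self 𝒜).shift l)
      (TensorProduct.rid R N).toLinearMap.toAddMonoidHom _ j ?_ x
    rintro k i m n rfl hm hn
    exact smul_mem_of_eq (i := i - l) hn hm (by ring)

/-- `N ⊗ (R × R) ≃ N × N`. -/
def tensorPair (N : Type) [AddCommGroup N] [Module R N] : N ⊗[R] (R × R) ≃ₗ[R] N × N :=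
  (TensorProduct.prodRight R R N R R).trans
    ((TensorProduct.rid R N).prodCongr (TensorProduct.rid R N))

theorem tensorPair_tmul {N : Type} [AddCommGroup N] [Module R N] (n : N) (r s : R) :
    tensorPair N (n ⊗ₜ[R] (r, s)) = (r • n, s • n) := by
  simp [tensorPair]

theorem tensorPair_symm {N : Type} [AddCommGroup N] [Module R N] (p q : N) :
    (tensorPair (R := R) N).symm (p, q) = p ⊗ₜ[R] (1, 0) + q ⊗ₜ[R] (0, 1) := by
  rw [LinearEquiv.symm_apply_eq, map_add, tensorPair_tmul, tensorPair_tmul]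
  simp

theorem tensorPair_mem {N : GrMod 𝒜} (k l j : ℤ) (x : N ⊗[R] (R × R)) :
    tensorPair (R := R) N x ∈ ((N.shift k).prod (N.shift l)).gr j ↔
      x ∈ (N.tensor (((GrMod.self 𝒜).shift k).prod ((GrMod.self 𝒜).shift l))).gr j := by
  constructor
  · intro h
    obtain ⟨⟨p, q⟩, rfl⟩ := (tensorPair (R := R) N).symm.surjective x
    rw [LinearEquiv.apply_symm_apply] at h
    rw [tensorPair_symm]
    refine AddSubgroup.add_mem _ (tmul_mem (N := ((GrMod.self 𝒜).shift k).prod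
      ((GrMod.self 𝒜).shift l)) (sub_add_cancel j k) h.1 ?_) (tmul_mem (N :=
      ((GrMod.self 𝒜).shift k).prod ((GrMod.self 𝒜).shift l)) (sub_add_cancel j l) h.2 ?_)
    · exact ⟨one_mem_sub 𝒜 k, (𝒜 _).zero_mem⟩
    · exact ⟨(𝒜 _).zero_mem, one_mem_sub 𝒜 l⟩
  · refine tensor_induction (N := ((GrMod.self 𝒜).shift k).prod ((GrMod.self 𝒜).shift l))
      (tensorPair (R := R) N).toLinearMap.toAddMonoidHom _ j ?_ x
    rintro i i' m ⟨(r : R), (s : R)⟩ rfl hm hn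
    have h1 : r • m ∈ N.gr (i + i' - k) := smul_mem_of_eq (M := N) (i := i' - k) hn.1 hm (by ring)
    have h2 : s • m ∈ N.gr (i + i' - l) := smul_mem_of_eq (M := N) (i := i' - l) hn.2 hm (by ring)
    refine (congrArg (· ∈ ((N.shift k).prod (N.shift l)).gr (i + i'))
      (tensorPair_tmul m r s)).mpr ?_
    exact ⟨h1, h2⟩

end GrMod

/-! ### Naturality of the identifications of tensor products. -/

section Naturality

variable {M M' N N' L : Type} [AddCommGroup M] [AddCommGroup M'] [AddCommGroup N] [AddCommGroup N']
  [AddCommGroup L] [Module R M] [Module R M'] [Module R N] [Module R N'] [Module R L]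

theorem congr_rTensor (d : M →ₗ[R] M') (e : N ≃ₗ[R] N') (x : M ⊗[R] N) :
    d.rTensor N' (TensorProduct.congr (.refl R M) e x) =
      TensorProduct.congr (.refl R M') e (d.rTensor N x) := by
  induction x with
  | zero => simp only [map_zero]
  | add x y hx hy => simp only [map_add, hx, hy]
  | tmul x y => rfl

theorem congr_lTensor {L' : Type} [AddCommGroup L'] [Module R L'] (d : N →ₗ[R] L)
    (d' : N' →ₗ[R] L') (e : N ≃ₗ[R] N') (e' : L ≃ₗ[R] L') (h : ∀ x, d' (e x) = e' (d x))
    (x : M ⊗[R] N) : d'.lTensor M (TensorProduct.congr (.refl R M) e x) =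
      TensorProduct.congr (.refl R M) e' (d.lTensor M x) := by
  induction x with
  | zero => simp only [map_zero]
  | add x y hx hy => simp only [map_add, hx, hy]
  | tmul x y => simp [h]

theorem comm_rTensor (d : M →ₗ[R] M') (x : M ⊗[R] N) :
    TensorProduct.comm R M' N (d.rTensor N x) = d.lTensor N (TensorProduct.comm R M N x) := by
  induction x with
  | zero => simp only [map_zero]
  | add x y hx hy => simp only [map_add, hx, hy]
  | tmul x y => rfl

theorem comm_lTensor (d : N →ₗ[R] N') (x : M ⊗[R] N) :
    TensorProduct.comm R M N' (d.lTensor M x) = d.rTensor M (TensorProduct.comm R M N x) := by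
  induction x with
  | zero => simp only [map_zero]
  | add x y hx hy => simp only [map_add, hx, hy]
  | tmul x y => rfl

theorem tensorPair_rTensor (d : M →ₗ[R] M') (x : M ⊗[R] (R × R)) :
    d.prodMap d (GrMod.tensorPair M x) = GrMod.tensorPair M' (d.rTensor (R × R) x) := by
  induction x with
  | zero => simp only [map_zero]
  | add x y hx hy => simp only [map_add, hx, hy]
  | tmul x y => obtain ⟨r, s⟩ := y; simp [GrMod.tensorPair_tmul]

theorem tensorPair_mat0 (D : KoszulRows 𝒜 c) (x : M ⊗[R] (R × R)) :
    D.mat0 M (GrMod.tensorPair M x) = GrMod.tensorPair M ((D.mat0 R).lTensor M x) := by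
  induction x with
  | zero => simp only [map_zero]
  | add x y hx hy => simp only [map_add, hx, hy]
  | tmul x y =>
    obtain ⟨r, s⟩ := y
    simp [GrMod.tensorPair_tmul, KoszulRows.mat0_apply, mul_smul, sub_smul, add_smul]

theorem tensorPair_mat1 (D : KoszulRows 𝒜 c) (x : M ⊗[R] (R × R)) :
    D.mat1 M (GrMod.tensorPair M x) = GrMod.tensorPair M ((D.mat1 R).lTensor M x) := by
  induction x with
  | zero => simp only [map_zero]
  | add x y hx hy => simp only [map_add, hx, hy]
  | tmul x y =>
    obtain ⟨r, s⟩ := y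
    simp [GrMod.tensorPair_tmul, KoszulRows.mat1_apply, mul_smul, sub_smul, add_smul]

end Naturality

/-! ### Strict isomorphisms between tensor products of factorizations. -/

namespace MF.GEquiv

/-- Functoriality of the tensor product in the second factor. -/
def lTensor (M : MF 𝒜 c ω) {ω₁ ω₂ : R} {N : MF 𝒜 c ω₁} {N' : MF 𝒜 c ω₂} (e : GEquiv N N') :
    GEquiv (M.tensor N) (M.tensor N') where
  e0 := (TensorProduct.congr (.refl R M.X0) e.e0).prodCongr
    (TensorProduct.congr (.refl R M.X1) e.e1)
  e1 := (TensorProduct.congr (.refl R M.X1) e.e0).prodCongr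
    (TensorProduct.congr (.refl R M.X0) e.e1)
  mem0 j x := and_congr
    (GrMod.tensor_congr_mem (.refl R M.X0) e.e0 (fun _ _ => Iff.rfl) e.mem0 j x.1)
    (GrMod.tensor_congr_mem (.refl R M.X1) e.e1 (fun _ _ => Iff.rfl) e.mem1 j x.2)
  mem1 j x := and_congr
    (GrMod.tensor_congr_mem (.refl R M.X1) e.e0 (fun _ _ => Iff.rfl) e.mem0 j x.1)
    (GrMod.tensor_congr_mem (.refl R M.X0) e.e1 (fun _ _ => Iff.rfl) e.mem1 j x.2)
  comm0 x := by
    refine Prod.ext ?_ ?_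
    · exact (congrArg₂ (· - ·) (congr_rTensor M.d0 e.e0 x.1)
        (congr_lTensor N.d1 N'.d1 e.e1 e.e0 e.comm1 x.2)).trans (map_sub _ _ _).symm
    · exact (congrArg₂ (· + ·) (congr_lTensor N.d0 N'.d0 e.e0 e.e1 e.comm0 x.1)
        (congr_rTensor M.d1 e.e1 x.2)).trans (map_add _ _ _).symm
  comm1 x := by
    refine Prod.ext ?_ ?_
    · exact (congrArg₂ (· + ·) (congr_rTensor M.d1 e.e0 x.1)
        (congr_lTensor N.d1 N'.d1 e.e1 e.e0 e.comm1 x.2)).trans (map_add _ _ _).symm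
    · refine (congrArg₂ (fun a b => - a + b) (congr_lTensor N.d0 N'.d0 e.e0 e.e1 e.comm0 x.1)
        (congr_rTensor M.d0 e.e1 x.2)).trans ?_
      exact ((map_add (TensorProduct.congr (.refl R M.X1) e.e1) _ _).trans
        (congrArg (· + _) (map_neg (TensorProduct.congr (.refl R M.X1) e.e1) _))).symm

/-- The tensor product is commutative. -/
def tensorComm (M : MF 𝒜 c ω) (N : MF 𝒜 c ω') : GEquiv (M.tensor N) (N.tensor M) where
  -- The exchange of two odd factors carries the Koszul sign; it compensates for the asymmetric
  -- signs in the differentials of the tensor product.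
  e0 := (TensorProduct.comm R M.X0 N.X0).prodCongr
    ((TensorProduct.comm R M.X1 N.X1).trans (.neg R))
  e1 := ((TensorProduct.comm R M.X1 N.X0).prodCongr (TensorProduct.comm R M.X0 N.X1)).trans
    (LinearEquiv.prodComm R _ _)
  mem0 j x := and_congr (GrMod.tensor_comm_mem j x.1)
    ((AddSubgroup.neg_mem_iff _).trans (GrMod.tensor_comm_mem j x.2))
  mem1 j x := and_comm.trans (and_congr (GrMod.tensor_comm_mem j x.1)
    (GrMod.tensor_comm_mem j x.2))
  comm0 := by
    rintro ⟨(u : M.X0 ⊗[R] N.X0), (v : M.X1 ⊗[R] N.X1)⟩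
    refine Prod.ext ?_ ?_
    · change N.d0.rTensor M.X0 (TensorProduct.comm R M.X0 N.X0 u) -
        M.d1.lTensor N.X1 (-TensorProduct.comm R M.X1 N.X1 v) =
        TensorProduct.comm R M.X0 N.X1 (N.d0.lTensor M.X0 u + M.d1.rTensor N.X1 v)
      rw [map_add, comm_lTensor, comm_rTensor, map_neg, sub_neg_eq_add]
    · change M.d0.lTensor N.X0 (TensorProduct.comm R M.X0 N.X0 u) +
        N.d1.rTensor M.X1 (-TensorProduct.comm R M.X1 N.X1 v) =
        TensorProduct.comm R M.X1 N.X0 (M.d0.rTensor N.X0 u - N.d1.lTensor M.X1 v)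
      rw [map_sub, comm_lTensor, comm_rTensor, map_neg, ← sub_eq_add_neg]
  comm1 := by
    rintro ⟨(u : M.X1 ⊗[R] N.X0), (v : M.X0 ⊗[R] N.X1)⟩
    refine Prod.ext ?_ ?_
    · change N.d1.rTensor M.X0 (TensorProduct.comm R M.X0 N.X1 v) +
        M.d1.lTensor N.X0 (TensorProduct.comm R M.X1 N.X0 u) =
        TensorProduct.comm R M.X0 N.X0 (M.d1.rTensor N.X0 u + N.d1.lTensor M.X0 v)
      rw [map_add, comm_lTensor, comm_rTensor, add_comm]
    · change -M.d0.lTensor N.X1 (TensorProduct.comm R M.X0 N.X1 v) +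
        N.d0.rTensor M.X1 (TensorProduct.comm R M.X1 N.X0 u) =
        -TensorProduct.comm R M.X1 N.X1 (-N.d0.lTensor M.X1 u + M.d0.rTensor N.X1 v)
      rw [map_add, map_neg, comm_lTensor, comm_rTensor]
      abel

/-- The tensor product with a Koszul factorization with two rows. -/
def tensorKoszul (N : MF 𝒜 c ω) (D : KoszulRows 𝒜 c) (k : ℤ) :
    GEquiv (N.tensor (D.mf k)) (D.tensorMf N k) where
  e0 := (GrMod.tensorPair (R := R) N.X0).prodCongr (GrMod.tensorPair (R := R) N.X1)
  e1 := (GrMod.tensorPair (R := R) N.X1).prodCongr (GrMod.tensorPair (R := R) N.X0)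
  mem0 j x := and_congr (GrMod.tensorPair_mem _ _ j x.1) (GrMod.tensorPair_mem _ _ j x.2)
  mem1 j x := and_congr (GrMod.tensorPair_mem _ _ j x.1) (GrMod.tensorPair_mem _ _ j x.2)
  comm0 x := by
    refine Prod.ext ?_ ?_
    · exact (congrArg₂ (· - ·) (tensorPair_rTensor N.d0 x.1) (tensorPair_mat1 D x.2)).trans
        (map_sub (GrMod.tensorPair (R := R) N.X1) _ _).symm
    · exact (congrArg₂ (· + ·) (tensorPair_mat0 D x.1) (tensorPair_rTensor N.d1 x.2)).trans
        (map_add (GrMod.tensorPair (R := R) N.X0) _ _).symm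
  comm1 x := by
    refine Prod.ext ?_ ?_
    · exact (congrArg₂ (· + ·) (tensorPair_rTensor N.d1 x.1) (tensorPair_mat1 D x.2)).trans
        (map_add (GrMod.tensorPair (R := R) N.X0) _ _).symm
    · refine (congrArg₂ (fun a b => - a + b) (tensorPair_mat0 D x.1)
        (tensorPair_rTensor N.d0 x.2)).trans ?_
      exact ((map_add (GrMod.tensorPair (R := R) N.X1) _ _).trans
        (congrArg (· + _) (map_neg (GrMod.tensorPair (R := R) N.X1) _))).symm

end MF.GEquiv

end TwoRows

section Elimination

set_option linter.unusedSectionVars false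

variable {R S T : Type} [CommRing R] [Algebra ℚ R] [CommRing S] [Algebra ℚ S] [CommRing T]
  [Algebra ℚ T] {𝒜 : ℤ → Submodule ℚ R} {ℬ : ℤ → Submodule ℚ S} {𝒞 : ℤ → Submodule ℚ T}
  [SetLike.GradedMonoid 𝒜] [SetLike.GradedMonoid ℬ] [SetLike.GradedMonoid 𝒞] {c : ℤ}

/-! ## Restriction of scalars -/

/-- Restriction of scalars of a strict isomorphism. -/
def MF.GEquiv.restrict (φ : R →+* S)
    (hφ : letI := Module.compHom S φ
      IsFreeGraded (R := R) (M := S) 𝒜 (fun j => (ℬ j).toAddSubgroup))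
    {ω : R} {M N : MF ℬ c (φ ω)} (e : GEquiv M N) :
    GEquiv (MF.restrict φ hφ M) (MF.restrict φ hφ N) where
  e0 := { e.e0.toAddEquiv with map_smul' := fun r x => e.e0.map_smul (φ r) x }
  e1 := { e.e1.toAddEquiv with map_smul' := fun r x => e.e1.map_smul (φ r) x }
  mem0 := e.mem0
  mem1 := e.mem1
  comm0 := e.comm0
  comm1 := e.comm1

/-- Restriction of scalars along the identity. -/
def MF.GEquiv.restrictId {φ : R →+* R} (hid : φ = RingHom.id R)
    (hφ : letI := Module.compHom R φ
      IsFreeGraded (R := R) (M := R) 𝒜 (fun j => (𝒜 j).toAddSubgroup))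
    {ω : R} (M : MF 𝒜 c (φ ω)) : GEquiv (MF.restrict φ hφ M) M where
  e0 := { AddEquiv.refl M.X0 with
          map_smul' := fun r x => congrArg (fun s : R => s • (show M.X0 from x))
            (DFunLike.congr_fun hid r) }
  e1 := { AddEquiv.refl M.X1 with
          map_smul' := fun r x => congrArg (fun s : R => s • (show M.X1 from x))
            (DFunLike.congr_fun hid r) }
  mem0 _ _ := Iff.rfl
  mem1 _ _ := Iff.rfl
  comm0 _ := rfl
  comm1 _ := rfl

/-- A ring is free and graded over itself. -/
theorem isFreeGraded_id {φ : R →+* R} (hid : φ = RingHom.id R) :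
    letI := Module.compHom R φ
    IsFreeGraded (R := R) (M := R) 𝒜 (fun j => (𝒜 j).toAddSubgroup) := by
  subst hid
  exact ⟨Unit, Module.Basis.singleton Unit R, fun _ => 0, fun j x => by simp⟩

/-! ## Elimination of two Koszul rows -/

/-- The Koszul complex of the homogeneous elements `b₁`, `b₂` of degrees `β₁`, `β₂` is, degree by
degree, a resolution of `S` by means of `ρ : R → S`. -/
structure IsKoszulResolution (ρ : R →+* S) (𝒜 : ℤ → Submodule ℚ R) (ℬ : ℤ → Submodule ℚ S)
    (b₁ b₂ : R) (β₁ β₂ : ℤ) : Prop where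
  map_mem : ∀ (j : ℤ), ∀ r ∈ 𝒜 j, ρ r ∈ ℬ j
  surj : ∀ (j : ℤ), ∀ s ∈ ℬ j, ∃ r ∈ 𝒜 j, ρ r = s
  ker : ∀ (j : ℤ), ∀ r ∈ 𝒜 j, ρ r = 0 →
    ∃ p ∈ 𝒜 (j - β₁), ∃ q ∈ 𝒜 (j - β₂), b₁ * p + b₂ * q = r
  syz : ∀ (j : ℤ), ∀ p ∈ 𝒜 (j - β₁), ∀ q ∈ 𝒜 (j - β₂), b₁ * p + b₂ * q = 0 →
    ∃ m ∈ 𝒜 (j - (β₁ + β₂)), -(b₂ * m) = p ∧ b₁ * m = q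
  inj : ∀ m, b₁ * m = 0 → m = 0
  map_b₁ : ρ b₁ = 0
  map_b₂ : ρ b₂ = 0

namespace IsKoszulResolution

variable {ρ : R →+* S} {b₁ b₂ : R} {β₁ β₂ : ℤ} (H : IsKoszulResolution ρ 𝒜 ℬ b₁ b₂ β₁ β₂)
  {M : GrMod 𝒜} {N : GrMod ℬ} {η : M →ₛₗ[ρ] N}

include H

/-- This and the following lemmas carry the exactness of the Koszul complex from the ring to free
graded modules, one coordinate at a time. -/
theorem surj_module (hη : PreservesBasis η) (j : ℤ) (y : N) (hy : y ∈ N.gr j) :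
    ∃ x ∈ M.gr j, η x = y := by
  obtain ⟨ι, b, b', δ, hb, hb', e⟩ := hη
  obtain ⟨x, hx, h⟩ := GrMod.exists_of_coords hb j (b'.repr y).support
    (fun i r => ρ r = b'.repr y i) (fun i => H.surj _ _ ((hb' j y).1 hy i))
    (fun i hi => by rw [map_zero, Finsupp.notMem_support_iff.1 hi])
  exact ⟨x, hx, b'.repr.injective (Finsupp.ext fun i => by rw [repr_semilinear b b' η e, h])⟩

theorem map_module (hη : PreservesBasis η) (j : ℤ) (x : M) (hx : x ∈ M.gr j) :
    η x ∈ N.gr j := by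
  obtain ⟨ι, b, b', δ, hb, hb', e⟩ := hη
  rw [hb']
  intro i
  rw [repr_semilinear b b' η e]
  exact H.map_mem _ _ ((hb j x).1 hx i)

theorem inj_module (m : M) (h : b₁ • m = 0) : m = 0 := by
  obtain ⟨ι, b, δ, hb⟩ := M.free
  refine b.repr.injective (Finsupp.ext fun i => ?_)
  have := congrArg (fun x => b.repr x i) h
  simp only [map_smul, Finsupp.smul_apply, smul_eq_mul, map_zero, Finsupp.coe_zero,
    Pi.zero_apply] at this
  simpa using H.inj _ this

theorem ker_module (hη : PreservesBasis η) (j : ℤ) (x : M) (hx : x ∈ M.gr j) (h0 : η x = 0) :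
    ∃ p ∈ M.gr (j - β₁), ∃ q ∈ M.gr (j - β₂), b₁ • p + b₂ • q = x := by
  classical
  obtain ⟨ι, b, b', δ, hb, hb', e⟩ := hη
  have hρ : ∀ i, ρ (b.repr x i) = 0 := fun i => by
    rw [← repr_semilinear b b' η e, h0, map_zero]; rfl
  obtain ⟨p, hp, h⟩ := GrMod.exists_of_coords hb (j - β₁) (b.repr x).support
    (fun i r => ∃ q ∈ 𝒜 (j - β₂ - δ i), b₁ * r + b₂ * q = b.repr x i)
    (fun i => by
      obtain ⟨p, hp, q, hq, h⟩ := H.ker _ _ ((hb j x).1 hx i) (hρ i)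
      exact ⟨p, by rwa [sub_right_comm], q, by rwa [sub_right_comm], h⟩)
    (fun i hi => ⟨0, zero_mem _, by simp [Finsupp.notMem_support_iff.1 hi]⟩)
  -- The pair is chosen in two passes: first `p`, then `q` adapted to it. The exceptional set for
  -- `q` therefore also contains the support of `p`.
  obtain ⟨q, hq, h'⟩ := GrMod.exists_of_coords hb (j - β₂)
    ((b.repr x).support ∪ (b.repr p).support)
    (fun i r => b₁ * b.repr p i + b₂ * r = b.repr x i)
    (fun i => h i) (fun i hi => by
      rw [Finset.mem_union, not_or] at hi
      simp [Finsupp.notMem_support_iff.1 hi.1, Finsupp.notMem_support_iff.1 hi.2])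
  exact ⟨p, hp, q, hq, b.repr.injective (Finsupp.ext fun i => by simpa using h' i)⟩

theorem syz_module (j : ℤ) (p q : M) (hp : p ∈ M.gr (j - β₁)) (hq : q ∈ M.gr (j - β₂))
    (h0 : b₁ • p + b₂ • q = 0) :
    ∃ m ∈ M.gr (j - (β₁ + β₂)), -(b₂ • m) = p ∧ b₁ • m = q := by
  classical
  obtain ⟨ι, b, δ, hb⟩ := M.free
  have hz : ∀ i, b₁ * b.repr p i + b₂ * b.repr q i = 0 := fun i => by
    simpa using congrArg (fun x => b.repr x i) h0
  obtain ⟨m, hm, h⟩ := GrMod.exists_of_coords hb (j - (β₁ + β₂))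
    ((b.repr p).support ∪ (b.repr q).support)
    (fun i r => -(b₂ * r) = b.repr p i ∧ b₁ * r = b.repr q i)
    (fun i => by
      have h1 := (hb _ p).1 hp i
      have h2 := (hb _ q).1 hq i
      rw [sub_right_comm] at h1 h2 ⊢
      exact H.syz _ _ h1 _ h2 (hz i)) (fun i hi => by
      rw [Finset.mem_union, not_or] at hi
      simp [Finsupp.notMem_support_iff.1 hi.1, Finsupp.notMem_support_iff.1 hi.2])
  exact ⟨m, hm, b.repr.injective (Finsupp.ext fun i => by simpa using (h i).1),
    b.repr.injective (Finsupp.ext fun i => by simpa using (h i).2)⟩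

theorem map_row (p q : M) : η (b₁ • p + b₂ • q) = 0 := by
  rw [map_add, map_smulₛₗ, map_smulₛₗ, H.map_b₁, H.map_b₂, zero_smul, zero_smul, add_zero]

end IsKoszulResolution

/-- An exact Koszul complex of two commuting endomorphisms of a free graded module, augmented to a
free graded module, has a homogeneous contraction. -/
theorem exists_koszul_homotopy {P Q : GrMod 𝒞} (b₁ b₂ : P →ₗ[T] P) (η : P →ₗ[T] Q) (β₁ β₂ : ℤ)
    (comm : ∀ x, b₁ (b₂ x) = b₂ (b₁ x))
    (mem₁ : ∀ (j : ℤ), ∀ x ∈ P.gr j, b₁ x ∈ P.gr (j + β₁))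
    (mem₂ : ∀ (j : ℤ), ∀ x ∈ P.gr j, b₂ x ∈ P.gr (j + β₂))
    (mem : ∀ (j : ℤ), ∀ x ∈ P.gr j, η x ∈ Q.gr j)
    (surj : ∀ (j : ℤ), ∀ y ∈ Q.gr j, ∃ x ∈ P.gr j, η x = y)
    (ker : ∀ (j : ℤ), ∀ x ∈ P.gr j, η x = 0 →
      ∃ p ∈ P.gr (j - β₁), ∃ q ∈ P.gr (j - β₂), b₁ p + b₂ q = x)
    (syz : ∀ (j : ℤ), ∀ p ∈ P.gr (j - β₁), ∀ q ∈ P.gr (j - β₂), b₁ p + b₂ q = 0 →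
      ∃ m ∈ P.gr (j - (β₁ + β₂)), -(b₂ m) = p ∧ b₁ m = q)
    (inj : ∀ m, b₁ m = 0 → m = 0) (map_row : ∀ p q, η (b₁ p + b₂ q) = 0) :
    ∃ (h₁ h₂ : P →ₗ[T] P) (g : P × P →ₗ[T] P),
      (∀ (j : ℤ), ∀ x ∈ P.gr j, h₁ x ∈ P.gr (j - β₁)) ∧
      (∀ (j : ℤ), ∀ x ∈ P.gr j, h₂ x ∈ P.gr (j - β₂)) ∧
      (∀ (j : ℤ), ∀ p ∈ P.gr (j - β₁), ∀ q ∈ P.gr (j - β₂), g (p, q) ∈ P.gr (j - (β₁ + β₂))) ∧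
      (∀ x, η x = 0 → b₁ (h₁ x) + b₂ (h₂ x) = x) ∧
      (∀ p q, h₁ (b₁ p + b₂ q) - b₂ (g (p, q)) = p) ∧
      (∀ p q, h₂ (b₁ p + b₂ q) + b₁ (g (p, q)) = q) ∧
      ∀ m, g (-(b₂ m), b₁ m) = m := by
  -- The contraction is built from the augmentation upwards by graded lifting. A section `σ` of `η`
  -- comes first; then `1 - σ η` has values in the kernel of `η`, so it lifts through the row to `h
  -- = (h₁, h₂)`.
  obtain ⟨σ, hσ, ησ⟩ := GrMod.exists_lift (P := Q) (X := Q) (Y := P) 0 LinearMap.id η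
    (fun j x hx => by simpa using surj j x hx)
  obtain ⟨h, hh, row_h⟩ : ∃ h : P →ₗ[T] P × P, (∀ (j : ℤ), ∀ x ∈ P.gr j,
      (h x).1 ∈ P.gr (j + 0 - β₁) ∧ (h x).2 ∈ P.gr (j + 0 - β₂)) ∧
      ∀ x, b₁ (h x).1 + b₂ (h x).2 = x - σ (η x) := by
    obtain ⟨h, hh, row_h⟩ := GrMod.exists_lift (P := P) (X := P)
      (Y := (P.shift β₁).prod (P.shift β₂)) 0 (LinearMap.id - σ ∘ₗ η) (b₁.coprod b₂)
      (fun j x hx => by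
        have hx' : x - σ (η x) ∈ P.gr j :=
          sub_mem hx (by simpa using hσ j _ (mem j x hx))
        obtain ⟨p, hp, q, hq, e⟩ := ker j _ hx' (by rw [map_sub, ησ]; exact sub_self _)
        exact ⟨(p, q), by rw [add_zero]; exact ⟨hp, hq⟩, e⟩)
    exact ⟨h, fun j x hx => hh j x hx, fun x => row_h x⟩
  simp only [add_zero] at hh
  let h₁ : P →ₗ[T] P := LinearMap.fst T P P ∘ₗ h
  let h₂ : P →ₗ[T] P := LinearMap.snd T P P ∘ₗ h
  have mem_h₁ : ∀ (j : ℤ), ∀ x ∈ P.gr j, h₁ x ∈ P.gr (j - β₁) := fun j x hx => (hh j x hx).1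
  have mem_h₂ : ∀ (j : ℤ), ∀ x ∈ P.gr j, h₂ x ∈ P.gr (j - β₂) := fun j x hx => (hh j x hx).2
  have row_h' : ∀ x, b₁ (h₁ x) + b₂ (h₂ x) = x - σ (η x) := row_h
  -- What `h` leaves uncontracted in the middle term. The row kills it, since the row composed with
  -- `h` is the identity on the image of the row; hence it lifts through the column `m ↦ (-b₂ m, b₁
  -- m)` to `g`.
  let t : P × P →ₗ[T] P × P :=
    LinearMap.id - (h₁.prod h₂) ∘ₗ (b₁.coprod b₂)
  have key : ∀ (j : ℤ) (p q : P), p ∈ P.gr (j - β₁) → q ∈ P.gr (j - β₂) →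
      ∃ m ∈ P.gr (j + 0 - (β₁ + β₂)), (-(b₂ m), b₁ m) = t (p, q) := by
    intro j p q hp hq
    have hr : b₁ p + b₂ q ∈ P.gr j :=
      add_mem (by simpa using mem₁ _ p hp) (by simpa using mem₂ _ q hq)
    obtain ⟨m, hm, e1, e2⟩ := syz j (p - h₁ (b₁ p + b₂ q)) (sub_mem hp (mem_h₁ _ _ hr))
      (q - h₂ (b₁ p + b₂ q)) (sub_mem hq (mem_h₂ _ _ hr)) (by
        have := row_h' (b₁ p + b₂ q)
        rw [map_row, map_zero, sub_zero] at this
        rw [map_sub, map_sub, sub_add_sub_comm, this, sub_self])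
    exact ⟨m, by rwa [add_zero], Prod.ext e1 e2⟩
  obtain ⟨g, hg, col_g⟩ : ∃ g : P × P →ₗ[T] P, (∀ (j : ℤ), ∀ x : P × P,
      x.1 ∈ P.gr (j - β₁) ∧ x.2 ∈ P.gr (j - β₂) → g x ∈ P.gr (j + 0 - (β₁ + β₂))) ∧
      ∀ x, (-(b₂ (g x)), b₁ (g x)) = t x :=
    GrMod.exists_lift (P := (P.shift β₁).prod (P.shift β₂))
    (X := (P.shift β₁).prod (P.shift β₂)) (Y := P.shift (β₁ + β₂)) 0 t
    ((-b₂).prod b₁) (fun j x hx => key j x.1 x.2 hx.1 hx.2)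
  have cg1 : ∀ p q : P, -(b₂ (g (p, q))) = p - h₁ (b₁ p + b₂ q) := fun p q =>
    congrArg Prod.fst (col_g (p, q))
  have cg2 : ∀ p q : P, b₁ (g (p, q)) = q - h₂ (b₁ p + b₂ q) := fun p q =>
    congrArg Prod.snd (col_g (p, q))
  refine ⟨h₁, h₂, g, mem_h₁, mem_h₂, fun j p hp q hq => ?_, fun x hx => ?_, fun p q => ?_,
    fun p q => ?_, fun m => ?_⟩
  · have := hg j (p, q) ⟨hp, hq⟩
    rwa [add_zero] at this
  · rw [row_h', hx, map_zero, sub_zero]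
  · rw [sub_eq_add_neg, cg1, add_sub_cancel]
  · rw [cg2, add_sub_cancel]
  -- The row after the column is zero, so `t` fixes the image of the column. The second entry of the
  -- column is multiplication by `b₁`, which is injective, and this forces `g` to be a left inverse.
  · refine sub_eq_zero.1 (inj _ ?_)
    rw [map_sub]
    rw [cg2, map_neg, comm, neg_add_cancel, map_zero, sub_zero, sub_self]

/-- A homogeneous contraction of the Koszul complex of `b₁`, `b₂` on `M`, linear over the source
of `φ`. -/
structure KoszulContraction (φ : T →+* R) (M : GrMod 𝒜) (b₁ b₂ : R) (β₁ β₂ : ℤ)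
    (K : M → Prop) where
  h₁ : M →+ M
  h₂ : M →+ M
  g : M × M →+ M
  h₁_smul : ∀ r x, h₁ (φ r • x) = φ r • h₁ x
  h₂_smul : ∀ r x, h₂ (φ r • x) = φ r • h₂ x
  g_smul : ∀ r (x : M × M), g (φ r • x) = φ r • g x
  h₁_mem : ∀ (j : ℤ), ∀ x ∈ M.gr j, h₁ x ∈ M.gr (j - β₁)
  h₂_mem : ∀ (j : ℤ), ∀ x ∈ M.gr j, h₂ x ∈ M.gr (j - β₂)
  g_mem : ∀ (j : ℤ), ∀ p ∈ M.gr (j - β₁), ∀ q ∈ M.gr (j - β₂), g (p, q) ∈ M.gr (j - (β₁ + β₂))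
  row_h : ∀ x, K x → b₁ • h₁ x + b₂ • h₂ x = x
  h₁_row : ∀ p q, h₁ (b₁ • p + b₂ • q) - b₂ • g (p, q) = p
  h₂_row : ∀ p q, h₂ (b₁ • p + b₂ • q) + b₁ • g (p, q) = q
  g_col : ∀ m, g (-(b₂ • m), b₁ • m) = m

/-- Multiplication by a scalar of `R`, as a `T`-linear map. -/
def restrictSmul (φ : T →+* R)
    (hφ : letI := Module.compHom R φ
      IsFreeGraded (R := T) (M := R) 𝒞 (fun j => (𝒜 j).toAddSubgroup))
    (M : GrMod 𝒜) (b : R) : M.restrict φ hφ →ₗ[T] M.restrict φ hφ where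
  toFun := fun x : M => b • x
  map_add' := fun x y : M => smul_add b x y
  map_smul' := fun r (x : M) => smul_comm b (φ r) x

/-- The resolution need not split over `R`. Over `T` both `M` and `N` are free graded, because `R`
and `S` are, so the graded lifting argument applies after restriction of scalars. -/
theorem IsKoszulResolution.nonempty_contraction {ρ : R →+* S} {b₁ b₂ : R} {β₁ β₂ : ℤ}
    (H : IsKoszulResolution ρ 𝒜 ℬ b₁ b₂ β₁ β₂) (hb₁ : b₁ ∈ 𝒜 β₁) (hb₂ : b₂ ∈ 𝒜 β₂)
    {M : GrMod 𝒜} {N : GrMod ℬ} {η : M →ₛₗ[ρ] N}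
    (hη : PreservesBasis η) (φ : T →+* R)
    (hφ : letI := Module.compHom R φ
      IsFreeGraded (R := T) (M := R) 𝒞 (fun j => (𝒜 j).toAddSubgroup))
    (ψ : T →+* S) (hψ : letI := Module.compHom S ψ
      IsFreeGraded (R := T) (M := S) 𝒞 (fun j => (ℬ j).toAddSubgroup))
    (hρ : ∀ r, ρ (φ r) = ψ r) :
    Nonempty (KoszulContraction φ M b₁ b₂ β₁ β₂ (fun x => η x = 0)) := by
  let η' : M.restrict φ hφ →ₗ[T] N.restrict ψ hψ :=
    { toFun := η
      map_add' := η.map_add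
      map_smul' := fun r x => (η.map_smulₛₗ (φ r) x).trans
        (congrArg (fun s : S => s • η x) (hρ r)) }
  obtain ⟨h₁, h₂, g, m1, m2, m3, e1, e2, e3, e4⟩ :=
    exists_koszul_homotopy (restrictSmul φ hφ M b₁) (restrictSmul φ hφ M b₂) η' β₁ β₂
    (fun x : M => smul_comm b₁ b₂ x)
    (fun j (x : M) hx => GrMod.smul_mem_of_eq (M := M) hb₁ hx (add_comm _ _))
    (fun j (x : M) hx => GrMod.smul_mem_of_eq (M := M) hb₂ hx (add_comm _ _))
    (H.map_module hη) (H.surj_module hη) (H.ker_module hη)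
    (fun j p hp q hq => H.syz_module (M := M) j p q hp hq) (H.inj_module (M := M)) (H.map_row)
  exact ⟨⟨h₁.toAddMonoidHom, h₂.toAddMonoidHom, g.toAddMonoidHom, h₁.map_smul, h₂.map_smul,
    fun r x => g.map_smul r x, m1, m2, m3, e1, e2, e3, e4⟩⟩

end Elimination

/-! ### The Koszul contraction in the presence of the full differential, and elimination of rows. -/

section Elimination

set_option linter.unusedSectionVars false

variable {R S T : Type} [CommRing R] [Algebra ℚ R] [CommRing S] [Algebra ℚ S] [CommRing T]
  [Algebra ℚ T] {𝒜 : ℤ → Submodule ℚ R} {ℬ : ℤ → Submodule ℚ S} {𝒞 : ℤ → Submodule ℚ T}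
  [SetLike.GradedMonoid 𝒜] [SetLike.GradedMonoid ℬ] [SetLike.GradedMonoid 𝒞] {c : ℤ}

theorem GrMod.mem_of_eq {M : GrMod 𝒜} {i j : ℤ} {x : M} (hx : x ∈ M.gr i) (h : i = j) :
    x ∈ M.gr j := h ▸ hx

namespace KoszulRows

variable (D : KoszulRows 𝒜 c) {φ : T →+* R} {M M' : GrMod 𝒜} {K : M → Prop} {K' : M' → Prop}
  (C : KoszulContraction φ M D.b₁ D.b₂ (c + D.κ₁) (c + D.κ₂) K)
  (C' : KoszulContraction φ M' D.b₁ D.b₂ (c + D.κ₁) (c + D.κ₂) K')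

/-- The contraction of the Koszul differential on the even part. -/
def contr0 : (M × M) × (M' × M') →+ (M' × M') × (M × M) where
  toFun x := ((0, -C'.g x.2), (C.h₁ x.1.1, C.h₂ x.1.1))
  map_zero' := by simp
  map_add' x y := by simp [add_comm]

/-- The contraction of the Koszul differential on the odd part. -/
def contr1 : (M' × M') × (M × M) →+ (M × M) × (M' × M') where
  toFun x := ((0, C.g x.2), (-C'.h₁ x.1.1, -C'.h₂ x.1.1))
  map_zero' := by simp
  map_add' x y := by simp [add_comm]

theorem contr0_apply (u : M × M) (v : M' × M') :
    D.contr0 C C' (u, v) = ((0, -C'.g v), (C.h₁ u.1, C.h₂ u.1)) := rfl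

theorem contr1_apply (u : M' × M') (v : M × M) :
    D.contr1 C C' (u, v) = ((0, C.g v), (-C'.h₁ u.1, -C'.h₂ u.1)) := rfl

theorem contr0_smul (r : T) (x : (M × M) × (M' × M')) :
    D.contr0 C C' (φ r • x) = φ r • D.contr0 C C' x := by
  obtain ⟨u, v⟩ := x
  simp [contr0_apply, C.h₁_smul, C.h₂_smul, C'.g_smul]

theorem contr1_smul (r : T) (x : (M' × M') × (M × M)) :
    D.contr1 C C' (φ r • x) = φ r • D.contr1 C C' x := by
  obtain ⟨u, v⟩ := x
  simp [contr1_apply, C'.h₁_smul, C'.h₂_smul, C.g_smul]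

theorem contr0_mem (k j : ℤ) (x : (M × M) × (M' × M'))
    (hx : x ∈ ((D.even k M).prod (D.odd k M')).gr j) :
    D.contr0 C C' x ∈ ((D.even k M').prod (D.odd k M)).gr (j - c) := by
  obtain ⟨u, p, q⟩ := x
  obtain ⟨hu, -⟩ := D.mem_even.1 hx.1
  obtain ⟨hp, hq⟩ := D.mem_odd.1 hx.2
  refine ⟨D.mem_even.2 ⟨zero_mem _, neg_mem ?_⟩, D.mem_odd.2 ⟨?_, ?_⟩⟩
  · exact GrMod.mem_of_eq (C'.g_mem (j - k + c) p (GrMod.mem_of_eq hp (by ring)) q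
      (GrMod.mem_of_eq hq (by ring))) (by ring)
  · exact GrMod.mem_of_eq (C.h₁_mem _ _ hu) (by ring)
  · exact GrMod.mem_of_eq (C.h₂_mem _ _ hu) (by ring)

theorem contr1_mem (k j : ℤ) (x : (M' × M') × (M × M))
    (hx : x ∈ ((D.even k M').prod (D.odd k M)).gr j) :
    D.contr1 C C' x ∈ ((D.even k M).prod (D.odd k M')).gr (j - c) := by
  obtain ⟨u, p, q⟩ := x
  obtain ⟨hu, -⟩ := D.mem_even.1 hx.1
  obtain ⟨hp, hq⟩ := D.mem_odd.1 hx.2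
  refine ⟨D.mem_even.2 ⟨zero_mem _, ?_⟩, D.mem_odd.2 ⟨neg_mem ?_, neg_mem ?_⟩⟩
  · exact GrMod.mem_of_eq (C.g_mem (j - k + c) p (GrMod.mem_of_eq hp (by ring)) q
      (GrMod.mem_of_eq hq (by ring))) (by ring)
  · exact GrMod.mem_of_eq (C'.h₁_mem _ _ hu) (by ring)
  · exact GrMod.mem_of_eq (C'.h₂_mem _ _ hu) (by ring)

variable (d : M →ₗ[R] M') (d' : M' →ₗ[R] M)

/-- The error term of the contraction on the even part. -/
def err0 : (M × M) × (M' × M') →+ (M × M) × (M' × M') :=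
  AddMonoidHom.id _ - (D.contr1 C C').comp (D.tot0 d d').toAddMonoidHom -
    (D.tot1 d d').toAddMonoidHom.comp (D.contr0 C C')

/-- The error term of the contraction on the odd part. -/
def err1 : (M' × M') × (M × M) →+ (M' × M') × (M × M) :=
  AddMonoidHom.id _ - (D.contr0 C C').comp (D.tot1 d d').toAddMonoidHom -
    (D.tot0 d d').toAddMonoidHom.comp (D.contr1 C C')

theorem err0_apply (x : (M × M) × (M' × M')) : D.err0 C C' d d' x =
    x - D.contr1 C C' (D.tot0 d d' x) - D.tot1 d d' (D.contr0 C C' x) := rfl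

theorem err1_apply (x : (M' × M') × (M × M)) : D.err1 C C' d d' x =
    x - D.contr0 C C' (D.tot1 d d' x) - D.tot0 d d' (D.contr1 C C' x) := rfl

theorem err0_smul (r : T) (x : (M × M) × (M' × M')) :
    D.err0 C C' d d' (φ r • x) = φ r • D.err0 C C' d d' x := by
  rw [err0_apply, err0_apply, contr0_smul, (D.tot0 d d').map_smul, (D.tot1 d d').map_smul,
    contr1_smul, smul_sub, smul_sub]

theorem err1_smul (r : T) (x : (M' × M') × (M × M)) :
    D.err1 C C' d d' (φ r • x) = φ r • D.err1 C C' d d' x := by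
  rw [err1_apply, err1_apply, contr1_smul, (D.tot0 d d').map_smul, (D.tot1 d d').map_smul,
    contr0_smul, smul_sub, smul_sub]

/-- Filtration by Koszul degree: the first entry of the even pair has degree `0`, the odd pair
degree `1`, the second entry of the even pair degree `2`. Against the `bᵢ` the contraction is exact;
`d`, `d'` preserve this degree and the `aᵢ` raise it, while the contraction raises it by one. So the
error strictly raises the degree, and nothing is left in degree `0`. -/
theorem err0_fst (x : (M × M) × (M' × M')) (hx : K x.1.1) : (D.err0 C C' d d' x).1.1 = 0 := by
  obtain ⟨⟨a, s⟩, p, q⟩ := x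
  have := C.row_h a hx
  simp [err0_apply, contr0_apply, contr1_apply, tot0_apply, tot1_apply, mat0_apply, mat1_apply,
    this]

theorem err1_fst (x : (M' × M') × (M × M)) (hx : K' x.1.1) : (D.err1 C C' d d' x).1.1 = 0 := by
  obtain ⟨⟨a, s⟩, p, q⟩ := x
  have := C'.row_h a hx
  simp [err1_apply, contr0_apply, contr1_apply, tot0_apply, tot1_apply, mat0_apply, mat1_apply,
    ← sub_eq_add_neg]
  rw [add_comm, this, sub_self]

/-- The same principle in degree `1`: without a component in degree `0` the input produces no error
there, by the identities for `h` after the row and `g`. -/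
theorem err0_snd (x : (M × M) × (M' × M')) (hx : x.1.1 = 0) : (D.err0 C C' d d' x).2 = 0 := by
  obtain ⟨⟨a, s⟩, p, q⟩ := x
  obtain rfl : a = 0 := hx
  simp [err0_apply, contr0_apply, contr1_apply, tot0_apply, tot1_apply, mat0_apply, mat1_apply]
  have h₁ := C'.h₁_row p q
  have h₂ := C'.h₂_row p q
  rw [map_add, sub_eq_iff_eq_add] at h₁
  rw [map_add, ← eq_sub_iff_add_eq] at h₂
  rw [h₁, h₂]
  refine ⟨?_, ?_⟩ <;> abel

theorem err1_snd (x : (M' × M') × (M × M)) (hx : x.1.1 = 0) : (D.err1 C C' d d' x).2 = 0 := by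
  obtain ⟨⟨a, s⟩, p, q⟩ := x
  obtain rfl : a = 0 := hx
  simp [err1_apply, contr0_apply, contr1_apply, tot0_apply, tot1_apply, mat0_apply, mat1_apply]
  have h₁ := C.h₁_row p q
  have h₂ := C.h₂_row p q
  rw [map_add, sub_eq_iff_eq_add] at h₁
  rw [map_add, ← eq_sub_iff_add_eq] at h₂
  rw [h₁, h₂]
  refine ⟨?_, ?_⟩ <;> abel

/-- Degree `2` is the top degree: the error has nowhere to go, and `g` is a left inverse of the
column. -/
theorem err0_eq_zero (x : (M × M) × (M' × M')) (hx : x.1.1 = 0) (hx' : x.2 = 0) :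
    D.err0 C C' d d' x = 0 := by
  obtain ⟨⟨a, s⟩, v⟩ := x
  obtain rfl : a = 0 := hx
  obtain rfl : v = 0 := hx'
  have h0 : C'.g (0, 0) = 0 := map_zero C'.g
  have := C.g_col s
  have e : (0 : M' × M') = (0, 0) := rfl
  simp [err0_apply, contr0_apply, contr1_apply, tot0_apply, tot1_apply, mat0_apply, mat1_apply,
    this]

theorem err1_eq_zero (x : (M' × M') × (M × M)) (hx : x.1.1 = 0) (hx' : x.2 = 0) :
    D.err1 C C' d d' x = 0 := by
  obtain ⟨⟨a, s⟩, v⟩ := x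
  obtain rfl : a = 0 := hx
  obtain rfl : v = 0 := hx'
  have := C'.g_col s
  simp [err1_apply, contr0_apply, contr1_apply, tot0_apply, tot1_apply, mat0_apply, mat1_apply]
  rw [show (D.b₂ • s, -(D.b₁ • s)) = -(-(D.b₂ • s), D.b₁ • s) by simp, map_neg, this,
    add_neg_cancel]

/-- Each application of the error leaves one of the three Koszul degrees. `K 0` is needed because
the component in degree `0` vanishes after the first application and must still satisfy `K`. -/
theorem err0_nilpotent (h0 : K 0) (x : (M × M) × (M' × M')) (hx : K x.1.1) :
    D.err0 C C' d d' (D.err0 C C' d d' (D.err0 C C' d d' x)) = 0 := by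
  have h1 := D.err0_fst C C' d d' x hx
  exact D.err0_eq_zero C C' d d' _ (D.err0_fst C C' d d' _ (by rw [h1]; exact h0))
    (D.err0_snd C C' d d' _ h1)

theorem err1_nilpotent (h0 : K' 0) (x : (M' × M') × (M × M)) (hx : K' x.1.1) :
    D.err1 C C' d d' (D.err1 C C' d d' (D.err1 C C' d d' x)) = 0 := by
  have h1 := D.err1_fst C C' d d' x hx
  exact D.err1_eq_zero C C' d d' _ (D.err1_fst C C' d d' _ (by rw [h1]; exact h0))
    (D.err1_snd C C' d d' _ h1)

end KoszulRows

/-- Elimination of two Koszul rows: if the rows `b₁`, `b₂` resolve `S` over `R`, then the tensor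
product of `N` with the Koszul factorization is homotopy equivalent to the base change of `N` to
`S`. -/
theorem nonempty_iso_elimination {φ : T →+* R}
    (hφ : letI := Module.compHom R φ
      IsFreeGraded (R := T) (M := R) 𝒞 (fun j => (𝒜 j).toAddSubgroup))
    {ψ : T →+* S} (hψ : letI := Module.compHom S ψ
      IsFreeGraded (R := T) (M := S) 𝒞 (fun j => (ℬ j).toAddSubgroup))
    {ρ : R →+* S} (hρ : ∀ r, ρ (φ r) = ψ r) (D : KoszulRows 𝒜 c)
    (H : IsKoszulResolution ρ 𝒜 ℬ D.b₁ D.b₂ (c + D.κ₁) (c + D.κ₂)) {ωN : R} {ωQ : S}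
    {N : MF 𝒜 c ωN} {Q : MF ℬ c ωQ} (π : MF.SemiHom ρ N Q) (hπ : π.IsExt) (k : ℤ) {ω : T}
    (h1 : ωN + D.potential = φ ω) (h2 : ωQ = ψ ω) :
    Nonempty ((MF.restrict φ hφ (MF.ofEq h1 (D.tensorMf N k))).toHMF ≅
      (MF.restrict ψ hψ (MF.ofEq h2 (Q.shift k))).toHMF) := by
  obtain ⟨C⟩ := H.nonempty_contraction D.hb₁ D.hb₂ hπ.1 φ hφ ψ hψ hρ
  obtain ⟨C'⟩ := H.nonempty_contraction D.hb₁ D.hb₂ hπ.2 φ hφ ψ hψ hρ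
  -- The map keeps only the component in Koszul degree zero and reduces it along `π`. Apart from the
  -- differential of `N`, only the row `b₁ p + b₂ q` enters that component, and `π` kills it.
  let F : MF.Hom (MF.restrict φ hφ (MF.ofEq h1 (D.tensorMf N k)))
      (MF.restrict ψ hψ (MF.ofEq h2 (Q.shift k))) :=
    { f0 :=
        { toFun := fun x : (N.X0 × N.X0) × (N.X1 × N.X1) => π.f0 x.1.1
          map_add' := fun x y : (N.X0 × N.X0) × (N.X1 × N.X1) => π.f0.map_add x.1.1 y.1.1
          map_smul' := fun r (x : (N.X0 × N.X0) × (N.X1 × N.X1)) =>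
            (π.f0.map_smulₛₗ (φ r) x.1.1).trans (congrArg (fun s : S => s • π.f0 x.1.1) (hρ r)) }
      f1 :=
        { toFun := fun x : (N.X1 × N.X1) × (N.X0 × N.X0) => π.f1 x.1.1
          map_add' := fun x y : (N.X1 × N.X1) × (N.X0 × N.X0) => π.f1.map_add x.1.1 y.1.1
          map_smul' := fun r (x : (N.X1 × N.X1) × (N.X0 × N.X0)) =>
            (π.f1.map_smulₛₗ (φ r) x.1.1).trans (congrArg (fun s : S => s • π.f1 x.1.1) (hρ r)) }
      f0_mem := fun j x hx => H.map_module hπ.1 (j - k) _ hx.1.1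
      f1_mem := fun j x hx => H.map_module hπ.2 (j - k) _ hx.1.1
      comm0 := by
        rintro ⟨u, (p : N.X1), (q : N.X1)⟩
        refine (π.comm0 u.1).trans ?_
        change π.f1 (N.d0 u.1) = π.f1 (N.d0 u.1 - (D.b₁ • p + D.b₂ • q))
        rw [map_sub, H.map_row, sub_zero]
      comm1 := by
        rintro ⟨u, (p : N.X0), (q : N.X0)⟩
        refine (π.comm1 u.1).trans ?_
        change π.f0 (N.d1 u.1) = π.f0 (N.d1 u.1 + (D.b₁ • p + D.b₂ • q))
        rw [map_add, H.map_row, add_zero] }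
  let T0 : MF 𝒞 c ω := MF.restrict φ hφ (MF.ofEq h1 (D.tensorMf N k))
  let h0 : T0.X0 →ₗ[T] T0.X1 :=
    { toFun := D.contr0 C C'
      map_add' := (D.contr0 C C').map_add
      map_smul' := D.contr0_smul C C' }
  let h1 : T0.X1 →ₗ[T] T0.X0 :=
    { toFun := D.contr1 C C'
      map_add' := (D.contr1 C C').map_add
      map_smul' := D.contr1_smul C C' }
  refine MF.nonempty_iso_of_nilpotent F ?_ ?_ h0 h1
    (D.contr0_mem C C' k) (D.contr1_mem C C' k) ?_ ?_
    { toFun := D.err0 C C' N.d0 N.d1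
      map_add' := (D.err0 C C' N.d0 N.d1).map_add
      map_smul' := D.err0_smul C C' N.d0 N.d1 }
    { toFun := D.err1 C C' N.d0 N.d1
      map_add' := (D.err1 C C' N.d0 N.d1).map_add
      map_smul' := D.err1_smul C C' N.d0 N.d1 }
    (fun _ => rfl) (fun _ => rfl) ?_ ?_
  · intro j x hx
    obtain ⟨y, hy, e⟩ := H.surj_module hπ.1 (j - k) x hx
    exact ⟨((y, 0), (0, 0)), ⟨⟨hy, zero_mem _⟩, zero_mem _, zero_mem _⟩, e⟩
  · intro j x hx
    obtain ⟨y, hy, e⟩ := H.surj_module hπ.2 (j - k) x hx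
    exact ⟨((y, 0), (0, 0)), ⟨⟨hy, zero_mem _⟩, zero_mem _, zero_mem _⟩, e⟩
  -- The contraction has zero component in Koszul degree zero, so it maps into the kernel of `F`.
  · exact fun x _ => map_zero π.f1
  · exact fun x _ => map_zero π.f0
  · exact fun x hx => D.err0_nilpotent C C' N.d0 N.d1 (map_zero π.f0) x hx
  · exact fun x hx => D.err1_nilpotent C C' N.d0 N.d1 (map_zero π.f1) x hx

end Elimination

section Rows

set_option linter.unusedSectionVars false

variable {R S T : Type} [CommRing R] [Algebra ℚ R] [CommRing S] [Algebra ℚ S] [CommRing T]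
  [Algebra ℚ T] {𝒜 : ℤ → Submodule ℚ R} {ℬ : ℤ → Submodule ℚ S} {𝒞 : ℤ → Submodule ℚ T}
  [SetLike.GradedMonoid 𝒜] [SetLike.GradedMonoid ℬ] [SetLike.GradedMonoid 𝒞] {c : ℤ}

/-! ## Koszul factorizations and base change -/

theorem GrMod.tensor_self_mem_zero {N : GrMod 𝒜} (j : ℤ) (x : N ⊗[R] R) :
    TensorProduct.rid R N x ∈ N.gr j ↔ x ∈ (N.tensor (GrMod.self 𝒜)).gr j := by
  constructor
  · intro h
    have e : x = TensorProduct.rid R N x ⊗ₜ[R] (1 : R) :=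
      ((TensorProduct.rid R N).symm_apply_apply x).symm
    rw [e]
    exact tmul_mem (N := GrMod.self 𝒜) (add_zero j) h (SetLike.one_mem_graded 𝒜)
  · refine tensor_induction (N := GrMod.self 𝒜)
      (TensorProduct.rid R N).toLinearMap.toAddMonoidHom _ j ?_ x
    rintro k i m n rfl hm hn
    exact smul_mem_of_eq (i := i) hn hm (add_comm _ _)

theorem rid_mulLeft_lTensor {N : Type} [AddCommGroup N] [Module R N] (a : R) (x : N ⊗[R] R) :
    a • TensorProduct.rid R N x = TensorProduct.rid R N ((LinearMap.mulLeft R a).lTensor N x) := by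
  induction x with
  | zero => simp only [map_zero, smul_zero]
  | add x y hx hy => simp only [map_add, smul_add, hx, hy]
  | tmul x y => simp [mul_smul]

theorem rid_mulLeft_rTensor (a : R) (x : R ⊗[R] R) :
    a • TensorProduct.rid R R x = TensorProduct.rid R R ((LinearMap.mulLeft R a).rTensor R x) := by
  induction x with
  | zero => simp only [map_zero, smul_zero]
  | add x y hx hy => simp only [map_add, smul_add, hx, hy]
  | tmul x y => simp; ring

namespace KoszulRows

/-- The tensor product of two Koszul factorizations with one row. -/
def tensorEquiv (D : KoszulRows 𝒜 c) {α₁ β₁ α₂ β₂ : ℤ} (ha₁ : D.a₁ ∈ 𝒜 α₁) (hb₁ : D.b₁ ∈ 𝒜 β₁)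
    (ha₂ : D.a₂ ∈ 𝒜 α₂) (hb₂ : D.b₂ ∈ 𝒜 β₂) (h₁ : α₁ + β₁ = 2 * c) (h₂ : α₂ + β₂ = 2 * c)
    (e₁ : D.κ₁ = c - α₁) (e₂ : D.κ₂ = c - α₂) :
    MF.GEquiv (MF.tensor (MF.koszul D.a₁ D.b₁ α₁ β₁ ha₁ hb₁ h₁)
      (MF.koszul D.a₂ D.b₂ α₂ β₂ ha₂ hb₂ h₂)) (D.mf 0) where
  e0 := (TensorProduct.rid R R).prodCongr (TensorProduct.rid R R)
  e1 := (TensorProduct.rid R R).prodCongr (TensorProduct.rid R R)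
  mem0 j x := by
    refine and_congr ?_ ?_
    · refine Iff.trans ?_ (GrMod.tensor_self_mem_zero (N := GrMod.self 𝒜) j x.1)
      change _ ∈ 𝒜 (j - 0) ↔ _ ∈ 𝒜 j
      rw [sub_zero]; rfl
    · refine Iff.trans ?_ (GrMod.tensor_self_mem
        (N := (GrMod.self 𝒜).shift ((β₁ - α₁) / 2)) ((β₂ - α₂) / 2) j x.2)
      change _ ∈ 𝒜 (j - (0 + D.κ₁ + D.κ₂)) ↔ _ ∈ 𝒜 (j - (β₂ - α₂) / 2 - (β₁ - α₁) / 2)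
      -- Since `αᵢ + βᵢ = 2c` and `κᵢ = c - αᵢ`, the half difference `(βᵢ - αᵢ) / 2` is exactly
      -- `κᵢ`.
      rw [show j - (β₂ - α₂) / 2 - (β₁ - α₁) / 2 = j - (0 + D.κ₁ + D.κ₂) by omega]; rfl
  mem1 j x := by
    refine and_congr ?_ ?_
    · refine Iff.trans ?_ (GrMod.tensor_self_mem_zero
        (N := (GrMod.self 𝒜).shift ((β₁ - α₁) / 2)) j x.1)
      change _ ∈ 𝒜 (j - (0 + D.κ₁)) ↔ _ ∈ 𝒜 (j - (β₁ - α₁) / 2)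
      rw [show j - (β₁ - α₁) / 2 = j - (0 + D.κ₁) by omega]; rfl
    · refine Iff.trans ?_ (GrMod.tensor_self_mem (N := GrMod.self 𝒜) ((β₂ - α₂) / 2) j x.2)
      change _ ∈ 𝒜 (j - (0 + D.κ₂)) ↔ _ ∈ 𝒜 (j - (β₂ - α₂) / 2)
      rw [show j - (β₂ - α₂) / 2 = j - (0 + D.κ₂) by omega]; rfl
  comm0 := by
    rintro ⟨(u : R ⊗[R] R), (v : R ⊗[R] R)⟩
    refine Prod.ext ?_ ?_
    · change D.a₁ • TensorProduct.rid R R u - D.b₂ • TensorProduct.rid R R v =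
        TensorProduct.rid R R ((LinearMap.mulLeft R D.a₁).rTensor R u -
          (LinearMap.mulLeft R D.b₂).lTensor R v)
      rw [map_sub, rid_mulLeft_rTensor, rid_mulLeft_lTensor]
    · change D.a₂ • TensorProduct.rid R R u + D.b₁ • TensorProduct.rid R R v =
        TensorProduct.rid R R ((LinearMap.mulLeft R D.a₂).lTensor R u +
          (LinearMap.mulLeft R D.b₁).rTensor R v)
      rw [map_add, rid_mulLeft_rTensor D.b₁, rid_mulLeft_lTensor D.a₂]
  comm1 := by
    rintro ⟨(u : R ⊗[R] R), (v : R ⊗[R] R)⟩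
    refine Prod.ext ?_ ?_
    · change D.b₁ • TensorProduct.rid R R u + D.b₂ • TensorProduct.rid R R v =
        TensorProduct.rid R R ((LinearMap.mulLeft R D.b₁).rTensor R u +
          (LinearMap.mulLeft R D.b₂).lTensor R v)
      rw [map_add, rid_mulLeft_rTensor, rid_mulLeft_lTensor]
    · change D.a₁ • TensorProduct.rid R R v - D.a₂ • TensorProduct.rid R R u =
        TensorProduct.rid R R (-(LinearMap.mulLeft R D.a₂).lTensor R u +
          (LinearMap.mulLeft R D.a₁).rTensor R v)
      rw [map_add, map_neg, rid_mulLeft_rTensor, rid_mulLeft_lTensor, sub_eq_neg_add]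

/-- Shifts of Koszul factorizations. -/
def shiftEquiv (D : KoszulRows 𝒜 c) (k l : ℤ) : MF.GEquiv ((D.mf k).shift l) (D.mf (k + l)) where
  e0 := .refl R (R × R)
  e1 := .refl R (R × R)
  mem0 j x := by
    refine and_congr ?_ ?_
    · change _ ∈ 𝒜 (j - (k + l)) ↔ _ ∈ 𝒜 (j - l - k)
      rw [show j - l - k = j - (k + l) by ring]; rfl
    · change _ ∈ 𝒜 (j - (k + l + D.κ₁ + D.κ₂)) ↔ _ ∈ 𝒜 (j - l - (k + D.κ₁ + D.κ₂))
      rw [show j - l - (k + D.κ₁ + D.κ₂) = j - (k + l + D.κ₁ + D.κ₂) by ring]; rfl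
  mem1 j x := by
    refine and_congr ?_ ?_
    · change _ ∈ 𝒜 (j - (k + l + D.κ₁)) ↔ _ ∈ 𝒜 (j - l - (k + D.κ₁))
      rw [show j - l - (k + D.κ₁) = j - (k + l + D.κ₁) by ring]; rfl
    · change _ ∈ 𝒜 (j - (k + l + D.κ₂)) ↔ _ ∈ 𝒜 (j - l - (k + D.κ₂))
      rw [show j - l - (k + D.κ₂) = j - (k + l + D.κ₂) by ring]; rfl
  comm0 _ := rfl
  comm1 _ := rfl

/-- Base change of the rows. -/
def map (D : KoszulRows 𝒜 c) (φ : R →+* S) (hφ : ∀ j, ∀ r ∈ 𝒜 j, φ r ∈ ℬ j) : KoszulRows ℬ c where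
  a₁ := φ D.a₁
  b₁ := φ D.b₁
  a₂ := φ D.a₂
  b₂ := φ D.b₂
  κ₁ := D.κ₁
  κ₂ := D.κ₂
  ha₁ := hφ _ _ D.ha₁
  hb₁ := hφ _ _ D.hb₁
  ha₂ := hφ _ _ D.ha₂
  hb₂ := hφ _ _ D.hb₂

theorem map_potential (D : KoszulRows 𝒜 c) (φ : R →+* S) (hφ : ∀ j, ∀ r ∈ 𝒜 j, φ r ∈ ℬ j) :
    (D.map φ hφ).potential = φ D.potential := by
  simp [potential, map]

/-- A ring homomorphism, applied to pairs. -/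
def pairMap (φ : R →+* S) : R × R →ₛₗ[φ] S × S where
  toFun x := (φ x.1, φ x.2)
  map_add' x y := by simp
  map_smul' r x := by simp

/-- The standard basis of the module of pairs. -/
def pairBasis (R : Type) [CommRing R] : Module.Basis (Unit ⊕ Unit) R (R × R) :=
  (Module.Basis.singleton Unit R).prod (Module.Basis.singleton Unit R)

theorem pairBasis_repr_inl (x : R × R) (i : Unit) :
    (pairBasis R).repr x (Sum.inl i) = x.1 := by simp [pairBasis]

theorem pairBasis_repr_inr (x : R × R) (i : Unit) :
    (pairBasis R).repr x (Sum.inr i) = x.2 := by simp [pairBasis]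

theorem isHomogeneousBasis_pairBasis (k l : ℤ) :
    IsHomogeneousBasis 𝒜 (M := R × R) (((GrMod.self 𝒜).shift k).prod ((GrMod.self 𝒜).shift l)).gr
      (pairBasis R) (Sum.elim (fun _ => k) (fun _ => l)) := by
  rintro j ⟨x, y⟩
  rw [Sum.forall]
  simp only [pairBasis_repr_inl, pairBasis_repr_inr, Sum.elim_inl, Sum.elim_inr, forall_const]
  rfl

theorem pairMap_pairBasis (φ : R →+* S) (i : Unit ⊕ Unit) :
    pairBasis S i = pairMap φ (pairBasis R i) := by
  refine (pairBasis S).repr.injective (Finsupp.ext fun k => ?_)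
  rcases i with i | i <;> rcases k with k | k <;>
    simp [pairBasis, pairMap]

theorem preservesBasis_pairMap (φ : R →+* S) (k l : ℤ) :
    PreservesBasis (M := ((GrMod.self 𝒜).shift k).prod ((GrMod.self 𝒜).shift l))
      (N := ((GrMod.self ℬ).shift k).prod ((GrMod.self ℬ).shift l)) (pairMap φ) :=
  ⟨Unit ⊕ Unit, pairBasis R, pairBasis S, Sum.elim (fun _ => k) (fun _ => l),
    isHomogeneousBasis_pairBasis k l, isHomogeneousBasis_pairBasis k l, pairMap_pairBasis φ⟩

theorem exists_isExt_map (D : KoszulRows 𝒜 c) (φ : R →+* S) (hφ : ∀ j, ∀ r ∈ 𝒜 j, φ r ∈ ℬ j)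
    (k : ℤ) : ∃ η : MF.SemiHom φ (D.mf k) ((D.map φ hφ).mf k), η.IsExt := by
  refine ⟨⟨pairMap φ, pairMap φ, ?_, ?_⟩, preservesBasis_pairMap φ _ _,
    preservesBasis_pairMap φ _ _⟩
  · rintro ⟨(x : R), (y : R)⟩
    change (φ D.a₁ * φ x - φ D.b₂ * φ y, φ D.a₂ * φ x + φ D.b₁ * φ y) =
      (φ (D.a₁ * x - D.b₂ * y), φ (D.a₂ * x + D.b₁ * y))
    simp
  · rintro ⟨(x : R), (y : R)⟩
    change (φ D.b₁ * φ x + φ D.b₂ * φ y, φ D.a₁ * φ y - φ D.a₂ * φ x) =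
      (φ (D.b₁ * x + D.b₂ * y), φ (D.a₁ * y - D.a₂ * x))
    simp

/-- Applying `φ` to the entries of the matrices is one base change of `M`, and the extension is
another; uniqueness of base change identifies them. -/
theorem nonempty_extend_gequiv (D : KoszulRows 𝒜 c) (φ : R →+* S)
    (hφ : ∀ j, ∀ r ∈ 𝒜 j, φ r ∈ ℬ j) {ω : R} {M : MF 𝒜 c ω} {k : ℤ} (e : MF.GEquiv M (D.mf k)) :
    Nonempty (MF.GEquiv (M.extend φ hφ) ((D.map φ hφ).mf k)) := by
  obtain ⟨η, hη⟩ := MF.exists_extend_isStrongExt φ hφ M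
  obtain ⟨ζ, hζ⟩ := D.exists_isExt_map φ hφ k
  obtain ⟨ζ', hζ'⟩ := hζ.of_gequiv e
  exact MF.nonempty_gequiv_of_isExt η hη ζ' hζ'

end KoszulRows

/-- Elimination of the rows of a base change of a Koszul factorization from its tensor product with
another base change. -/
theorem nonempty_iso_tensor_extend {R₁ R₂ : Type} [CommRing R₁] [Algebra ℚ R₁] [CommRing R₂]
    [Algebra ℚ R₂] {𝒜₁ : ℤ → Submodule ℚ R₁} {𝒜₂ : ℤ → Submodule ℚ R₂} [SetLike.GradedMonoid 𝒜₁]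
    [SetLike.GradedMonoid 𝒜₂] {φ : T →+* R}
    (hφ : letI := Module.compHom R φ
      IsFreeGraded (R := T) (M := R) 𝒞 (fun j => (𝒜 j).toAddSubgroup))
    {ψ : T →+* S} (hψ : letI := Module.compHom S ψ
      IsFreeGraded (R := T) (M := S) 𝒞 (fun j => (ℬ j).toAddSubgroup))
    {ρ : R →+* S} (hρ : ∀ r, ρ (φ r) = ψ r) {θ₁ : R₁ →+* R} (hθ₁ : ∀ j, ∀ r ∈ 𝒜₁ j, θ₁ r ∈ 𝒜 j)
    {θ₂ : R₂ →+* R} (hθ₂ : ∀ j, ∀ r ∈ 𝒜₂ j, θ₂ r ∈ 𝒜 j) {χ : R₁ →+* S}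
    (hχ : ∀ r, ρ (θ₁ r) = χ r) (D : KoszulRows 𝒜₂ c)
    (H : IsKoszulResolution ρ 𝒜 ℬ (θ₂ D.b₁) (θ₂ D.b₂) (c + D.κ₁) (c + D.κ₂)) {ω₁ : R₁} {ω₂ : R₂}
    {ωQ : S} {N : MF 𝒜₁ c ω₁} {K : MF 𝒜₂ c ω₂} {Q : MF ℬ c ωQ} {k : ℤ}
    (e : MF.GEquiv K (D.mf k)) (hω₂ : ω₂ = D.potential) (ζ : MF.SemiHom χ N Q) (hζ : ζ.IsExt)
    {ω : T} (h1 : θ₁ ω₁ + θ₂ ω₂ = φ ω) (h2 : ωQ = ψ ω) :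
    Nonempty ((MF.restrict φ hφ (MF.ofEq h1 ((N.extend θ₁ hθ₁).tensor (K.extend θ₂ hθ₂)))).toHMF ≅
      (MF.restrict ψ hψ (MF.ofEq h2 (Q.shift k))).toHMF) := by
  obtain ⟨η, hη⟩ := MF.exists_extend_isStrongExt θ₁ hθ₁ N
  -- As `χ = ρ θ₁`, the base change of `N` along `χ` is also the base change along `ρ` of the
  -- extension of `N` to `R`, which is what elimination requires.
  obtain ⟨π, hπ⟩ := MF.SemiHom.exists_factor hχ η hη ζ hζ
  obtain ⟨e'⟩ := D.nonempty_extend_gequiv θ₂ hθ₂ e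
  have h3 : θ₁ ω₁ + (D.map θ₂ hθ₂).potential = φ ω := by
    rw [KoszulRows.map_potential, ← hω₂, h1]
  obtain ⟨i⟩ := nonempty_iso_elimination hφ hψ hρ (D.map θ₂ hθ₂) H π hπ k h3 h2
  have g : MF.GEquiv (MF.ofEq h1 ((N.extend θ₁ hθ₁).tensor (K.extend θ₂ hθ₂)))
      (MF.ofEq h3 ((D.map θ₂ hθ₂).tensorMf (N.extend θ₁ hθ₁) k)) :=
    ((MF.GEquiv.ofEq _ _).trans ((MF.GEquiv.lTensor _ e').trans
      (MF.GEquiv.tensorKoszul _ _ k))).trans (MF.GEquiv.ofEq _ _).symm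
  obtain ⟨i'⟩ := (g.restrict φ hφ).nonempty_iso
  exact ⟨i'.trans i⟩

end Rows

section Resolution

/-! ## Koszul resolutions of polynomial rings -/

/-- Used to make solutions homogeneous: if the coefficients and the right-hand side of a linear
equation are homogeneous, suitable components of a solution solve it again. -/
theorem weightedHomogeneousComponent_mul_of_mem {σ : Type} (w : σ → ℤ) {i : ℤ}
    {b : MvPolynomial σ ℚ} (hb : MvPolynomial.IsWeightedHomogeneous w b i) (p : MvPolynomial σ ℚ)
    (j : ℤ) : MvPolynomial.weightedHomogeneousComponent w j (b * p) =
      b * MvPolynomial.weightedHomogeneousComponent w (j - i) p := by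
  let _ := MvPolynomial.weightedGradedAlgebra ℚ w
  have := DirectSum.coe_decompose_mul_add_of_left_mem
    (MvPolynomial.weightedHomogeneousSubmodule ℚ w) (j := j - i) (b := p) hb
  rw [add_sub_cancel] at this
  have e : ∀ (r : MvPolynomial σ ℚ) (k : ℤ), (DirectSum.decompose
      (MvPolynomial.weightedHomogeneousSubmodule ℚ w) r k : MvPolynomial σ ℚ) =
      MvPolynomial.weightedHomogeneousComponent w k r :=
    MvPolynomial.weightedDecomposition.decompose'_apply ℚ w
  rwa [e, e] at this

/-- Modulo `b`, the maps `τ` and the identity are algebra homomorphisms that agree on the variables,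
hence everywhere. -/
theorem dvd_sub_of_forall_X {σ : Type} {b : MvPolynomial σ ℚ}
    (τ : MvPolynomial σ ℚ →ₐ[ℚ] MvPolynomial σ ℚ)
    (h : ∀ v, b ∣ MvPolynomial.X v - τ (MvPolynomial.X v)) (r : MvPolynomial σ ℚ) :
    b ∣ r - τ r := by
  have key : (Ideal.Quotient.mkₐ ℚ (Ideal.span {b})).comp τ = Ideal.Quotient.mkₐ ℚ (Ideal.span {b}) :=
    MvPolynomial.algHom_ext fun v => by
      have := (Ideal.Quotient.eq (I := Ideal.span {b})).2 (Ideal.mem_span_singleton.2 (h v))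
      exact this.symm
  have := DFunLike.congr_fun key r
  exact Ideal.mem_span_singleton.1 (Ideal.Quotient.eq.1 this.symm)

theorem mem_span_pair_of_forall_X {σ : Type} {b₁ b₂ : MvPolynomial σ ℚ}
    (τ : MvPolynomial σ ℚ →ₐ[ℚ] MvPolynomial σ ℚ)
    (h : ∀ v, MvPolynomial.X v - τ (MvPolynomial.X v) ∈ Ideal.span {b₁, b₂})
    (r : MvPolynomial σ ℚ) : ∃ p q, b₁ * p + b₂ * q = r - τ r := by
  have key : (Ideal.Quotient.mkₐ ℚ (Ideal.span {b₁, b₂})).comp τ =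
      Ideal.Quotient.mkₐ ℚ (Ideal.span {b₁, b₂}) :=
    MvPolynomial.algHom_ext fun v => ((Ideal.Quotient.eq (I := Ideal.span {b₁, b₂})).2 (h v)).symm
  have := DFunLike.congr_fun key r
  obtain ⟨p, q, e⟩ := Ideal.mem_span_pair.1 (Ideal.Quotient.eq.1 this.symm)
  exact ⟨p, q, Eq.trans (by ring) e⟩

/-- Regularity of the sequence. The substitution `τ` models reduction modulo `b₁` inside a domain.
Applied to the relation it gives `τ b₂ * τ q = 0`, so `τ q = 0` and `b₁` divides `q`; cancelling
`b₁` then determines `p`. -/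
theorem exists_syzygy_of_section {σ : Type} {b₁ b₂ : MvPolynomial σ ℚ}
    (τ : MvPolynomial σ ℚ →ₐ[ℚ] MvPolynomial σ ℚ)
    (h : ∀ v, b₁ ∣ MvPolynomial.X v - τ (MvPolynomial.X v)) (h₁ : τ b₁ = 0) (h₂ : τ b₂ ≠ 0)
    (h0 : b₁ ≠ 0) {p q : MvPolynomial σ ℚ} (e : b₁ * p + b₂ * q = 0) :
    ∃ m, -(b₂ * m) = p ∧ b₁ * m = q := by
  have e1 := congrArg τ e
  rw [map_add, map_mul, map_mul, h₁, zero_mul, zero_add, map_zero] at e1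
  have e2 : τ q = 0 := (mul_eq_zero.1 e1).resolve_left h₂
  have e3 := dvd_sub_of_forall_X τ h q
  rw [e2, sub_zero] at e3
  obtain ⟨m, rfl⟩ := e3
  refine ⟨m, mul_left_cancel₀ h0 ?_, rfl⟩
  linear_combination -e

/-- With a section `ι` of `ρ`, every `r` is congruent to `ι (ρ r)` modulo `(b₁, b₂)`, so the kernel
of `ρ` is that ideal. The coefficients found in this way are replaced by their homogeneous
components. -/
theorem isKoszulResolution_of_section {σ S : Type} [CommRing S] [Algebra ℚ S] (w : σ → ℤ)
    {ℬ : ℤ → Submodule ℚ S} (ρ : MvPolynomial σ ℚ →ₐ[ℚ] S) (ι : S →ₐ[ℚ] MvPolynomial σ ℚ)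
    (hρ : ∀ j, ∀ r, MvPolynomial.IsWeightedHomogeneous w r j → ρ r ∈ ℬ j)
    (hι : ∀ j, ∀ s ∈ ℬ j, MvPolynomial.IsWeightedHomogeneous w (ι s) j)
    (hρι : ∀ s, ρ (ι s) = s) {b₁ b₂ : MvPolynomial σ ℚ} {β₁ β₂ : ℤ}
    (hb₁ : MvPolynomial.IsWeightedHomogeneous w b₁ β₁)
    (hb₂ : MvPolynomial.IsWeightedHomogeneous w b₂ β₂) (h₁ : ρ b₁ = 0) (h₂ : ρ b₂ = 0)
    (hker : ∀ v, MvPolynomial.X v - ι (ρ (MvPolynomial.X v)) ∈ Ideal.span {b₁, b₂})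
    (τ : MvPolynomial σ ℚ →ₐ[ℚ] MvPolynomial σ ℚ)
    (hτ : ∀ v, b₁ ∣ MvPolynomial.X v - τ (MvPolynomial.X v)) (hτ₁ : τ b₁ = 0) (hτ₂ : τ b₂ ≠ 0)
    (h0 : b₁ ≠ 0) :
    IsKoszulResolution (ρ : MvPolynomial σ ℚ →+* S) (MvPolynomial.weightedHomogeneousSubmodule ℚ w)
      ℬ b₁ b₂ β₁ β₂ where
  map_mem j r hr := hρ j r hr
  surj j s hs := ⟨ι s, hι j s hs, hρι s⟩
  ker j r hr hr0 := by
    obtain ⟨p, q, e⟩ := mem_span_pair_of_forall_X (ι.comp ρ) hker r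
    have e' : b₁ * p + b₂ * q = r := by
      rw [e, AlgHom.comp_apply, show ρ r = 0 from hr0, map_zero, sub_zero]
    refine ⟨_, MvPolynomial.weightedHomogeneousComponent_mem w p (j - β₁), _,
      MvPolynomial.weightedHomogeneousComponent_mem w q (j - β₂), ?_⟩
    rw [← weightedHomogeneousComponent_mul_of_mem w hb₁,
      ← weightedHomogeneousComponent_mul_of_mem w hb₂, ← map_add, e',
      MvPolynomial.weightedHomogeneousComponent_eq_self hr]
  syz j p hp q hq e := by
    obtain ⟨m, e₁, e₂⟩ := exists_syzygy_of_section τ hτ hτ₁ hτ₂ h0 e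
    refine ⟨_, MvPolynomial.weightedHomogeneousComponent_mem w m (j - (β₁ + β₂)), ?_, ?_⟩
    · rw [show j - (β₁ + β₂) = j - β₁ - β₂ by ring,
        ← weightedHomogeneousComponent_mul_of_mem w hb₂, ← map_neg, e₁,
        MvPolynomial.weightedHomogeneousComponent_eq_self hp]
    · rw [show j - (β₁ + β₂) = j - β₂ - β₁ by ring,
        ← weightedHomogeneousComponent_mul_of_mem w hb₁, e₂,
        MvPolynomial.weightedHomogeneousComponent_eq_self hq]
  inj m hm := (mul_eq_zero.1 hm).resolve_left h0
  map_b₁ := h₁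
  map_b₂ := h₂

/-- Two rows `(±(v₁ - s), ±(v₂ - t))` allow one to eliminate the variables `v₁` and `v₂`. -/
theorem isKoszulResolution_of_elimination {σ S : Type} [CommRing S] [Algebra ℚ S] (w : σ → ℤ)
    {ℬ : ℤ → Submodule ℚ S} (ρ : MvPolynomial σ ℚ →ₐ[ℚ] S) (ι : S →ₐ[ℚ] MvPolynomial σ ℚ)
    (hρ : ∀ j, ∀ r, MvPolynomial.IsWeightedHomogeneous w r j → ρ r ∈ ℬ j)
    (hι : ∀ j, ∀ s ∈ ℬ j, MvPolynomial.IsWeightedHomogeneous w (ι s) j)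
    (hρι : ∀ s, ρ (ι s) = s) {b₁ b₂ : MvPolynomial σ ℚ} {β₁ β₂ : ℤ}
    (hb₁ : MvPolynomial.IsWeightedHomogeneous w b₁ β₁)
    (hb₂ : MvPolynomial.IsWeightedHomogeneous w b₂ β₂) (v₁ v₂ : σ) (hv : v₁ ≠ v₂)
    {s t : MvPolynomial σ ℚ} {u : ℚ} (hu : u ≠ 0)
    (e₁ : b₁ = u • (MvPolynomial.X v₁ - s)) (e₂ : b₂ = u • (MvPolynomial.X v₂ - t))
    (h₁ : ι (ρ (MvPolynomial.X v₁)) = s) (h₂ : ι (ρ (MvPolynomial.X v₂)) = t)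
    (hfix : ∀ v, v ≠ v₁ → v ≠ v₂ → ι (ρ (MvPolynomial.X v)) = MvPolynomial.X v)
    (hs : v₁ ∉ s.vars) (hs' : v₂ ∉ s.vars) (ht : v₁ ∉ t.vars) (ht' : v₂ ∉ t.vars) :
    IsKoszulResolution (ρ : MvPolynomial σ ℚ →+* S) (MvPolynomial.weightedHomogeneousSubmodule ℚ w)
      ℬ b₁ b₂ β₁ β₂ := by
  classical
  have hbind : ∀ (g : σ → MvPolynomial σ ℚ) (r : MvPolynomial σ ℚ),
      (∀ v ∈ r.vars, g v = MvPolynomial.X v) → MvPolynomial.aeval g r = r := by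
    intro g r h
    conv_rhs => rw [← MvPolynomial.aeval_X_left_apply r]
    exact MvPolynomial.eval₂Hom_congr' rfl (fun v hv _ => h v hv) rfl
  have hne : ∀ (v : σ) (r : MvPolynomial σ ℚ), v ∉ r.vars → MvPolynomial.X v - r ≠ 0 := by
    intro v r h h'
    apply h
    rw [← sub_eq_zero.1 h', MvPolynomial.vars_X]
    exact Finset.mem_singleton_self v
  have hunit : ∀ r : MvPolynomial σ ℚ, r = u • ((1 / u) • r) := fun r => by
    rw [smul_smul, mul_one_div_cancel hu, one_smul]
  have hinj : ∀ r : S, ∀ r', ι r = ι r' → r = r' := fun r r' h => by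
    rw [← hρι r, h, hρι]
  have hret : ∀ r, (∀ v ∈ r.vars, v ≠ v₁ ∧ v ≠ v₂) → ι (ρ r) = r := fun r h => by
    have : ι (ρ r) = MvPolynomial.aeval (fun v => ι (ρ (MvPolynomial.X v))) r :=
      DFunLike.congr_fun (MvPolynomial.aeval_unique (ι.comp ρ)) r
    rw [this]
    exact hbind _ r fun v hv => hfix v (h v hv).1 (h v hv).2
  have hs'' : ι (ρ s) = s := hret s fun _ hv =>
    ⟨ne_of_mem_of_not_mem hv hs, ne_of_mem_of_not_mem hv hs'⟩
  have ht'' : ι (ρ t) = t := hret t fun _ hv =>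
    ⟨ne_of_mem_of_not_mem hv ht, ne_of_mem_of_not_mem hv ht'⟩
  have m₁ : MvPolynomial.X v₁ - s ∈ Ideal.span {b₁, b₂} := by
    rw [hunit (MvPolynomial.X v₁ - s), smul_comm, ← e₁]
    exact Submodule.smul_of_tower_mem _ _ (Ideal.subset_span (Set.mem_insert _ _))
  have m₂ : MvPolynomial.X v₂ - t ∈ Ideal.span {b₁, b₂} := by
    rw [hunit (MvPolynomial.X v₂ - t), smul_comm, ← e₂]
    exact Submodule.smul_of_tower_mem _ _ (Ideal.subset_span (Set.mem_insert_of_mem _ rfl))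
  -- Only `v₁` is substituted. This kills `b₁` and fixes `b₂`, since neither `v₂` nor `t` involves
  -- `v₁`; and `b₂` is nonzero because `v₂` does not occur in `t`.
  let τ : MvPolynomial σ ℚ →ₐ[ℚ] MvPolynomial σ ℚ :=
    MvPolynomial.aeval fun v => if v = v₁ then s else MvPolynomial.X v
  have τs : τ s = s := hbind _ s fun v hv => if_neg (ne_of_mem_of_not_mem hv hs)
  have τt : τ t = t := hbind _ t fun v hv => if_neg (ne_of_mem_of_not_mem hv ht)
  refine isKoszulResolution_of_section w ρ ι hρ hι hρι hb₁ hb₂ ?_ ?_ ?_ τ ?_ ?_ ?_ ?_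
  · rw [e₁, map_smul]
    apply hinj
    rw [map_smul, map_sub, map_sub, h₁, hs'', sub_self, smul_zero, map_zero]
  · rw [e₂, map_smul]
    apply hinj
    rw [map_smul, map_sub, map_sub, h₂, ht'', sub_self, smul_zero, map_zero]
  · intro v
    by_cases hv₁ : v = v₁
    · rw [hv₁, h₁]; exact m₁
    · by_cases hv₂ : v = v₂
      · rw [hv₂, h₂]; exact m₂
      · rw [hfix v hv₁ hv₂, sub_self]; exact zero_mem _
  · intro v
    rw [MvPolynomial.aeval_X]
    split_ifs with h
    · rw [h, e₁]
      exact ⟨MvPolynomial.C (1 / u), by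
        rw [mul_comm, ← MvPolynomial.smul_eq_C_mul, smul_comm, ← hunit]⟩
    · rw [sub_self]; exact dvd_zero _
  · rw [e₁, map_smul, map_sub, MvPolynomial.aeval_X, if_pos rfl, τs, sub_self, smul_zero]
  · rw [e₂, map_smul, map_sub, MvPolynomial.aeval_X, if_neg hv.symm, τt]
    exact smul_ne_zero hu (hne v₂ t ht')
  · rw [e₁]; exact smul_ne_zero hu (hne v₁ s hs)

end Resolution

section Diagrams

variable {S D : Type}

/-! ## The Koszul rows of the elementary diagrams -/

/-- The rows of `twoRow`. -/
def fRows (n : ℕ) (s t s' t' : BRing S D) (hs : s ∈ grade S D 2) (ht : t ∈ grade S D 4)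
    (hs' : s' ∈ grade S D 2) (ht' : t' ∈ grade S D 4) : KoszulRows (grade S D) (n + 1) where
  a₁ := fQuotFst n s s' t
  b₁ := s - s'
  a₂ := fQuotSnd n s' t t'
  b₂ := t - t'
  κ₁ := 1 - n
  κ₂ := 3 - n
  ha₁ := by rw [fQuotFst]; convert quotFst_mem hs hs' ht (n + 1) using 2; push_cast; ring
  hb₁ := by convert sub_mem hs hs' using 2; ring
  ha₂ := by rw [fQuotSnd]; convert quotSnd_mem hs' ht ht' (n + 1) using 2; push_cast; ring
  hb₂ := by convert sub_mem ht ht' using 2; ring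

theorem fRows_potential (n : ℕ) (s t s' t' : BRing S D) (hs : s ∈ grade S D 2)
    (ht : t ∈ grade S D 4) (hs' : s' ∈ grade S D 2) (ht' : t' ∈ grade S D 4) :
    f n s t - f n s' t' = (fRows n s t s' t' hs ht hs' ht').potential := by
  change _ = fQuotFst n s s' t * (s - s') + fQuotSnd n s' t t' * (t - t')
  rw [fQuotFst_mul, fQuotSnd_mul]; ring

/-- The factorization `K(s, t | s', t')` as a Koszul factorization in matrix form. -/
def twoRowEquiv (n : ℕ) (s t s' t' : BRing S D) (hs : s ∈ grade S D 2)
    (ht : t ∈ grade S D 4) (hs' : s' ∈ grade S D 2) (ht' : t' ∈ grade S D 4) :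
    MF.GEquiv (twoRow n s t s' t' hs ht hs' ht') ((fRows n s t s' t' hs ht hs' ht').mf 0) :=
  (MF.GEquiv.ofEq _ _).trans
    ((fRows n s t s' t' hs ht hs' ht').tensorEquiv _ _ _ _ _ _
      (by simp only [fRows]; ring) (by simp only [fRows]; ring))

theorem map_quotFst {A B : Type} [CommRing A] [CommRing B] (φ : A →+* B) (s s' t : A) :
    ∀ k, φ (quotFst s s' t k) = quotFst (φ s) (φ s') (φ t) k
  | 0 => by simp [quotFst]
  | 1 => by simp [quotFst]
  | k + 2 => by
    simp only [quotFst, map_sub, map_add, map_mul, map_powerSum, map_quotFst φ s s' t (k + 1),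
      map_quotFst φ s s' t k]

theorem map_quotSnd {A B : Type} [CommRing A] [CommRing B] (φ : A →+* B) (s t t' : A) :
    ∀ k, φ (quotSnd s t t' k) = quotSnd (φ s) (φ t) (φ t') k
  | 0 => by simp [quotSnd]
  | 1 => by simp [quotSnd]
  | k + 2 => by
    simp only [quotSnd, map_sub, map_add, map_mul, map_powerSum, map_quotSnd φ s t t' (k + 1),
      map_quotSnd φ s t t' k]

/-- The difference quotients are universal polynomials in their arguments, so they commute with `φ`.
The images enter through equations, which lets the target rows be written in their intended form. -/
theorem fRows_map {S' D' : Type} (n : ℕ) {s t s' t' : BRing S D} (hs : s ∈ grade S D 2)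
    (ht : t ∈ grade S D 4) (hs' : s' ∈ grade S D 2) (ht' : t' ∈ grade S D 4)
    (φ : BRing S D →+* BRing S' D') (hφ : ∀ j, ∀ r ∈ grade S D j, φ r ∈ grade S' D' j)
    {u v u' v' : BRing S' D'} (hu : u ∈ grade S' D' 2) (hv : v ∈ grade S' D' 4)
    (hu' : u' ∈ grade S' D' 2) (hv' : v' ∈ grade S' D' 4) (e₁ : φ s = u) (e₂ : φ t = v)
    (e₃ : φ s' = u') (e₄ : φ t' = v') :
    (fRows n s t s' t' hs ht hs' ht').map φ hφ = fRows n u v u' v' hu hv hu' hv' := by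
  subst e₁ e₂ e₃ e₄
  simp only [KoszulRows.map, fRows, fQuotFst, fQuotSnd, map_sub, map_quotFst, map_quotSnd]

/-! ## Prolongations -/

theorem shift_zero_nonempty_gequiv {R : Type} [CommRing R] [Algebra ℚ R] {𝒜 : ℤ → Submodule ℚ R}
    {c : ℤ} {ω : R} (M : MF 𝒜 c ω) : Nonempty (MF.GEquiv (M.shift 0) M) :=
  ⟨⟨.refl R M.X0, .refl R M.X1,
    fun j x => by
      change x ∈ M.X0.gr j ↔ x ∈ M.X0.gr (j - 0)
      rw [sub_zero],
    fun j x => by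
      change x ∈ M.X1.gr j ↔ x ∈ M.X1.gr (j - 0)
      rw [sub_zero], fun _ => rfl, fun _ => rfl⟩⟩

/-- Forgetting the inner point which is glued to the boundary point `Sum.inr ()`. -/
def contract (S D : Type) : BRing (S ⊕ Empty) ((D ⊕ Unit) ⊕ Unit) →+* BRing S (D ⊕ Unit) :=
  relabel (Sum.elim id Empty.elim) (Sum.elim id fun _ => Sum.inr ())

/-- The inner variables are eliminated in favour of those of the boundary point. The scalar `u`
absorbs the sign that depends on the direction of the double line. -/
theorem contract_resolution {β₁ β₂ : ℤ} {b₁ b₂ : BRing (S ⊕ Empty) ((D ⊕ Unit) ⊕ Unit)}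
    (hb₁ : b₁ ∈ grade _ _ β₁) (hb₂ : b₂ ∈ grade _ _ β₂) {u : ℚ} (hu : u ≠ 0)
    (e₁ : b₁ = u • (Y (Sum.inr ()) - Y (Sum.inl (Sum.inr ()))))
    (e₂ : b₂ = u • (Z (Sum.inr ()) - Z (Sum.inl (Sum.inr ())))) :
    IsKoszulResolution (contract S D) (grade _ _) (grade _ _) b₁ b₂ β₁ β₂ := by
  refine isKoszulResolution_of_elimination BVar.wt
    (MvPolynomial.rename (BVar.map (Sum.elim id Empty.elim) (Sum.elim id fun _ => Sum.inr ())))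
    (MvPolynomial.rename (BVar.map Sum.inl Sum.inl)) ?_ ?_ ?_ hb₁ hb₂ (BVar.y (Sum.inr ()))
    (BVar.z (Sum.inr ())) ?_ hu e₁ e₂ ?_ ?_ ?_ ?_ ?_ ?_ ?_
  · exact fun j r hr => relabel_mem _ _ j r hr
  · exact fun j r hr => relabel_mem _ _ j r hr
  · intro s
    rw [MvPolynomial.rename_rename]
    conv_rhs => rw [← MvPolynomial.rename_id_apply s]
    congr 2
    funext v
    cases v <;> rfl
  · simp
  · rw [MvPolynomial.rename_X, MvPolynomial.rename_X]; rfl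
  · rw [MvPolynomial.rename_X, MvPolynomial.rename_X]; rfl
  · rintro ((i | i) | (i | i) | (i | i)) h h'
    · rw [MvPolynomial.rename_X, MvPolynomial.rename_X]; rfl
    · exact i.elim
    · rw [MvPolynomial.rename_X, MvPolynomial.rename_X]; rfl
    · exact absurd rfl h
    · rw [MvPolynomial.rename_X, MvPolynomial.rename_X]; rfl
    · exact absurd rfl h'
  all_goals simp [Y, Z]

theorem contract_relabel {S' : Type} (s : S' → S ⊕ Empty) {D' : Type} (d : D' → (D ⊕ Unit) ⊕ Unit)
    (s' : S' → S) (d' : D' → D ⊕ Unit) (hs : ∀ i, Sum.elim id Empty.elim (s i) = s' i)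
    (hd : ∀ i, Sum.elim id (fun _ => Sum.inr ()) (d i) = d' i) (r : BRing S' D') :
    contract S D (relabel s d r) = relabel s' d' r := by
  rw [contract, relabel_relabel]
  congr 2
  · exact funext hs
  · exact funext hd

theorem relabel_id' (s : S → S) (d : D → D) (hs : ∀ i, s i = i) (hd : ∀ i, d i = i) :
    relabel s d = RingHom.id (BRing S D) := by
  obtain rfl : s = id := funext hs
  obtain rfl : d = id := funext hd
  refine RingHom.ext fun r => ?_
  have : BVar.map (id : S → S) (id : D → D) = id := by funext v; cases v <;> rfl
  change MvPolynomial.rename _ r = r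
  rw [this, MvPolynomial.rename_id_apply]

/-- The ring homomorphisms behind the prolongation of a diagram. -/
theorem contract_relabel_id (s : S → S ⊕ Empty) (d : D ⊕ Unit → (D ⊕ Unit) ⊕ Unit)
    (hs : ∀ i, Sum.elim id Empty.elim (s i) = i)
    (hd : ∀ i, Sum.elim id (fun _ => Sum.inr ()) (d i) = i) (r : BRing S (D ⊕ Unit)) :
    contract S D (relabel s d r) = RingHom.id (BRing S (D ⊕ Unit)) r := by
  rw [contract_relabel s d id id hs hd, relabel_id' id id (fun _ => rfl) fun _ => rfl]

/-! ### Gluing as elimination of rows. -/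

section Glue

variable {S₁ D₁ S₂ D₂ S' D' S₀ D₀ : Type} {c : ℤ} {ω₁ : BRing S₁ D₁} {ω₂ : BRing S₂ D₂}

/-- Gluing a Koszul factorization whose rows can be eliminated. -/
theorem nonempty_glue_iso (M : MFgr S₁ D₁ c ω₁) (s₁ : S₁ → S ⊕ S') (d₁ : D₁ → D ⊕ D')
    (N : MFgr S₂ D₂ c ω₂) (s₂ : S₂ → S ⊕ S') (d₂ : D₂ → D ⊕ D') (ω : BRing S D)
    (h : relabel s₁ d₁ ω₁ + relabel s₂ d₂ ω₂ = relabel Sum.inl Sum.inl ω)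
    {ψ : BRing S D →+* BRing S₀ D₀} (hψ : letI := Module.compHom (BRing S₀ D₀) ψ
      IsFreeGraded (R := BRing S D) (M := BRing S₀ D₀) (grade S D)
        (fun j => (grade S₀ D₀ j).toAddSubgroup))
    (ρ : BRing (S ⊕ S') (D ⊕ D') →+* BRing S₀ D₀)
    (hρ : ∀ r, ρ (relabel Sum.inl Sum.inl r) = ψ r) {χ : BRing S₁ D₁ →+* BRing S₀ D₀}
    (hχ : ∀ r, ρ (relabel s₁ d₁ r) = χ r) (E : KoszulRows (grade S₂ D₂) c)
    (H : IsKoszulResolution ρ (grade _ _) (grade _ _) (relabel s₂ d₂ E.b₁) (relabel s₂ d₂ E.b₂)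
      (c + E.κ₁) (c + E.κ₂)) {k : ℤ} (e : MF.GEquiv N (E.mf k)) (hω₂ : ω₂ = E.potential)
    {ωQ : BRing S₀ D₀} {Q : MFgr S₀ D₀ c ωQ} {ζ : MF.SemiHom χ M Q} (hζ : ζ.IsExt)
    (h2 : ωQ = ψ ω) :
    Nonempty ((glue M s₁ d₁ N s₂ d₂ ω h).toHMF ≅
      (MF.restrict ψ hψ (MF.ofEq h2 (Q.shift k))).toHMF) :=
  nonempty_iso_tensor_extend (relabel_free S D S' D') hψ hρ (relabel_mem s₁ d₁)
    (relabel_mem s₂ d₂) hχ E H e hω₂ ζ hζ h h2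

/-- Gluing is symmetric. -/
theorem nonempty_glue_comm (M : MFgr S₁ D₁ c ω₁) (s₁ : S₁ → S ⊕ S') (d₁ : D₁ → D ⊕ D')
    (N : MFgr S₂ D₂ c ω₂) (s₂ : S₂ → S ⊕ S') (d₂ : D₂ → D ⊕ D') (ω : BRing S D)
    (h : relabel s₁ d₁ ω₁ + relabel s₂ d₂ ω₂ = relabel Sum.inl Sum.inl ω) :
    Nonempty ((glue M s₁ d₁ N s₂ d₂ ω h).toHMF ≅
      (glue N s₂ d₂ M s₁ d₁ ω ((add_comm _ _).trans h)).toHMF) :=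
  ((((MF.GEquiv.ofEq _ _).trans (MF.GEquiv.tensorComm (M.relabel s₁ d₁) (N.relabel s₂ d₂))).trans
    (MF.GEquiv.ofEq ((add_comm _ _).trans h) _).symm).restrict _
      (relabel_free S D S' D')).nonempty_iso

end Glue

/-- Gluing a double line to a diagram does not change it, provided that the Koszul rows of the
double line identify the inner point with the boundary point. -/
theorem nonempty_prolong_iso (n : ℕ) {ω₁ : BRing S (D ⊕ Unit)} (M : MFgr S (D ⊕ Unit) (n + 1) ω₁)
    (d₂ : Fin 2 → (D ⊕ Unit) ⊕ Unit) {u : ℚ} (hu : u ≠ 0)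
    (hy : (Y (d₂ 0) - Y (d₂ 1) : BRing (S ⊕ Empty) ((D ⊕ Unit) ⊕ Unit)) =
      u • (Y (Sum.inr ()) - Y (Sum.inl (Sum.inr ()))))
    (hz : (Z (d₂ 0) - Z (d₂ 1) : BRing (S ⊕ Empty) ((D ⊕ Unit) ⊕ Unit)) =
      u • (Z (Sum.inr ()) - Z (Sum.inl (Sum.inr ()))))
    (h : relabel Sum.inl (Sum.elim (fun i => Sum.inl (Sum.inl i)) Sum.inr) ω₁ +
      relabel Empty.elim d₂ (f n (Y 0) (Z 0) - f n (Y 1) (Z 1)) = relabel Sum.inl Sum.inl ω₁) :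
    Nonempty ((glue (S := S) (S' := Empty) (D := D ⊕ Unit) (D' := Unit) M Sum.inl
      (Sum.elim (fun i => Sum.inl (Sum.inl i)) Sum.inr) (doubleLine n) Empty.elim d₂ ω₁ h).toHMF ≅
        M.toHMF) := by
  obtain ⟨ζ, hζ⟩ := MF.exists_isExt_id M (φ := RingHom.id _) rfl
  let E := fRows (S := Empty) (D := Fin 2) n (Y 0) (Z 0) (Y 1) (Z 1) (Y_mem 0) (Z_mem 0)
    (Y_mem 1) (Z_mem 1)
  obtain ⟨i⟩ := nonempty_glue_iso M Sum.inl (Sum.elim (fun i => Sum.inl (Sum.inl i)) Sum.inr)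
    (doubleLine n) Empty.elim d₂ ω₁ h (isFreeGraded_id (𝒜 := grade S (D ⊕ Unit)) rfl)
    (contract S D) (contract_relabel_id _ _ (fun _ => rfl) fun _ => rfl)
    (contract_relabel_id _ _ (fun _ => rfl) (by rintro (i | i) <;> rfl)) E
    (contract_resolution (relabel_mem _ _ _ _ E.hb₁) (relabel_mem _ _ _ _ E.hb₂) hu
      (by rw [← hy]; change relabel _ _ (Y 0 - Y 1) = _; rw [map_sub, relabel_Y, relabel_Y])
      (by rw [← hz]; change relabel _ _ (Z 0 - Z 1) = _; rw [map_sub, relabel_Z, relabel_Z]))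
    (twoRowEquiv n (Y 0) (Z 0) (Y 1) (Z 1) (Y_mem 0) (Z_mem 0) (Y_mem 1) (Z_mem 1))
    (fRows_potential ..) hζ rfl
  obtain ⟨i'⟩ := shift_zero_nonempty_gequiv M
  obtain ⟨i''⟩ := ((MF.GEquiv.restrictId rfl (isFreeGraded_id rfl) _).trans
    ((MF.GEquiv.ofEq rfl _).trans i')).nonempty_iso
  exact ⟨i.trans i''⟩

/-- The head of the double line is the boundary point, so its rows are boundary minus inner
variables and `u = -1`. -/
theorem nonempty_prolongOut_iso (n : ℕ) (ω : BRing S D)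
    (M : MFgr S (D ⊕ Unit) (n + 1)
      (f n (Y (Sum.inr ())) (Z (Sum.inr ())) - relabel id Sum.inl ω)) :
    Nonempty ((prolongOut n ω M).toHMF ≅ M.toHMF) :=
  nonempty_prolong_iso n M _ (u := -1) (by norm_num) (by simp) (by simp) _

theorem nonempty_prolongIn_iso (n : ℕ) (ω : BRing S D)
    (M : MFgr S (D ⊕ Unit) (n + 1)
      (relabel id Sum.inl ω - f n (Y (Sum.inr ())) (Z (Sum.inr ())))) :
    Nonempty ((prolongIn n ω M).toHMF ≅ M.toHMF) := by
  have h := nonempty_prolong_iso n M ![Sum.inr (), Sum.inl (Sum.inr ())] (u := 1) one_ne_zero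
    (by simp) (by simp)
    (by
      simp only [map_sub, map_f, relabel_Y, relabel_Z, relabel_relabel, Sum.elim_inr]
      simp [Function.comp_def])
  -- In `prolongIn` the double line is the first tensor factor, whereas the rows to be eliminated
  -- belong to the second; symmetry of gluing exchanges them.
  exact Nonempty.map2 (fun i i' => i.trans i') (nonempty_glue_comm _ _ _ _ _ _ _ _) h

/-! ## Merging and splitting -/

theorem KoszulRows.nonempty_gequiv_of_eq {R : Type} [CommRing R] [Algebra ℚ R]
    {𝒜 : ℤ → Submodule ℚ R} [SetLike.GradedMonoid 𝒜] {c : ℤ} {E E' : KoszulRows 𝒜 c}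
    (h : E = E') (k : ℤ) : Nonempty (MF.GEquiv (E.mf k) (E'.mf k)) := by
  subst h
  exact ⟨.refl _⟩

/-- The rows of `trivalentOut`. -/
abbrev outRows (n : ℕ) : KoszulRows (grade (Fin 2) Unit) (n + 1) :=
  fRows n (X 0 + X 1) (X 0 * X 1) (Y ()) (Z ()) (X_add_X_mem 0 1) (X_mul_X_mem 0 1) (Y_mem ())
    (Z_mem ())

/-- The rows of `trivalentIn`. -/
abbrev inRows (n : ℕ) : KoszulRows (grade (Fin 2) Unit) (n + 1) :=
  fRows n (Y ()) (Z ()) (X 0 + X 1) (X 0 * X 1) (Y_mem ()) (Z_mem ()) (X_add_X_mem 0 1)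
    (X_mul_X_mem 0 1)

/-- The splitting diagram as a Koszul factorization in matrix form. -/
def trivalentOutEquiv (n : ℕ) : MF.GEquiv (trivalentOut n) ((outRows n).mf (-1)) :=
  (MF.GEquiv.ofEq _ _).trans (((twoRowEquiv ..).shift (-1)).trans ((outRows n).shiftEquiv 0 (-1)))

/-- The merging diagram as a Koszul factorization in matrix form. -/
def trivalentInEquiv (n : ℕ) : MF.GEquiv (trivalentIn n) ((inRows n).mf 0) :=
  (MF.GEquiv.ofEq _ _).trans (twoRowEquiv ..)

theorem outRows_potential (n : ℕ) :
    X 0 ^ (n + 1) + X 1 ^ (n + 1) - f n (Y ()) (Z ()) = (outRows n).potential := by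
  rw [← fRows_potential, f_add_mul]

/-- The elimination of the middle double line. -/
def mergeHom : BRing (Fin 4 ⊕ Empty) (Empty ⊕ Unit) →ₐ[ℚ] BRing (Fin 4) Empty :=
  MvPolynomial.aeval fun
    | .x (.inl i) => X i
    | .x (.inr i) => i.elim
    | .y _ => X 0 + X 1
    | .z _ => X 0 * X 1

theorem mergeHom_mem (j : ℤ) (r : BRing (Fin 4 ⊕ Empty) (Empty ⊕ Unit)) (hr : r ∈ grade _ _ j) :
    mergeHom r ∈ grade (Fin 4) Empty j := by
  refine map_mem_of_weights (grade (Fin 4) Empty) BVar.wt mergeHom ?_ j r hr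
  rintro ((i | i) | i | i)
  · rw [mergeHom, MvPolynomial.aeval_X]; exact X_mem i
  · exact i.elim
  · rw [mergeHom, MvPolynomial.aeval_X]; exact X_add_X_mem 0 1
  · rw [mergeHom, MvPolynomial.aeval_X]; exact X_mul_X_mem 0 1

theorem mergeHom_X (i : Fin 4) : mergeHom (X (Sum.inl i)) = X i := MvPolynomial.aeval_X _ _

theorem mergeHom_Y (i : Empty ⊕ Unit) : mergeHom (Y i) = X 0 + X 1 := MvPolynomial.aeval_X _ _

theorem mergeHom_Z (i : Empty ⊕ Unit) : mergeHom (Z i) = X 0 * X 1 := MvPolynomial.aeval_X _ _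

theorem mergeHom_relabel (r : BRing (Fin 4) Empty) :
    mergeHom (relabel Sum.inl Sum.inl r) = r := by
  have : mergeHom.comp (MvPolynomial.rename (BVar.map Sum.inl Sum.inl)) = AlgHom.id ℚ _ := by
    refine MvPolynomial.algHom_ext ?_
    rintro (i | i | i)
    · rw [AlgHom.comp_apply, MvPolynomial.rename_X]; exact mergeHom_X i
    · exact i.elim
    · exact i.elim
  exact DFunLike.congr_fun this r

theorem notMem_vars_add {σ : Type} {v : σ} {p q : MvPolynomial σ ℚ} (hp : v ∉ p.vars)
    (hq : v ∉ q.vars) : v ∉ (p + q).vars := by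
  classical
  exact fun h => (Finset.mem_union.1 (MvPolynomial.vars_add_subset p q h)).elim hp hq

theorem notMem_vars_mul {σ : Type} {v : σ} {p q : MvPolynomial σ ℚ} (hp : v ∉ p.vars)
    (hq : v ∉ q.vars) : v ∉ (p * q).vars := by
  classical
  exact fun h => (Finset.mem_union.1 (MvPolynomial.vars_mul p q h)).elim hp hq

/-- The rows are `-1` times `y - (x₀ + x₁)` and `z - x₀ x₁`, so they eliminate the two variables of
the inner double point. -/
theorem mergeHom_resolution {β₁ β₂ : ℤ} {b₁ b₂ : BRing (Fin 4 ⊕ Empty) (Empty ⊕ Unit)}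
    (hb₁ : b₁ ∈ grade _ _ β₁) (hb₂ : b₂ ∈ grade _ _ β₂)
    (e₁ : b₁ = X (Sum.inl 0) + X (Sum.inl 1) - Y (Sum.inr ()))
    (e₂ : b₂ = X (Sum.inl 0) * X (Sum.inl 1) - Z (Sum.inr ())) :
    IsKoszulResolution (mergeHom : _ →+* BRing (Fin 4) Empty) (grade _ _) (grade _ _)
      b₁ b₂ β₁ β₂ := by
  refine isKoszulResolution_of_elimination BVar.wt mergeHom
    (MvPolynomial.rename (BVar.map Sum.inl Sum.inl)) mergeHom_mem
    (fun j r hr => relabel_mem _ _ j r hr) mergeHom_relabel hb₁ hb₂ (BVar.y (Sum.inr ()))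
    (BVar.z (Sum.inr ())) (by simp) (u := -1) (s := X (Sum.inl 0) + X (Sum.inl 1))
    (t := X (Sum.inl 0) * X (Sum.inl 1)) (by norm_num) (e₁.trans ?_) (e₂.trans ?_) ?_ ?_ ?_
    ?_ ?_ ?_ ?_
  · simp [Y]
  · simp [Z]
  · exact (congrArg _ (mergeHom_Y _)).trans (by simp [X, BVar.map])
  · exact (congrArg _ (mergeHom_Z _)).trans (by simp [X, BVar.map])
  · rintro ((i | i) | (i | i) | (i | i)) h h'
    · exact (congrArg _ (mergeHom_X i)).trans (by simp [X, BVar.map])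
    · exact i.elim
    · exact i.elim
    · exact absurd rfl h
    · exact i.elim
    · exact absurd rfl h'
  · exact notMem_vars_add (by simp [X]) (by simp [X])
  · exact notMem_vars_add (by simp [X]) (by simp [X])
  · exact notMem_vars_mul (by simp [X]) (by simp [X])
  · exact notMem_vars_mul (by simp [X]) (by simp [X])

/-- The rows of the splitting vertex are eliminated. The merging vertex, with `y` and `z` replaced
by the elementary symmetric functions of the outgoing points, has the rows of the wide edge; the
shift by `-1` is inherited from the splitting vertex. -/
theorem nonempty_mergeSplit_iso (n : ℕ) :
    Nonempty ((mergeSplit n).toHMF ≅ (wideEdge n).toHMF) := by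
  let χ : BRing (Fin 2) Unit →+* BRing (Fin 4) Empty :=
    (mergeHom : BRing (Fin 4 ⊕ Empty) (Empty ⊕ Unit) →+* BRing (Fin 4) Empty).comp
      (relabel ![Sum.inl 2, Sum.inl 3] Sum.inr)
  have hχ : ∀ j, ∀ r ∈ grade (Fin 2) Unit j, χ r ∈ grade (Fin 4) Empty j := fun j r hr =>
    mergeHom_mem j _ (relabel_mem _ _ j r hr)
  have hX : ∀ i, χ (X i) = X (![2, 3] i) := fun i => by
    refine (congrArg mergeHom (relabel_X _ _ i)).trans ?_
    fin_cases i <;> exact mergeHom_X _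
  have hE : (inRows n).map χ hχ = fRows n (X 0 + X 1) (X 0 * X 1) (X 2 + X 3) (X 2 * X 3)
      (X_add_X_mem 0 1) (X_mul_X_mem 0 1) (X_add_X_mem 2 3) (X_mul_X_mem 2 3) :=
    fRows_map n _ _ _ _ χ hχ _ _ _ _
      ((congrArg mergeHom (relabel_Y _ _ _)).trans (mergeHom_Y _))
      ((congrArg mergeHom (relabel_Z _ _ _)).trans (mergeHom_Z _))
      (by rw [map_add, hX, hX]; rfl) (by rw [map_mul, hX, hX]; rfl)
  obtain ⟨ζ, hζ⟩ := (inRows n).exists_isExt_map χ hχ 0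
  obtain ⟨ζ', hζ'⟩ := hζ.of_gequiv (trivalentInEquiv n)
  have h2 : ((inRows n).map χ hχ).potential =
      RingHom.id _ (X 0 ^ (n + 1) + X 1 ^ (n + 1) - X 2 ^ (n + 1) - X 3 ^ (n + 1)) := by
    rw [hE, ← fRows_potential, f_add_mul, f_add_mul, RingHom.id_apply]; ring
  have hb₁ := relabel_mem (![Sum.inl 0, Sum.inl 1] : _ → Fin 4 ⊕ Empty)
    (Sum.inr : _ → Empty ⊕ Unit) _ _ (outRows n).hb₁
  have hb₂ := relabel_mem (![Sum.inl 0, Sum.inl 1] : _ → Fin 4 ⊕ Empty)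
    (Sum.inr : _ → Empty ⊕ Unit) _ _ (outRows n).hb₂
  have H := mergeHom_resolution hb₁ hb₂
    (by change relabel _ _ (X 0 + X 1 - Y ()) = _
        simp only [map_sub, map_add, relabel_X, relabel_Y]; rfl)
    (by change relabel _ _ (X 0 * X 1 - Z ()) = _
        simp only [map_sub, map_mul, relabel_X, relabel_Z]; rfl)
  obtain ⟨e⟩ := KoszulRows.nonempty_gequiv_of_eq hE 0
  have g : MF.GEquiv (MF.ofEq h2 ((((inRows n).map χ hχ).mf 0).shift (-1))) (wideEdge n) :=
    ((MF.GEquiv.ofEq h2 _).trans ((e.trans (twoRowEquiv ..).symm).shift (-1))).trans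
      (MF.GEquiv.ofEq _ _).symm
  have g' := ((MF.GEquiv.restrictId rfl (isFreeGraded_id rfl) _).trans g).nonempty_iso
  exact Nonempty.map2 (fun i i' => i.trans i') (nonempty_glue_iso (trivalentIn n)
    ![Sum.inl 2, Sum.inl 3] Sum.inr (trivalentOut n) ![Sum.inl 0, Sum.inl 1] Sum.inr _ _
    (isFreeGraded_id rfl) (mergeHom : _ →+* BRing (Fin 4) Empty) mergeHom_relabel (χ := χ)
    (fun _ => rfl) (outRows n) H (trivalentOutEquiv n) (outRows_potential n) hζ' h2) g'

end Diagrams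

section Bubble

/-! ## Extensions of rank two -/

/-- Restriction of scalars of a Koszul factorization along a free extension of rank two. -/
def KoszulRows.restrictEquiv {S T : Type} [CommRing S] [Algebra ℚ S] [CommRing T] [Algebra ℚ T]
    {ℬ : ℤ → Submodule ℚ S} {𝒞 : ℤ → Submodule ℚ T} [SetLike.GradedMonoid ℬ]
    [SetLike.GradedMonoid 𝒞] {c : ℤ} (D : KoszulRows 𝒞 c) (ψ : T →+* S)
    (hψ : letI := Module.compHom S ψ
      IsFreeGraded (R := T) (M := S) 𝒞 (fun j => (ℬ j).toAddSubgroup))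
    (hψ' : ∀ j, ∀ r ∈ 𝒞 j, ψ r ∈ ℬ j) (e : S ≃+ T × T) (he : ∀ t s, e (ψ t * s) = t • e s) (l : ℤ)
    (mem : ∀ j s, (e s).1 ∈ 𝒞 j ∧ (e s).2 ∈ 𝒞 (j - l) ↔ s ∈ ℬ j) (k : ℤ) {ω : T}
    (h : (D.map ψ hψ').potential = ψ ω) :
    MF.GEquiv (MF.restrict ψ hψ (MF.ofEq h ((D.map ψ hψ').mf k)))
      ((D.mf k).prod (D.mf (k + l))) where
  -- Each of the two copies of `S` splits into two copies of `T`; interchanging the middle factors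
  -- collects the first coordinates into one Koszul factorization and the second ones into another.
  e0 := { (e.prodCongr e).trans (AddEquiv.prodProdProdComm T T T T) with
          map_smul' := fun t (x : S × S) => by
            refine Prod.ext (Prod.ext ?_ ?_) (Prod.ext ?_ ?_)
            · exact (congrArg Prod.fst (he t x.1) :)
            · exact (congrArg Prod.fst (he t x.2) :)
            · exact (congrArg Prod.snd (he t x.1) :)
            · exact (congrArg Prod.snd (he t x.2) :) }
  e1 := { (e.prodCongr e).trans (AddEquiv.prodProdProdComm T T T T) with
          map_smul' := fun t (x : S × S) => by
            refine Prod.ext (Prod.ext ?_ ?_) (Prod.ext ?_ ?_)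
            · exact (congrArg Prod.fst (he t x.1) :)
            · exact (congrArg Prod.fst (he t x.2) :)
            · exact (congrArg Prod.snd (he t x.1) :)
            · exact (congrArg Prod.snd (he t x.2) :) }
  mem0 := by
    rintro j ⟨(x : S), (y : S)⟩
    have h1 := mem (j - k) x
    have h2 := mem (j - (k + D.κ₁ + D.κ₂)) y
    rw [show j - k - l = j - (k + l) by ring] at h1
    rw [show j - (k + D.κ₁ + D.κ₂) - l = j - (k + l + D.κ₁ + D.κ₂) by ring] at h2
    exact and_and_and_comm.trans (and_congr h1 h2)
  mem1 := by
    rintro j ⟨(x : S), (y : S)⟩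
    have h1 := mem (j - (k + D.κ₁)) x
    have h2 := mem (j - (k + D.κ₂)) y
    rw [show j - (k + D.κ₁) - l = j - (k + l + D.κ₁) by ring] at h1
    rw [show j - (k + D.κ₂) - l = j - (k + l + D.κ₂) by ring] at h2
    exact and_and_and_comm.trans (and_congr h1 h2)
  comm0 := by
    rintro ⟨(x : S), (y : S)⟩
    have h1 : e (ψ D.a₁ * x - ψ D.b₂ * y) = D.a₁ • e x - D.b₂ • e y := by
      rw [map_sub, he, he]
    have h2 : e (ψ D.a₂ * x + ψ D.b₁ * y) = D.a₂ • e x + D.b₁ • e y := by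
      rw [map_add, he, he]
    refine Prod.ext (Prod.ext ?_ ?_) (Prod.ext ?_ ?_)
    · exact (congrArg Prod.fst h1).symm
    · exact (congrArg Prod.fst h2).symm
    · exact (congrArg Prod.snd h1).symm
    · exact (congrArg Prod.snd h2).symm
  comm1 := by
    rintro ⟨(x : S), (y : S)⟩
    have h1 : e (ψ D.b₁ * x + ψ D.b₂ * y) = D.b₁ • e x + D.b₂ • e y := by
      rw [map_add, he, he]
    have h2 : e (ψ D.a₁ * y - ψ D.a₂ * x) = D.a₁ • e y - D.a₂ • e x := by
      rw [map_sub, he, he]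
    refine Prod.ext (Prod.ext ?_ ?_) (Prod.ext ?_ ?_)
    · exact (congrArg Prod.fst h1).symm
    · exact (congrArg Prod.fst h2).symm
    · exact (congrArg Prod.snd h1).symm
    · exact (congrArg Prod.snd h2).symm

theorem isFreeGraded_of_pair {S T : Type} [CommRing S] [Algebra ℚ S] [CommRing T] [Algebra ℚ T]
    {ℬ : ℤ → Submodule ℚ S} {𝒞 : ℤ → Submodule ℚ T} (ψ : T →+* S) (e : S ≃+ T × T)
    (he : ∀ t s, e (ψ t * s) = t • e s) (l : ℤ)
    (mem : ∀ j s, (e s).1 ∈ 𝒞 j ∧ (e s).2 ∈ 𝒞 (j - l) ↔ s ∈ ℬ j) :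
    letI := Module.compHom S ψ
    IsFreeGraded (R := T) (M := S) 𝒞 (fun j => (ℬ j).toAddSubgroup) := by
  let _ := Module.compHom S ψ
  let e' : S ≃ₗ[T] T × T := { e with map_smul' := he }
  refine ⟨Unit ⊕ Unit, (KoszulRows.pairBasis T).map e'.symm, Sum.elim (fun _ => 0) (fun _ => l),
    fun j x => ?_⟩
  have h₁ : ∀ i, ((KoszulRows.pairBasis T).map e'.symm).repr x (Sum.inl i) = (e x).1 :=
    fun i => KoszulRows.pairBasis_repr_inl (e x) i
  have h₂ : ∀ i, ((KoszulRows.pairBasis T).map e'.symm).repr x (Sum.inr i) = (e x).2 :=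
    fun i => KoszulRows.pairBasis_repr_inr (e x) i
  rw [Sum.forall]
  simp only [h₁, h₂, Sum.elim_inl, Sum.elim_inr, sub_zero, forall_const]
  exact (mem j x).symm

/-! ## The ring of two points as an extension of the ring of symmetric functions -/

/-- The quadratic extension `u ^ 2 = y₁ u - z₁`. -/
abbrev QuadExt : Type := QuadraticAlgebra (BRing Empty (Fin 2)) (-Z 1) (Y 1)

/-- The homomorphism which expresses `y₁`, `z₁` as the elementary symmetric functions. -/
def symmHom : BRing Empty (Fin 2) →ₐ[ℚ] BRing (Fin 2) Unit :=
  MvPolynomial.aeval fun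
    | .x i => i.elim
    | .y i => ![Y (), X 0 + X 1] i
    | .z i => ![Z (), X 0 * X 1] i

theorem symmHom_Y (i : Fin 2) : symmHom (Y i) = ![Y (), X 0 + X 1] i := MvPolynomial.aeval_X _ _

theorem symmHom_Z (i : Fin 2) : symmHom (Z i) = ![Z (), X 0 * X 1] i := MvPolynomial.aeval_X _ _

theorem symmHom_mem (j : ℤ) (r : BRing Empty (Fin 2)) (hr : r ∈ grade _ _ j) :
    symmHom r ∈ grade (Fin 2) Unit j := by
  refine map_mem_of_weights (grade (Fin 2) Unit) BVar.wt symmHom ?_ j r hr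
  rintro (i | i | i)
  · exact i.elim
  · refine (congrArg (· ∈ _) (symmHom_Y i)).mpr ?_
    fin_cases i
    · exact Y_mem ()
    · exact X_add_X_mem 0 1
  · refine (congrArg (· ∈ _) (symmHom_Z i)).mpr ?_
    fin_cases i
    · exact Z_mem ()
    · exact X_mul_X_mem 0 1

/-- The inclusion of the coefficients. -/
def coeffHom : BRing Empty (Fin 2) →ₐ[ℚ] QuadExt where
  toFun r := ⟨r, 0⟩
  map_one' := rfl
  map_zero' := rfl
  map_add' r s := by ext <;> simp
  map_mul' r s := by ext <;> simp
  commutes' r := rfl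

/-- The two points are the roots of `u ^ 2 = y₁ u - z₁`. -/
def toQuadExt : BRing (Fin 2) Unit →ₐ[ℚ] QuadExt :=
  MvPolynomial.aeval fun
    | .x i => ![⟨0, 1⟩, ⟨Y 1, -1⟩] i
    | .y _ => ⟨Y 0, 0⟩
    | .z _ => ⟨Z 0, 0⟩

theorem toQuadExt_X (i : Fin 2) : toQuadExt (X i) = ![⟨0, 1⟩, ⟨Y 1, -1⟩] i :=
  MvPolynomial.aeval_X _ _

theorem toQuadExt_Y (i : Unit) : toQuadExt (Y i) = ⟨Y 0, 0⟩ := MvPolynomial.aeval_X _ _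

theorem toQuadExt_Z (i : Unit) : toQuadExt (Z i) = ⟨Z 0, 0⟩ := MvPolynomial.aeval_X _ _

/-- The inverse of `toQuadExt`. -/
def ofQuadExt : QuadExt →ₐ[ℚ] BRing (Fin 2) Unit where
  toFun r := symmHom r.re + X 0 * symmHom r.im
  map_one' := by simp [QuadraticAlgebra.re_one, QuadraticAlgebra.im_one]
  map_zero' := by simp
  map_add' r s := by
    rw [QuadraticAlgebra.re_add, QuadraticAlgebra.im_add, map_add, map_add]; ring
  map_mul' r s := by
    -- Multiplicativity amounts to `x₀² = (x₀ + x₁) x₀ - x₀ x₁`, the quadratic relation of the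
    -- generator.
    rw [QuadraticAlgebra.re_mul, QuadraticAlgebra.im_mul]
    simp only [map_add, map_mul, map_neg, symmHom_Y, symmHom_Z, Matrix.cons_val_one,
      Matrix.cons_val_fin_one]
    ring
  commutes' r := by
    change symmHom (algebraMap ℚ _ r) + X 0 * symmHom 0 = _
    rw [map_zero, mul_zero, add_zero]
    exact symmHom.commutes r

theorem ofQuadExt_apply (r : QuadExt) : ofQuadExt r = symmHom r.re + X 0 * symmHom r.im := rfl

theorem ofQuadExt_toQuadExt (r : BRing (Fin 2) Unit) : ofQuadExt (toQuadExt r) = r := by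
  have : ofQuadExt.comp toQuadExt = AlgHom.id ℚ _ := by
    refine MvPolynomial.algHom_ext ?_
    rintro (i | i | i)
    · refine (congrArg ofQuadExt (toQuadExt_X i)).trans ?_
      fin_cases i
      · change symmHom 0 + X 0 * symmHom 1 = X 0
        simp
      · change symmHom (Y 1) + X 0 * symmHom (-1) = X 1
        rw [symmHom_Y, map_neg, map_one]
        simp
    · refine (congrArg ofQuadExt (toQuadExt_Y i)).trans ?_
      change symmHom (Y 0) + X 0 * symmHom 0 = Y ()
      rw [symmHom_Y]; simp
    · refine (congrArg ofQuadExt (toQuadExt_Z i)).trans ?_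
      change symmHom (Z 0) + X 0 * symmHom 0 = Z ()
      rw [symmHom_Z]; simp
  exact DFunLike.congr_fun this r

theorem toQuadExt_symmHom (r : BRing Empty (Fin 2)) : toQuadExt (symmHom r) = ⟨r, 0⟩ := by
  have : toQuadExt.comp symmHom = coeffHom := by
    refine MvPolynomial.algHom_ext ?_
    rintro (i | i | i)
    · exact i.elim
    · refine (congrArg toQuadExt (symmHom_Y i)).trans ?_
      fin_cases i
      · exact toQuadExt_Y ()
      · change toQuadExt (X 0 + X 1) = ⟨Y 1, 0⟩
        rw [map_add, toQuadExt_X, toQuadExt_X]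
        ext <;> simp
    · refine (congrArg toQuadExt (symmHom_Z i)).trans ?_
      fin_cases i
      · exact toQuadExt_Z ()
      · change toQuadExt (X 0 * X 1) = ⟨Z 1, 0⟩
        rw [map_mul, toQuadExt_X, toQuadExt_X]
        ext <;> simp
  exact DFunLike.congr_fun this r

theorem toQuadExt_ofQuadExt (r : QuadExt) : toQuadExt (ofQuadExt r) = r := by
  rw [ofQuadExt_apply, map_add, map_mul, toQuadExt_symmHom, toQuadExt_symmHom, toQuadExt_X]
  ext <;> simp

/-- The ring of two points and a double point is free of rank two. -/
def quadExtEquiv : BRing (Fin 2) Unit ≃+ BRing Empty (Fin 2) × BRing Empty (Fin 2) where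
  toFun r := ((toQuadExt r).re, (toQuadExt r).im)
  invFun p := ofQuadExt ⟨p.1, p.2⟩
  left_inv r := ofQuadExt_toQuadExt r
  right_inv p := Prod.ext (congrArg QuadraticAlgebra.re (toQuadExt_ofQuadExt ⟨p.1, p.2⟩))
    (congrArg QuadraticAlgebra.im (toQuadExt_ofQuadExt ⟨p.1, p.2⟩))
  map_add' r s := by rw [map_add]; rfl

theorem quadExtEquiv_smul (t : BRing Empty (Fin 2)) (r : BRing (Fin 2) Unit) :
    quadExtEquiv (symmHom t * r) = t • quadExtEquiv r := by
  change ((toQuadExt (symmHom t * r)).re, (toQuadExt (symmHom t * r)).im) =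
    (t * (toQuadExt r).re, t * (toQuadExt r).im)
  rw [map_mul, toQuadExt_symmHom]
  simp

/-- The grading of the quadratic extension, the generator having degree `2`. -/
def quadGrade (j : ℤ) : Submodule ℚ QuadExt where
  carrier := {r | r.re ∈ grade Empty (Fin 2) j ∧ r.im ∈ grade Empty (Fin 2) (j - 2)}
  zero_mem' := ⟨zero_mem _, zero_mem _⟩
  add_mem' hr hs := ⟨add_mem hr.1 hs.1, add_mem hr.2 hs.2⟩
  smul_mem' q _ hr := ⟨Submodule.smul_mem _ q hr.1, Submodule.smul_mem _ q hr.2⟩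

/-- The relation `u² = y₁ u - z₁` is homogeneous of degree `4`. This makes the general criterion
`map_mem_of_weights` available for `toQuadExt`. -/
instance : SetLike.GradedMonoid quadGrade where
  one_mem := ⟨SetLike.one_mem_graded (grade Empty (Fin 2)), zero_mem _⟩
  mul_mem i j r s hr hs := by
    refine ⟨add_mem (mul_mem_of_eq hr.1 hs.1 rfl) (mul_mem_of_eq
      (mul_mem_of_eq (neg_mem (Z_mem 1)) hr.2 rfl) hs.2 (by ring)), add_mem (add_mem
      (mul_mem_of_eq hr.1 hs.2 (by ring)) (mul_mem_of_eq hr.2 hs.1 (by ring))) (mul_mem_of_eq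
      (mul_mem_of_eq (Y_mem 1) hr.2 rfl) hs.2 (by ring))⟩

theorem quadExtEquiv_mem (j : ℤ) (r : BRing (Fin 2) Unit) :
    (quadExtEquiv r).1 ∈ grade Empty (Fin 2) j ∧ (quadExtEquiv r).2 ∈ grade Empty (Fin 2) (j - 2) ↔
      r ∈ grade (Fin 2) Unit j := by
  constructor
  · intro h
    rw [← quadExtEquiv.symm_apply_apply r]
    exact add_mem (symmHom_mem _ _ h.1)
      (mul_mem_of_eq (X_mem 0) (symmHom_mem _ _ h.2) (by ring))
  · refine map_mem_of_weights quadGrade BVar.wt toQuadExt ?_ j r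
    have one : (1 : BRing Empty (Fin 2)) ∈ grade Empty (Fin 2) (2 - 2) :=
      SetLike.one_mem_graded (grade Empty (Fin 2))
    rintro (i | i | i)
    · refine (congrArg (· ∈ _) (toQuadExt_X i)).mpr ?_
      fin_cases i
      · exact ⟨zero_mem _, one⟩
      · exact ⟨Y_mem 1, neg_mem one⟩
    · exact (congrArg (· ∈ _) (toQuadExt_Y i)).mpr ⟨Y_mem 0, zero_mem _⟩
    · exact (congrArg (· ∈ _) (toQuadExt_Z i)).mpr ⟨Z_mem 0, zero_mem _⟩

/-! ## The bubble -/

/-- The elimination of the double line which enters the bubble. -/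
def bubbleHom : BRing (Empty ⊕ Fin 2) (Fin 2 ⊕ Empty) →ₐ[ℚ] BRing (Fin 2) Unit :=
  MvPolynomial.aeval fun
    | .x (.inl i) => i.elim
    | .x (.inr i) => X i
    | .y (.inl i) => ![Y (), X 0 + X 1] i
    | .y (.inr i) => i.elim
    | .z (.inl i) => ![Z (), X 0 * X 1] i
    | .z (.inr i) => i.elim

theorem bubbleHom_X (i : Fin 2) : bubbleHom (X (Sum.inr i)) = X i := MvPolynomial.aeval_X _ _

theorem bubbleHom_Y (i : Fin 2) : bubbleHom (Y (Sum.inl i)) = ![Y (), X 0 + X 1] i :=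
  MvPolynomial.aeval_X _ _

theorem bubbleHom_Z (i : Fin 2) : bubbleHom (Z (Sum.inl i)) = ![Z (), X 0 * X 1] i :=
  MvPolynomial.aeval_X _ _

theorem bubbleHom_mem (j : ℤ) (r : BRing (Empty ⊕ Fin 2) (Fin 2 ⊕ Empty)) (hr : r ∈ grade _ _ j) :
    bubbleHom r ∈ grade (Fin 2) Unit j := by
  refine map_mem_of_weights (grade (Fin 2) Unit) BVar.wt bubbleHom ?_ j r hr
  rintro ((i | i) | (i | i) | (i | i))
  · exact i.elim
  · exact (congrArg (· ∈ _) (bubbleHom_X i)).mpr (X_mem i)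
  · refine (congrArg (· ∈ _) (bubbleHom_Y i)).mpr ?_
    fin_cases i
    · exact Y_mem ()
    · exact X_add_X_mem 0 1
  · exact i.elim
  · refine (congrArg (· ∈ _) (bubbleHom_Z i)).mpr ?_
    fin_cases i
    · exact Z_mem ()
    · exact X_mul_X_mem 0 1
  · exact i.elim

theorem bubbleHom_relabel_symm (r : BRing Empty (Fin 2)) :
    bubbleHom (relabel Sum.inl Sum.inl r) = symmHom r := by
  have : bubbleHom.comp (MvPolynomial.rename (BVar.map Sum.inl Sum.inl)) = symmHom := by
    refine MvPolynomial.algHom_ext ?_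
    rintro (i | i | i)
    · exact i.elim
    · rw [AlgHom.comp_apply, MvPolynomial.rename_X]
      exact (bubbleHom_Y i).trans (symmHom_Y i).symm
    · rw [AlgHom.comp_apply, MvPolynomial.rename_X]
      exact (bubbleHom_Z i).trans (symmHom_Z i).symm
  exact DFunLike.congr_fun this r

theorem bubbleHom_relabel (r : BRing (Fin 2) Unit) :
    bubbleHom (relabel Sum.inr (fun _ => Sum.inl 0) r) = r := by
  have : bubbleHom.comp (MvPolynomial.rename (BVar.map Sum.inr (fun _ => Sum.inl 0))) =
      AlgHom.id ℚ _ := by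
    refine MvPolynomial.algHom_ext ?_
    rintro (i | i | i)
    · rw [AlgHom.comp_apply, MvPolynomial.rename_X]; exact bubbleHom_X i
    · rw [AlgHom.comp_apply, MvPolynomial.rename_X]; exact bubbleHom_Y 0
    · rw [AlgHom.comp_apply, MvPolynomial.rename_X]; exact bubbleHom_Z 0
  exact DFunLike.congr_fun this r

/-- Here the eliminated variables are those of a boundary point, and the inner points survive. The
quotient is therefore a proper extension of the boundary ring. -/
theorem bubbleHom_resolution {β₁ β₂ : ℤ} {b₁ b₂ : BRing (Empty ⊕ Fin 2) (Fin 2 ⊕ Empty)}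
    (hb₁ : b₁ ∈ grade _ _ β₁) (hb₂ : b₂ ∈ grade _ _ β₂)
    (e₁ : b₁ = X (Sum.inr 0) + X (Sum.inr 1) - Y (Sum.inl 1))
    (e₂ : b₂ = X (Sum.inr 0) * X (Sum.inr 1) - Z (Sum.inl 1)) :
    IsKoszulResolution (bubbleHom : _ →+* BRing (Fin 2) Unit) (grade _ _) (grade _ _)
      b₁ b₂ β₁ β₂ := by
  refine isKoszulResolution_of_elimination BVar.wt bubbleHom
    (MvPolynomial.rename (BVar.map Sum.inr (fun _ => Sum.inl 0))) bubbleHom_mem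
    (fun j r hr => relabel_mem _ _ j r hr) bubbleHom_relabel hb₁ hb₂ (BVar.y (Sum.inl 1))
    (BVar.z (Sum.inl 1)) (by simp) (u := -1) (s := X (Sum.inr 0) + X (Sum.inr 1))
    (t := X (Sum.inr 0) * X (Sum.inr 1)) (by norm_num) (e₁.trans ?_) (e₂.trans ?_) ?_ ?_ ?_
    ?_ ?_ ?_ ?_
  · simp [Y]
  · simp [Z]
  · exact (congrArg _ (bubbleHom_Y 1)).trans (by simp [X, BVar.map])
  · exact (congrArg _ (bubbleHom_Z 1)).trans (by simp [X, BVar.map])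
  · rintro ((i | i) | (i | i) | (i | i)) h h'
    · exact i.elim
    · exact (congrArg _ (bubbleHom_X i)).trans (by simp [X, BVar.map])
    · fin_cases i
      · exact (congrArg _ (bubbleHom_Y 0)).trans (by simp [Y, BVar.map])
      · exact absurd rfl h
    · exact i.elim
    · fin_cases i
      · exact (congrArg _ (bubbleHom_Z 0)).trans (by simp [Z, BVar.map])
      · exact absurd rfl h'
    · exact i.elim
  · exact notMem_vars_add (by simp [X]) (by simp [X])
  · exact notMem_vars_add (by simp [X]) (by simp [X])
  · exact notMem_vars_mul (by simp [X]) (by simp [X])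
  · exact notMem_vars_mul (by simp [X]) (by simp [X])

/-- After elimination the merging vertex remains, seen over the boundary ring through `symmHom`. Its
rows are the images of the rows of the double line (`hE`), so the free basis `1`, `x₀` splits it
into two double lines. -/
theorem nonempty_bubble_iso (n : ℕ) :
    Nonempty ((bubble n).toHMF ≅
      (((doubleLine n).shift (-1)).prod ((doubleLine n).shift 1)).toHMF) := by
  let E := fRows (S := Empty) (D := Fin 2) n (Y 0) (Z 0) (Y 1) (Z 1) (Y_mem 0) (Z_mem 0)
    (Y_mem 1) (Z_mem 1)
  let ψ : BRing Empty (Fin 2) →+* BRing (Fin 2) Unit := symmHom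
  have hψ : ∀ j, ∀ r ∈ grade Empty (Fin 2) j, ψ r ∈ grade (Fin 2) Unit j := symmHom_mem
  have hE : E.map ψ hψ = inRows n :=
    fRows_map n _ _ _ _ _ _ _ _ _ _ (symmHom_Y 0) (symmHom_Z 0) (symmHom_Y 1) (symmHom_Z 1)
  have free := isFreeGraded_of_pair ψ
    quadExtEquiv quadExtEquiv_smul 2 quadExtEquiv_mem
  obtain ⟨ζ, hζ⟩ := MF.exists_isExt_id (trivalentIn n) (φ := RingHom.id _) rfl
  have hω : (E.map ψ hψ).potential =
      ψ
        (f n (Y 0) (Z 0) - f n (Y 1) (Z 1)) := by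
    exact (E.map_potential ψ hψ).trans (congrArg ψ (fRows_potential ..).symm)
  have h2 : f n (Y ()) (Z ()) - X 0 ^ (n + 1) - X 1 ^ (n + 1) =
      ψ
        (f n (Y 0) (Z 0) - f n (Y 1) (Z 1)) := by
    rw [← hω, hE, ← fRows_potential, f_add_mul]; ring
  have hb₁ := relabel_mem (Sum.inr : _ → Empty ⊕ Fin 2)
    (fun _ => Sum.inl 1 : _ → Fin 2 ⊕ Empty) _ _ (outRows n).hb₁
  have hb₂ := relabel_mem (Sum.inr : _ → Empty ⊕ Fin 2)
    (fun _ => Sum.inl 1 : _ → Fin 2 ⊕ Empty) _ _ (outRows n).hb₂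
  have H := bubbleHom_resolution hb₁ hb₂
    (by change relabel _ _ (X 0 + X 1 - Y ()) = _
        simp only [map_sub, map_add, relabel_X, relabel_Y])
    (by change relabel _ _ (X 0 * X 1 - Z ()) = _
        simp only [map_sub, map_mul, relabel_X, relabel_Z])
  obtain ⟨e⟩ := KoszulRows.nonempty_gequiv_of_eq hE (-1)
  have e' : MF.GEquiv ((trivalentIn n).shift (-1)) ((inRows n).mf (-1)) :=
    ((trivalentInEquiv n).shift (-1)).trans ((inRows n).shiftEquiv 0 (-1))
  have g : MF.GEquiv (MF.ofEq h2 ((trivalentIn n).shift (-1)))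
      (MF.ofEq hω ((E.map ψ hψ).mf (-1))) :=
    (MF.GEquiv.ofEq _ _).trans ((e'.trans e.symm).trans (MF.GEquiv.ofEq _ _).symm)
  have d : ∀ k : ℤ, MF.GEquiv (E.mf k) ((doubleLine n).shift k) := fun k => by
    have := ((twoRowEquiv n (Y 0) (Z 0) (Y 1) (Z 1) (Y_mem (S := Empty) (D := Fin 2) 0) (Z_mem 0)
      (Y_mem 1) (Z_mem 1)).shift k).trans (E.shiftEquiv 0 k)
    rw [zero_add] at this
    exact this.symm
  -- The basis elements of degrees `0` and `2` give the shifts `-1` and `-1 + 2`; the latter is `1`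
  -- by computation.
  have g' := ((g.restrict _ free).trans ((E.restrictEquiv _ free hψ quadExtEquiv
    quadExtEquiv_smul 2 quadExtEquiv_mem (-1) hω).trans ((d (-1)).prod (d (-1 + 2))))).nonempty_iso
  exact Nonempty.map2 (fun i i' => i.trans i') (nonempty_glue_iso (trivalentIn n)
    Sum.inr (fun _ => Sum.inl 0) (trivalentOut n) Sum.inr (fun _ => Sum.inl 1) _ _
    free (bubbleHom : BRing (Empty ⊕ Fin 2) (Fin 2 ⊕ Empty) →+* BRing (Fin 2) Unit)
    bubbleHom_relabel_symm (χ := RingHom.id _) bubbleHom_relabel (outRows n) H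
    (trivalentOutEquiv n) (outRows_potential n) hζ h2) g'

end Bubble

section Coprime

/-! ## The partial derivatives of the potential -/

variable {A : Type} [CommRing A]

/-- The complete homogeneous symmetric polynomial of degree `k - 1`, in terms of the elementary
symmetric polynomials `s` and `t`. -/
def completeSum (s t : A) : ℕ → A
  | 0 => 0
  | 1 => 1
  | k + 2 => s * completeSum s t (k + 1) - t * completeSum s t k

/-- Eliminates power sums from the recursions of the difference quotients, so that only complete
symmetric polynomials remain. -/
theorem powerSum_succ_eq (s t : A) : ∀ k,
    powerSum s t (k + 1) = s * completeSum s t (k + 1) - 2 * t * completeSum s t k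
  | 0 => by simp [powerSum, completeSum]
  | 1 => by simp [powerSum, completeSum]; ring
  | k + 2 => by
    have h : completeSum s t (k + 2) = s * completeSum s t (k + 1) - t * completeSum s t k := rfl
    have h' : completeSum s t (k + 3) = s * completeSum s t (k + 2) - t * completeSum s t (k + 1) :=
      rfl
    rw [powerSum, powerSum_succ_eq s t (k + 1), powerSum_succ_eq s t k, h', h]
    ring

/-- On the diagonal the difference quotient is the partial derivative in `s` of the `k`-th power
sum. -/
theorem quotFst_self (s t : A) : ∀ k, quotFst s s t k = k * completeSum s t k
  | 0 => by simp [quotFst]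
  | 1 => by simp [quotFst, completeSum]
  | k + 2 => by
    rw [quotFst, powerSum_succ_eq, quotFst_self s t (k + 1), quotFst_self s t k, completeSum]
    push_cast; ring

theorem quotSnd_self (s t : A) : ∀ k,
    quotSnd s t t (k + 1) = -((k + 1 : ℕ) * completeSum s t k)
  | 0 => by simp [quotSnd, completeSum]
  | 1 => by simp [quotSnd, powerSum, completeSum]
  | k + 2 => by
    rw [quotSnd, powerSum_succ_eq, quotSnd_self s t (k + 1), quotSnd_self s t k, completeSum]
    push_cast; ring

/-- The chain rule, with the diagonal difference quotients as partial derivatives. It links the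
entries of the double loop to the Jacobian ideal. -/
theorem derivation_powerSum [Algebra ℚ A] (d : Derivation ℚ A A) (s t : A) : ∀ k,
    d (powerSum s t k) = quotFst s s t k * d s + quotSnd s t t k * d t
  | 0 => by
    rw [powerSum, quotFst, quotSnd, zero_mul, zero_mul, zero_add]
    exact d.map_natCast 2
  | 1 => by simp [powerSum, quotFst, quotSnd]
  | k + 2 => by
    rw [powerSum, quotFst, quotSnd, map_sub, Derivation.leibniz, Derivation.leibniz,
      derivation_powerSum d s t (k + 1), derivation_powerSum d s t k]
    simp only [smul_eq_mul]
    ring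

/-- Write `c` for `completeSum`. Euclid's algorithm along the recursion: a common divisor of `c
(k+2)` and `c (k+1)` divides `t * c k`, and `c (k+1)` is prime to both factors. Primeness to `t`
propagates because `c (k+2) ≡ s * c (k+1)` modulo `t`, so both claims are carried together. -/
theorem isRelPrime_completeSum [DecompositionMonoid A] {s t : A} (h : IsRelPrime t s) : ∀ k,
    IsRelPrime t (completeSum s t (k + 1)) ∧
      IsRelPrime (completeSum s t (k + 1)) (completeSum s t k)
  | 0 => ⟨isRelPrime_one_right, isRelPrime_one_left⟩
  | k + 1 => by
    obtain ⟨h1, h2⟩ := isRelPrime_completeSum h k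
    rw [completeSum]
    constructor
    · rw [sub_eq_add_neg, ← mul_neg]
      exact (h.mul_right h1).add_mul_left_right _
    · rw [sub_eq_neg_add]
      exact (IsRelPrime.neg_left (h1.mul_left h2.symm)).add_mul_right_left _

/-- Both quotients are consecutive complete symmetric polynomials up to the factor `n + 1`, which is
invertible over `ℚ`, and a sign. -/
theorem isRelPrime_fQuot [Algebra ℚ A] [DecompositionMonoid A] {s t : A} (h : IsRelPrime t s)
    (n : ℕ) : IsRelPrime (fQuotFst n s s t) (fQuotSnd n s t t) := by
  have hu : IsUnit ((n + 1 : ℕ) : A) := by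
    have := (isUnit_iff_ne_zero.2 (Nat.cast_ne_zero (R := ℚ).2 n.succ_ne_zero)).map
      (algebraMap ℚ A)
    rwa [map_natCast] at this
  rw [fQuotFst, fQuotSnd, quotFst_self, quotSnd_self]
  exact IsRelPrime.neg_right (((isRelPrime_mul_unit_left hu).2
    (isRelPrime_completeSum h n).2))

theorem isRelPrime_X_X {σ : Type} {i j : σ} (h : i ≠ j) :
    IsRelPrime (MvPolynomial.X i : MvPolynomial σ ℚ) (MvPolynomial.X j) := by
  rw [MvPolynomial.X_prime.irreducible.isRelPrime_iff_not_dvd, MvPolynomial.X_dvd_X]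
  exact h

end Coprime

section DoubleLoop

/-! ## The double loop -/

/-- The isomorphism of the ring of an inner double point with the ring of a double point. -/
def innerHom : BRing (Empty ⊕ Empty) (Empty ⊕ Unit) →+* BRing Empty Unit :=
  relabel (Sum.elim id id) (Sum.elim Empty.elim id)

/-- The inverse of `innerHom`. -/
def toInner : BRing Empty Unit →+* BRing (Empty ⊕ Empty) (Empty ⊕ Unit) :=
  relabel Sum.inl Sum.inr

theorem innerHom_toInner (r : BRing Empty Unit) : innerHom (toInner r) = r := by
  rw [innerHom, toInner, relabel_relabel]
  exact DFunLike.congr_fun (relabel_id' _ _ (fun _ => rfl) fun _ => rfl) r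

theorem toInner_innerHom (r : BRing (Empty ⊕ Empty) (Empty ⊕ Unit)) :
    toInner (innerHom r) = r := by
  rw [innerHom, toInner, relabel_relabel]
  exact DFunLike.congr_fun (relabel_id' _ _ (by rintro (i | i) <;> exact i.elim)
    (by rintro (i | i); exacts [i.elim, rfl])) r

/-- The partial derivative of the potential by `y`. -/
abbrev derivY (n : ℕ) : BRing Empty Unit := fQuotFst n (Y ()) (Y ()) (Z ())

/-- The partial derivative of the potential by `z`. -/
abbrev derivZ (n : ℕ) : BRing Empty Unit := fQuotSnd n (Y ()) (Z ()) (Z ())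

theorem jacobianIdeal_f (n : ℕ) :
    jacobianIdeal (f n (Y ()) (Z ()) : BRing Empty Unit) = Ideal.span {derivY n, derivZ n} := by
  have hy : MvPolynomial.pderiv (BVar.y ()) (f n (Y ()) (Z ()) : BRing Empty Unit) = derivY n := by
    rw [f, derivation_powerSum]
    simp [Y, Z, fQuotFst, MvPolynomial.pderiv_X_of_ne]
  have hz : MvPolynomial.pderiv (BVar.z ()) (f n (Y ()) (Z ()) : BRing Empty Unit) = derivZ n := by
    rw [f, derivation_powerSum]
    simp [Y, Z, fQuotSnd, MvPolynomial.pderiv_X_of_ne]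
  rw [jacobianIdeal]
  congr 1
  ext p
  constructor
  · rintro ⟨i | i | i, rfl⟩
    · exact i.elim
    · exact Or.inl hy
    · exact Or.inr hz
  · rintro (rfl | rfl)
    · exact ⟨_, hy⟩
    · exact ⟨_, hz⟩

end DoubleLoop

section ZeroRows

set_option linter.unusedSectionVars false

variable {R S T : Type} [CommRing R] [Algebra ℚ R] [CommRing S] [Algebra ℚ S] [CommRing T]
  [Algebra ℚ T] {𝒜 : ℤ → Submodule ℚ R} {ℬ : ℤ → Submodule ℚ S} {𝒞 : ℤ → Submodule ℚ T}
  [SetLike.GradedMonoid 𝒜] [SetLike.GradedMonoid ℬ] [SetLike.GradedMonoid 𝒞] {c : ℤ}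

/-! ## Koszul factorizations with potential zero -/

/-- A graded module as a matrix factorization with potential zero and vanishing odd part. -/
def MF.ofEven (c : ℤ) (N : GrMod 𝒞) : MF 𝒞 c 0 where
  X0 := N
  X1 := GrMod.zero _
  d0 := 0
  d1 := 0
  d0_mem _ _ _ := zero_mem _
  d1_mem _ _ _ := zero_mem _
  d1_d0 _ := by simp
  d0_d1 _ := by simp

theorem isHomogeneousBasis_singleton : IsHomogeneousBasis 𝒜 (M := R) (GrMod.self 𝒜).gr
    (Module.Basis.singleton Unit R) fun _ => 0 := by
  intro j x
  change x ∈ 𝒜 j ↔ _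
  simp

/-- The rank-one case of `nonempty_contraction`, with the scalar action written as multiplication in
the ring. -/
theorem IsKoszulResolution.exists_ring_contraction {ρ : R →+* S} {b₁ b₂ : R} {β₁ β₂ : ℤ}
    (H : IsKoszulResolution ρ 𝒜 ℬ b₁ b₂ β₁ β₂) (hb₁ : b₁ ∈ 𝒜 β₁) (hb₂ : b₂ ∈ 𝒜 β₂) (φ : T →+* R)
    (hφ : letI := Module.compHom R φ
      IsFreeGraded (R := T) (M := R) 𝒞 (fun j => (𝒜 j).toAddSubgroup))
    (ψ : T →+* S) (hψ : letI := Module.compHom S ψ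
      IsFreeGraded (R := T) (M := S) 𝒞 (fun j => (ℬ j).toAddSubgroup))
    (hρ : ∀ r, ρ (φ r) = ψ r) :
    ∃ (h₁ h₂ : R →+ R) (g : R × R →+ R), (∀ r x, h₁ (φ r * x) = φ r * h₁ x) ∧
      (∀ r x, h₂ (φ r * x) = φ r * h₂ x) ∧ (∀ r (x : R × R), g (φ r • x) = φ r * g x) ∧
      (∀ (j : ℤ), ∀ x ∈ 𝒜 j, h₁ x ∈ 𝒜 (j - β₁)) ∧ (∀ (j : ℤ), ∀ x ∈ 𝒜 j, h₂ x ∈ 𝒜 (j - β₂)) ∧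
      (∀ (j : ℤ), ∀ p ∈ 𝒜 (j - β₁), ∀ q ∈ 𝒜 (j - β₂), g (p, q) ∈ 𝒜 (j - (β₁ + β₂))) ∧
      (∀ x, ρ x = 0 → b₁ * h₁ x + b₂ * h₂ x = x) ∧
      (∀ p q, h₁ (b₁ * p + b₂ * q) - b₂ * g (p, q) = p) ∧
      (∀ p q, h₂ (b₁ * p + b₂ * q) + b₁ * g (p, q) = q) ∧
      ∀ m, g (-(b₂ * m), b₁ * m) = m := by
  let η : GrMod.self 𝒜 →ₛₗ[ρ] GrMod.self ℬ :=
    { toFun := ρ, map_add' := ρ.map_add, map_smul' := ρ.map_mul }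
  have hη : PreservesBasis η :=
    ⟨Unit, Module.Basis.singleton Unit R, Module.Basis.singleton Unit S, fun _ => 0,
      isHomogeneousBasis_singleton, isHomogeneousBasis_singleton, fun i =>
        (Module.Basis.singleton_apply Unit S i).trans ((congrArg ρ
          (Module.Basis.singleton_apply Unit R i)).trans ρ.map_one).symm⟩
  obtain ⟨C⟩ := H.nonempty_contraction hb₁ hb₂ hη φ hφ ψ hψ hρ
  exact ⟨C.h₁, C.h₂, C.g, C.h₁_smul, C.h₂_smul, C.g_smul, C.h₁_mem, C.h₂_mem, C.g_mem, C.row_h,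
    C.h₁_row, C.h₂_row, C.g_col⟩

/-- A Koszul factorization with rows `(a₁, a₂; 0, 0)`, where `a₁`, `a₂` resolve `S`. -/
theorem nonempty_iso_ofEven {φ : T →+* R}
    (hφ : letI := Module.compHom R φ
      IsFreeGraded (R := T) (M := R) 𝒞 (fun j => (𝒜 j).toAddSubgroup))
    {ψ : T →+* S} (hψ : letI := Module.compHom S ψ
      IsFreeGraded (R := T) (M := S) 𝒞 (fun j => (ℬ j).toAddSubgroup))
    {ρ : R →+* S} (hρ : ∀ r, ρ (φ r) = ψ r) (D : KoszulRows 𝒜 c) (hb₁ : D.b₁ = 0)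
    (hb₂ : D.b₂ = 0) (H : IsKoszulResolution ρ 𝒜 ℬ (-D.a₂) D.a₁ (c - D.κ₂) (c - D.κ₁)) (k : ℤ)
    (h : D.potential = φ 0) :
    Nonempty ((MF.restrict φ hφ (MF.ofEq h (D.mf k))).toHMF ≅
      (MF.ofEven c (((GrMod.self ℬ).restrict ψ hψ).shift (k + D.κ₁ + D.κ₂))).toHMF) := by
  obtain ⟨h₁, h₂, g, h₁_smul, h₂_smul, g_smul, h₁_mem, h₂_mem, g_mem, row_h, h₁_row, h₂_row,
    g_col⟩ := H.exists_ring_contraction (neg_mem D.ha₂) D.ha₁ φ hφ ψ hψ hρ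
  let η' : (GrMod.self 𝒜).restrict φ hφ →ₗ[T] (GrMod.self ℬ).restrict ψ hψ :=
    { toFun := ρ
      map_add' := ρ.map_add
      map_smul' := fun r (x : R) => (ρ.map_mul (φ r) x).trans (congrArg (fun s : S => s * ρ x) (hρ r)) }
  obtain ⟨σ, hσ, ησ⟩ := GrMod.exists_lift (P := (GrMod.self ℬ).restrict ψ hψ) 0 LinearMap.id η'
    (fun j x hx => by
      obtain ⟨y, hy, e⟩ := H.surj j x hx
      exact ⟨y, by rw [add_zero]; exact hy, e⟩)
  let P : MF 𝒞 c 0 := MF.restrict φ hφ (MF.ofEq h (D.mf k))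
  let Q : MF 𝒞 c 0 := MF.ofEven c (((GrMod.self ℬ).restrict ψ hψ).shift (k + D.κ₁ + D.κ₂))
  -- With `b₁ = b₂ = 0` the factorization folds the complex `r ↦ (p, q) ↦ s` with row `(-a₂, a₁)`.
  -- The augmented term is the second even copy, hence the shift by `k + κ₁ + κ₂`.
  have d0 : ∀ r s : R, (D.mat0 R (r, s)) = (D.a₁ * r, D.a₂ * r) := fun r s => by
    rw [D.mat0_apply, hb₁, hb₂]; simp
  have d1 : ∀ p q : R, (D.mat1 R (p, q)) = (0, D.a₁ * q - D.a₂ * p) := fun p q => by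
    rw [D.mat1_apply, hb₁, hb₂]; simp
  let F : MF.Hom P Q :=
    { f0 :=
        { toFun := fun x : R × R => ρ x.2
          map_add' := fun x y : R × R => ρ.map_add x.2 y.2
          map_smul' := fun r (x : R × R) => η'.map_smul r x.2 }
      f1 := 0
      f0_mem := fun j x hx => H.map_mem _ _ hx.2
      f1_mem := fun _ _ _ => zero_mem _
      comm0 := fun _ => rfl
      comm1 := by
        rintro ⟨(p : R), (q : R)⟩
        change (0 : S) = ρ (D.mat1 R (p, q)).2
        have e₁ := H.map_b₁
        rw [map_neg, neg_eq_zero] at e₁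
        rw [d1, map_sub, map_mul, map_mul, e₁, H.map_b₂, zero_mul, zero_mul, sub_zero] }
  let h0 : P.X0 →ₗ[T] P.X1 :=
    { toFun := fun x : R × R => ((h₁ x.2, h₂ x.2) : R × R)
      map_add' := fun x y : R × R => Prod.ext (h₁.map_add x.2 y.2) (h₂.map_add x.2 y.2)
      map_smul' := fun r (x : R × R) => Prod.ext (h₁_smul r x.2) (h₂_smul r x.2) }
  -- The column belonging to the row `(-a₂, a₁)` is `m ↦ (-a₁ m, -a₂ m)`, the negative of the first
  -- differential; hence the sign in front of `g`.
  let h1 : P.X1 →ₗ[T] P.X0 :=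
    { toFun := fun x : R × R => ((-g x, 0) : R × R)
      map_add' := fun x y : R × R => Prod.ext
        ((congrArg Neg.neg (g.map_add x y)).trans (neg_add _ _)) (add_zero (0 : R)).symm
      map_smul' := fun r (x : R × R) => Prod.ext
        ((congrArg Neg.neg (g_smul r x)).trans (smul_neg (φ r) (g x)).symm)
        (smul_zero (φ r)).symm }
  refine MF.nonempty_iso_of_contraction (P := P) (Q := Q) F
    { toFun := fun x : S => ((0, σ x) : R × R)
      map_add' := fun x y : S => Prod.ext (add_zero (0 : R)).symm (σ.map_add x y)
      map_smul' := fun r (x : S) => Prod.ext (smul_zero (φ r)).symm (σ.map_smul r x) } 0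
    (fun j x hx => ⟨zero_mem _, ?_⟩) (fun _ _ _ => zero_mem _) ησ (fun _ => rfl) h0 h1
    (fun j x hx => ⟨?_, ?_⟩) (fun j x hx => ⟨?_, zero_mem _⟩) (fun _ _ => rfl)
    (fun _ _ => map_zero ρ) ?_ ?_
  · have := hσ _ x hx
    rw [add_zero] at this
    exact this
  · have := h₁_mem _ x.2 hx.2
    exact GrMod.mem_of_eq (M := GrMod.self 𝒜) this (by ring)
  · have := h₂_mem _ x.2 hx.2
    exact GrMod.mem_of_eq (M := GrMod.self 𝒜) this (by ring)
  · have := g_mem (j - k - D.κ₁ - D.κ₂ + c) x.1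
      (GrMod.mem_of_eq (M := GrMod.self 𝒜) hx.1 (by ring)) x.2
      (GrMod.mem_of_eq (M := GrMod.self 𝒜) hx.2 (by ring))
    exact (𝒜 _).neg_mem (GrMod.mem_of_eq (M := GrMod.self 𝒜) this (by ring))
  · rintro ⟨(r : R), (s : R)⟩ hs
    have e1 : g (D.a₁ * r, D.a₂ * r) = -r := by
      simpa only [mul_neg, neg_mul, neg_neg] using g_col (-r)
    have e2 : -D.a₂ * h₁ s + D.a₁ * h₂ s = s := row_h s hs
    change ((-g (D.mat0 R (r, s)), 0) : R × R) + D.mat1 R (h₁ s, h₂ s) = (r, s)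
    rw [d0, d1, e1]
    refine Prod.ext (by simp) ?_
    simp only [Prod.mk_add_mk]
    linear_combination e2
  · rintro ⟨(p : R), (q : R)⟩ -
    have e1 : h₁ (-D.a₂ * p + D.a₁ * q) - D.a₁ * g (p, q) = p := h₁_row p q
    have e2 : h₂ (-D.a₂ * p + D.a₁ * q) + -D.a₂ * g (p, q) = q := h₂_row p q
    have e3 : D.a₁ * q - D.a₂ * p = -D.a₂ * p + D.a₁ * q := by ring
    change ((h₁ (D.mat1 R (p, q)).2, h₂ (D.mat1 R (p, q)).2) : R × R) +
      D.mat0 R (-g (p, q), 0) = (p, q)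
    rw [d1, d0, e3]
    refine Prod.ext ?_ ?_
    · simp only [Prod.mk_add_mk]
      linear_combination e1
    · simp only [Prod.mk_add_mk]
      linear_combination e2

end ZeroRows

/-! ### The double loop as the Koszul complex of the partial derivatives. -/

section DoubleLoop

/-- The grading of the Jacobi algebra. -/
def jacobiGrade (n : ℕ) (j : ℤ) : Submodule ℚ (Jacobi (f n (Y ()) (Z ()) : BRing Empty Unit)) :=
  (grade Empty Unit j).map (Ideal.Quotient.mkₐ ℚ (jacobianIdeal (f n (Y ()) (Z ())))).toLinearMap

instance (n : ℕ) : SetLike.GradedMonoid (jacobiGrade n) where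
  one_mem := ⟨1, SetLike.one_mem_graded (grade Empty Unit), map_one (Ideal.Quotient.mkₐ ℚ _)⟩
  mul_mem := by
    rintro i j _ _ ⟨p, hp, rfl⟩ ⟨q, hq, rfl⟩
    exact ⟨p * q, SetLike.mul_mem_graded hp hq, map_mul (Ideal.Quotient.mkₐ ℚ _) p q⟩

/-- The rows of the double loop. -/
abbrev loopRows (n : ℕ) : KoszulRows (grade (Empty ⊕ Empty) (Empty ⊕ Unit)) (n + 1) :=
  fRows n (Y (Sum.inr ())) (Z (Sum.inr ())) (Y (Sum.inr ())) (Z (Sum.inr ())) (Y_mem _) (Z_mem _)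
    (Y_mem _) (Z_mem _)

/-- The projection to the Jacobi algebra. -/
def toJacobi (n : ℕ) : BRing (Empty ⊕ Empty) (Empty ⊕ Unit) →+*
    Jacobi (f n (Y ()) (Z ()) : BRing Empty Unit) :=
  (Ideal.Quotient.mk _).comp innerHom

theorem toInner_derivY (n : ℕ) : toInner (derivY n) = (loopRows n).a₁ := by
  simp only [derivY, fQuotFst, map_quotFst, toInner, relabel_Y, relabel_Z]
  rfl

theorem toInner_derivZ (n : ℕ) : toInner (derivZ n) = (loopRows n).a₂ := by
  simp only [derivZ, fQuotSnd, map_quotSnd, toInner, relabel_Y, relabel_Z]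
  rfl

/-- The Jacobian ideal is generated by the two difference quotients, rewritten with the row `(-a₂,
a₁)` of the folded complex. -/
theorem toJacobi_eq_zero {n : ℕ} {r : BRing (Empty ⊕ Empty) (Empty ⊕ Unit)} :
    toJacobi n r = 0 ↔ ∃ p q, -(loopRows n).a₂ * p + (loopRows n).a₁ * q = r := by
  rw [toJacobi, RingHom.comp_apply, Ideal.Quotient.eq_zero_iff_mem, jacobianIdeal_f,
    Ideal.mem_span_pair]
  constructor
  · rintro ⟨p, q, e⟩
    refine ⟨-toInner q, toInner p, ?_⟩
    rw [← toInner_innerHom r, ← e, map_add, map_mul, map_mul, toInner_derivY, toInner_derivZ]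
    ring
  · rintro ⟨p, q, rfl⟩
    refine ⟨innerHom q, -innerHom p, ?_⟩
    rw [← toInner_derivY, ← toInner_derivZ, map_add, map_mul, map_mul, map_neg, innerHom_toInner,
      innerHom_toInner]
    ring

theorem completeSum_two_one : ∀ k, completeSum (2 : ℚ) 1 k = k
  | 0 => by simp [completeSum]
  | 1 => by simp [completeSum]
  | k + 2 => by
    rw [completeSum, completeSum_two_one (k + 1), completeSum_two_one k]
    push_cast; ring

/-- Evaluation at `y = 2`, `z = 1`, where both roots equal `1` and `completeSum` counts monomials,
gives `(n + 1)²` and `-(n + 1) n`. The second value is the reason for `n ≠ 0`. -/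
theorem loopRows_ne_zero {n : ℕ} (hn : n ≠ 0) : (loopRows n).a₁ ≠ 0 ∧ (loopRows n).a₂ ≠ 0 := by
  let φ : BRing (Empty ⊕ Empty) (Empty ⊕ Unit) →+* ℚ :=
    MvPolynomial.eval fun v => match v with
      | .y _ => 2
      | _ => 1
  have hy : φ (Y (Sum.inr ())) = 2 := MvPolynomial.eval_X _
  have hz : φ (Z (Sum.inr ())) = 1 := MvPolynomial.eval_X _
  constructor
  · intro h
    have h' := congrArg φ h
    change φ (quotFst _ _ _ _) = φ 0 at h'
    rw [map_quotFst, hy, hz, quotFst_self, completeSum_two_one, map_zero, mul_self_eq_zero] at h'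
    exact n.succ_ne_zero (Nat.cast_eq_zero.1 h')
  · intro h
    have h' := congrArg φ h
    change φ (quotSnd _ _ _ _) = φ 0 at h'
    rw [map_quotSnd, hy, hz, quotSnd_self, completeSum_two_one, map_zero, neg_eq_zero,
      mul_eq_zero, Nat.cast_eq_zero, Nat.cast_eq_zero] at h'
    exact h'.elim n.succ_ne_zero hn

theorem toJacobi_resolution {n : ℕ} (hn : n ≠ 0) :
    IsKoszulResolution (toJacobi n) (grade _ _) (jacobiGrade n) (-(loopRows n).a₂) (loopRows n).a₁
      (n + 1 - (loopRows n).κ₂) (n + 1 - (loopRows n).κ₁) := by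
  have m₁ := (loopRows n).ha₁
  have m₂ : -(loopRows n).a₂ ∈ grade _ _ _ := neg_mem (loopRows n).ha₂
  have rel : IsRelPrime (loopRows n).a₁ (loopRows n).a₂ :=
    isRelPrime_fQuot (isRelPrime_X_X (by simp)) n
  have hne := loopRows_ne_zero hn
  refine ⟨?_, ?_, ?_, ?_, ?_, ?_, ?_⟩
  · exact fun j r hr => ⟨_, relabel_mem _ _ j r hr, rfl⟩
  · rintro j _ ⟨r, hr, rfl⟩
    refine ⟨toInner r, relabel_mem _ _ j r hr, ?_⟩
    rw [toJacobi, RingHom.comp_apply, innerHom_toInner]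
    rfl
  · intro j r hr h0
    obtain ⟨p, q, e⟩ := toJacobi_eq_zero.1 h0
    refine ⟨_, MvPolynomial.weightedHomogeneousComponent_mem _ p _, _,
      MvPolynomial.weightedHomogeneousComponent_mem _ q _, ?_⟩
    rw [← weightedHomogeneousComponent_mul_of_mem _ m₂,
      ← weightedHomogeneousComponent_mul_of_mem _ m₁, ← map_add, e,
      MvPolynomial.weightedHomogeneousComponent_eq_self hr]
  · intro j p hp q hq e
    have e' : (loopRows n).a₁ * q = (loopRows n).a₂ * p := by linear_combination e
    -- Coprimality replaces the substitution argument: `a₁` divides `a₂ p`, hence `p`. The syzygy is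
    -- then a suitable component of `-m`.
    obtain ⟨m, rfl⟩ := rel.dvd_of_dvd_mul_left ⟨q, e'.symm⟩
    have hq' : q = (loopRows n).a₂ * m := mul_left_cancel₀ hne.1 (by rw [e']; ring)
    refine ⟨_, MvPolynomial.weightedHomogeneousComponent_mem _ (-m) _, ?_, ?_⟩
    · rw [← sub_sub, ← weightedHomogeneousComponent_mul_of_mem _ m₁,
        ← map_neg, mul_neg, neg_neg, MvPolynomial.weightedHomogeneousComponent_eq_self hp]
    · rw [← sub_sub, sub_right_comm, ← weightedHomogeneousComponent_mul_of_mem _ m₂, neg_mul_neg,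
        ← hq', MvPolynomial.weightedHomogeneousComponent_eq_self hq]
  · exact fun m hm => (mul_eq_zero.1 hm).resolve_left (neg_ne_zero.2 hne.2)
  · exact toJacobi_eq_zero.2 ⟨1, 0, by ring⟩
  · exact toJacobi_eq_zero.2 ⟨0, 1, by ring⟩

theorem nonempty_doubleLoop_iso {n : ℕ} (hn : n ≠ 0) :
    Nonempty ((doubleLoop n).toHMF ≅ (jacobiFactorization n).toHMF) := by
  let θ : BRing Empty (Fin 2) →+* BRing (Empty ⊕ Empty) (Empty ⊕ Unit) :=
    relabel Empty.elim (fun _ => Sum.inr ())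
  let E := fRows (S := Empty) (D := Fin 2) n (Y 0) (Z 0) (Y 1) (Z 1) (Y_mem 0) (Z_mem 0)
    (Y_mem 1) (Z_mem 1)
  have hE : E.map θ (relabel_mem _ _) = loopRows n :=
    fRows_map n _ _ _ _ _ _ _ _ _ _ (relabel_Y _ _ 0) (relabel_Z _ _ 0) (relabel_Y _ _ 1)
      (relabel_Z _ _ 1)
  obtain ⟨e⟩ := E.nonempty_extend_gequiv θ (relabel_mem _ _)
    (twoRowEquiv n (Y 0) (Z 0) (Y 1) (Z 1) (Y_mem 0) (Z_mem 0) (Y_mem 1) (Z_mem 1))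
  obtain ⟨e'⟩ := KoszulRows.nonempty_gequiv_of_eq hE 0
  have h0 : (loopRows n).potential = relabel Sum.inl Sum.inl (0 : BRing Empty Empty) := by
    rw [← fRows_potential, sub_self, map_zero]
  obtain ⟨i⟩ := nonempty_iso_ofEven (relabel_free Empty Empty Empty Unit)
    -- The Jacobi algebra is free over the ring of no points, by a basis of monomial classes; this
    -- is the freeness over `T` needed for the contraction.
    (jacobiMod (f n (Y ()) (Z ()) : BRing Empty Unit) (2 * n + 2) (f_mem n)).free
    (ψ := (Ideal.Quotient.mk _).comp (relabel Empty.elim Empty.elim))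
    (ρ := toJacobi n) (ℬ := jacobiGrade n) (fun r => by
      rw [toJacobi, RingHom.comp_apply, RingHom.comp_apply, innerHom, relabel_relabel,
        Subsingleton.elim (Sum.elim id id ∘ Sum.inl) (Empty.elim : Empty → Empty)]
      rfl) (loopRows n) (sub_self _) (sub_self _)
    (toJacobi_resolution hn) 0 h0
  have g : MF.GEquiv ((doubleLine n).relabel Empty.elim (fun _ => Sum.inr ()) :
      MFgr (Empty ⊕ Empty) (Empty ⊕ Unit) (n + 1) _) ((loopRows n).mf 0) := e.trans e'
  obtain ⟨i'⟩ := (((MF.GEquiv.ofEq (by simp [map_f, relabel_Y, relabel_Z]) _).trans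
    (g.trans (MF.GEquiv.ofEq h0 _).symm)).restrict (relabel Sum.inl Sum.inl)
      (relabel_free Empty Empty Empty Unit)).nonempty_iso
  -- The copy of the ring that survives is the one in Koszul degree two, whose shift is `κ₁ + κ₂`.
  have hk : (0 : ℤ) + (loopRows n).κ₁ + (loopRows n).κ₂ = 4 - 2 * n := by
    change (0 : ℤ) + (1 - n) + (3 - n) = _
    ring
  rw [hk] at i
  exact ⟨i'.trans i⟩

end DoubleLoop

end
end MOY

theorem proposition3p2 (n : ℕ) (hn : 3 ≤ n) :
    (∀ (S D : Type) (ω : BRing S D)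
      (M : MFgr S (D ⊕ Unit) (n + 1)
        (f n (Y (Sum.inr ())) (Z (Sum.inr ())) - relabel id Sum.inl ω)),
      Nonempty ((prolongOut n ω M).toHMF ≅ M.toHMF)) ∧
    (∀ (S D : Type) (ω : BRing S D)
      (M : MFgr S (D ⊕ Unit) (n + 1)
        (relabel id Sum.inl ω - f n (Y (Sum.inr ())) (Z (Sum.inr ())))),
      Nonempty ((prolongIn n ω M).toHMF ≅ M.toHMF)) ∧
    Nonempty ((doubleLoop n).toHMF ≅ (jacobiFactorization n).toHMF) ∧
    Nonempty ((bubble n).toHMF ≅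
      (((doubleLine n).shift (-1)).prod ((doubleLine n).shift 1)).toHMF) ∧
    Nonempty ((mergeSplit n).toHMF ≅ (wideEdge n).toHMF) :=
  ⟨fun _ _ ω M => nonempty_prolongOut_iso n ω M, fun _ _ ω M => nonempty_prolongIn_iso n ω M,
    nonempty_doubleLoop_iso (by lia), nonempty_bubble_iso n, nonempty_mergeSplit_iso n⟩
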